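/- **Model.** We use a unit-cost word-RAM with word length $w$. Words are the integers in $[0,2^w)$. The machine has a fixed number of registers, a zero-initialized work memory of words addressed by words, two read-only input arrays (pattern and text), and a write-only output. Its instructions are: loading a constant; addition, subtraction and multiplication modulo $2^w$, integer division and remainder; bitwise and, or, xor; shifts; loads and stores; reading an input word; reporting a word; and jumps, unconditional or conditional on $=$ or $<$. Every instruction takes one unit of time. Space is the number of registers plus the number of work-memory cells up to the largest address accessed; input and output are not counted. The program is a fixed finite list of instructions. **Input.** $P$ and $Q$ are strings of lengths $m$ and $n$, with $1\le m\le n$ and $n\ge 2$, over the alphabet $\{0,\dots,\sigma-1\}$, $\sigma\ge 2$. They are given in packed representation: $k$ characters per word, each in a field of $\lceil\log_2\sigma\rceil$ bits. The numbers $n$, $m$, $\lceil \log_2\sigma\rceil$ and $k$ are initially in registers. The word length is $w=\Theta(\log n)$ and large enough to hold $n$, that is, $n<2^w$ and $w\le b\log_2 n$ for a constant $b$. Each word holds $k=\Theta(\log n/\log\sigma)$ characters, that is, $\kappa\log_\sigma n\le k$ for a constant $\kappa>0$, and $k\lceil\log_2\sigma\rceil\le w$. **Theorem.** For all constants $0<\varepsilon<1$,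 $b$ and $\kappa>0$ there are a program and a constant $C$ such that the following holds for all $n,m,\sigma,w,k$ and all strings $P,Q$ as above. The program halts, having reported every position of $Q$ at which an occurrence of $P$ starts exactly once and nothing else, in time at most $$C\left(\frac{n}{\log_\sigma n}+m+\mathrm{occ}\right)$$ and space at most $C\,(n^{\varepsilon}+m)$ words, where $\mathrm{occ}$ is the number of occurrences of $P$ in $Q$. -/

import Mathlib

namespace WordRAM

/-- The binary operations of the processor. -/
inductive BinOp where
  | add | sub | mul | div | mod | land | lor | xor | shl | shr

/-- Result of an operation on words of length `w`; words are the naturals below `2 ^ w`, and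
addition, subtraction, multiplication and left shift are taken modulo `2 ^ w`. -/
def BinOp.eval (w : ℕ) : BinOp → ℕ → ℕ → ℕ
  | .add, a, b => (a + b) % 2 ^ w
  | .sub, a, b => (a + (2 ^ w - b)) % 2 ^ w
  | .mul, a, b => (a * b) % 2 ^ w
  | .div, a, b => (a / b) % 2 ^ w
  | .mod, a, b => (a % b) % 2 ^ w
  | .land, a, b => (a &&& b) % 2 ^ w
  | .lor, a, b => (a ||| b) % 2 ^ w
  | .xor, a, b => (a ^^^ b) % 2 ^ w
  | .shl, a, b => (a <<< b) % 2 ^ w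
  | .shr, a, b => (a >>> b) % 2 ^ w

/-- The two read-only input arrays. -/
inductive Port where
  | pattern | text

/-- Instructions of a machine with `s` registers. All register arguments are direct; the work memory
and the input arrays are addressed through registers. -/
inductive Instr (s : ℕ) where
  /-- `reg d := c` (reduced modulo `2 ^ w`) -/
  | const (d : Fin s) (c : ℕ)
  /-- `reg d := reg a ∘ reg b` -/
  | op (f : BinOp) (d a b : Fin s)
  /-- `reg d := mem[reg a]` -/
  | load (d a : Fin s)
  /-- `mem[reg a] := reg b` -/
  | store (a b : Fin s)
  /-- `reg d := input[reg a]`, for one of the input arrays -/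
  | read (x : Port) (d a : Fin s)
  /-- append `reg a` to the output -/
  | report (a : Fin s)
  /-- continue at instruction `l` -/
  | jump (l : ℕ)
  /-- continue at instruction `l` if `reg a = reg b` -/
  | jumpEq (a b : Fin s) (l : ℕ)
  /-- continue at instruction `l` if `reg a < reg b` -/
  | jumpLt (a b : Fin s) (l : ℕ)
  /-- stop -/
  | halt

/-- A program is a finite list of instructions, numbered from `0`. -/
abbrev Program (s : ℕ) := List (Instr s)

/-- A configuration: program counter, registers, work memory, and write-only output. -/
structure Config (s : ℕ) where
  pc : ℕ
  reg : Fin s → ℕ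
  mem : ℕ → ℕ
  out : List ℕ

/-- Assign a value to a register and go on to the next instruction. -/
def Config.set {s : ℕ} (c : Config s) (d : Fin s) (v : ℕ) : Config s :=
  { c with pc := c.pc + 1, reg := Function.update c.reg d v }

/-- The effect of one instruction, for word length `w` and input arrays `input`. -/
def Instr.exec {s : ℕ} (w : ℕ) (input : Port → ℕ → ℕ) (c : Config s) : Instr s → Config s
  | .const d v => c.set d (v % 2 ^ w)
  | .op f d a b => c.set d (f.eval w (c.reg a) (c.reg b))
  | .load d a => c.set d (c.mem (c.reg a))
  | .store a b => { c with pc := c.pc + 1, mem := Function.update c.mem (c.reg a) (c.reg b) }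
  | .read x d a => c.set d (input x (c.reg a))
  | .report a => { c with pc := c.pc + 1, out := c.out ++ [c.reg a] }
  | .jump l => { c with pc := l }
  | .jumpEq a b l => { c with pc := if c.reg a = c.reg b then l else c.pc + 1 }
  | .jumpLt a b l => { c with pc := if c.reg a < c.reg b then l else c.pc + 1 }
  | .halt => c

/-- The instruction to be executed next; running past the end of the program stops the machine. -/
def current {s : ℕ} (prog : Program s) (c : Config s) : Instr s :=
  prog.getD c.pc .halt

/-- One step of the computation; it takes one unit of time. Halted configurations are fixed. -/
def step {s : ℕ} (prog : Program s) (w : ℕ) (input : Port → ℕ → ℕ) (c : Config s) : Config s :=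
  (current prog c).exec w input c

/-- Initially the parameters are in the first registers; all else is zero or empty. -/
def initial (s : ℕ) (params : List ℕ) : Config s where
  pc := 0
  reg i := params.getD i 0
  mem _ := 0
  out := []

/-- The configuration after `t` steps. -/
def run {s : ℕ} (prog : Program s) (w : ℕ) (input : Port → ℕ → ℕ) (params : List ℕ) (t : ℕ) :
    Config s :=
  (step prog w input)^[t] (initial s params)

/-- The machine has stopped. -/
def Halted {s : ℕ} (prog : Program s) (c : Config s) : Prop :=
  current prog c = .halt

/-- The next instruction reads or writes the cell `x` of the work memory. -/
def Accesses {s : ℕ} (prog : Program s) (c : Config s) (x : ℕ) : Prop :=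
  match current prog c with
  | .load _ a => c.reg a = x
  | .store a _ => c.reg a = x
  | _ => False

/-- The whole computation fits into `S` words: the `s` registers together with all cells of the
work memory up to the largest address that is ever accessed. Input and output do not count. -/
def SpaceWithin {s : ℕ} (prog : Program s) (w : ℕ) (input : Port → ℕ → ℕ) (params : List ℕ)
    (S : ℕ) : Prop :=
  s ≤ S ∧ ∀ t x, Accesses prog (run prog w input params t) x → s + (x + 1) ≤ S

end WordRAM

namespace PackedMatching

/-- Word number `j` of the packed representation of `A` with `k` characters per word, each in a
field of `⌈log₂ σ⌉` bits, the first character lowest; unused fields are zero. -/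
def packed {σ : ℕ} (k : ℕ) (A : List (Fin σ)) (j : ℕ) : ℕ :=
  ∑ i ∈ Finset.range k, (A.map Fin.val).getD (j * k + i) 0 * 2 ^ (Nat.clog 2 σ * i)

/-- The input arrays: packed pattern and packed text. -/
def packedInput {σ : ℕ} (k : ℕ) (P Q : List (Fin σ)) : WordRAM.Port → ℕ → ℕ
  | .pattern => packed k P
  | .text => packed k Q

/-- The numbers that describe the input format: the lengths of the text and of the pattern, the
number of bits per character and the number of characters per word. -/
def parameters {σ : ℕ} (k : ℕ) (P Q : List (Fin σ)) : List ℕ :=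
  [Q.length, P.length, Nat.clog 2 σ, k]

/-- The positions (counted from `0`) at which an occurrence of `P` in `Q` starts. -/
def occurrences {σ : ℕ} (P Q : List (Fin σ)) : Finset ℕ :=
  {i ∈ Finset.range (Q.length + 1) | P <+: Q.drop i}

/-- On this input the program stops after at most `T` steps, using at most `S` words of space, and
has then reported every occurrence of `P` in `Q` exactly once, and nothing else. -/
def SolvesWithin {s : ℕ} (prog : WordRAM.Program s) (w : ℕ) {σ : ℕ} (k : ℕ) (P Q : List (Fin σ))
    (T S : ℕ) : Prop :=
  let final := WordRAM.run prog w (packedInput k P Q) (parameters k P Q) T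
  WordRAM.Halted prog final ∧
  WordRAM.SpaceWithin prog w (packedInput k P Q) (parameters k P Q) S ∧
  final.out.Nodup ∧ final.out.toFinset = occurrences P Q

end PackedMatching

/-!
The search reads blocks of `t = k / 2 ^ a` characters. Before each block it knows the leftmost
alignment of the pattern that agrees with the text read so far and that has not been settled. By
the theory of borders, the other such alignments are its shifts by periods of the matched prefix,
and the periods below `t` fit into a bit mask. Which of these short shifts survives the next block
depends only on the mask, the `2 * t` characters of the pattern around the end of the matched
prefix, the block, and the number, capped at `t`, of pattern characters still to be matched. A
table indexed by these data therefore yields the first surviving shift in constant time; a second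
table yields the alignments that start inside the block. If no short shift survives, the search
falls back to the longest border whose period is at least `t`, which moves the alignment by at
least `t`. So every round of constant time passes a block, settles a full match, or moves the
alignment by `t`, and the search takes time `O(n / t + m + occ)`. The table indices have
`O(t * log σ)` bits, so for large `a` filling the tables takes time `O(n ^ (ε / 2))`. For words of
fewer than `2 ^ a` characters, and for patterns longer than `n / 16`, the Knuth–Morris–Pratt
algorithm meets the bounds already.
-/

/-! ### A structured language over the word RAM -/

namespace WordRAM

section Commands

/-- The state of a structured program: registers named by `V`, work memory and output. -/
structure Store (V : Type) where
  reg : V → ℕ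
  mem : ℕ → ℕ
  out : List ℕ

/-- The machine instructions that do not jump, with registers named by `V`. -/
inductive Basic (V : Type) where
  | const (d : V) (c : ℕ)
  | op (f : BinOp) (d a b : V)
  | load (d a : V)
  | store (a b : V)
  | read (x : Port) (d a : V)
  | report (a : V)

/-- The two conditions on which the machine can branch. -/
inductive Cond (V : Type) where
  | eq (a b : V)
  | lt (a b : V)

/-- Structured programs, in which the search algorithm is written; `Com.compile` turns them into
machine code. -/
inductive Com (V : Type) where
  | block (l : List (Basic V))
  | seq (a b : Com V)
  | ite (q : Cond V) (a b : Com V)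
  | loop (q : Cond V) (a : Com V)

/-- What a program cannot change: the word length, the input arrays, and the number `bound` of cells
of the work memory that it may access. -/
structure Env where
  w : ℕ
  input : Port → ℕ → ℕ
  bound : ℕ

variable {V : Type}

/-- Assignment to a register. -/
def Store.set [DecidableEq V] (st : Store V) (d : V) (v : ℕ) : Store V :=
  { st with reg := Function.update st.reg d v }

/-- The effect of an instruction. -/
def Basic.exec [DecidableEq V] (E : Env) (st : Store V) : Basic V → Store V
  | .const d v => st.set d (v % 2 ^ E.w)
  | .op f d a b => st.set d (f.eval E.w (st.reg a) (st.reg b))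
  | .load d a => st.set d (st.mem (st.reg a))
  | .store a b => { st with mem := Function.update st.mem (st.reg a) (st.reg b) }
  | .read x d a => st.set d (E.input x (st.reg a))
  | .report a => { st with out := st.out ++ [st.reg a] }

/-- The instruction respects the bound on the work memory. -/
def Basic.Safe (E : Env) (st : Store V) : Basic V → Prop
  | .load _ a => st.reg a < E.bound
  | .store a _ => st.reg a < E.bound
  | _ => True

/-- The effect of a sequence of instructions. -/
def execAll [DecidableEq V] (E : Env) : List (Basic V) → Store V → Store V
  | [], st => st
  | i :: l, st => execAll E l (i.exec E st)

/-- All instructions of a sequence respect the bound on the work memory. -/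
def SafeAll [DecidableEq V] (E : Env) : List (Basic V) → Store V → Prop
  | [], _ => True
  | i :: l, st => i.Safe E st ∧ SafeAll E l (i.exec E st)

/-- The condition is true. -/
def Cond.Holds (st : Store V) : Cond V → Prop
  | .eq a b => st.reg a = st.reg b
  | .lt a b => st.reg a < st.reg b

attribute [simp] Store.set Basic.exec Basic.Safe execAll SafeAll Cond.Holds

/-- Big-step semantics: `Runs E c st T st'` says that `c` leads from `st` to `st'` in exactly `T`
steps of the compiled program. -/
inductive Runs [DecidableEq V] (E : Env) : Com V → Store V → ℕ → Store V → Prop where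
  | block (l st) : SafeAll E l st → Runs E (.block l) st l.length (execAll E l st)
  | seq {a b st st' st'' T T'} : Runs E a st T st' → Runs E b st' T' st'' →
      Runs E (.seq a b) st (T + T') st''
  | iteTrue {q a b st st' T} : Cond.Holds st q → Runs E a st T st' →
      Runs E (.ite q a b) st (1 + T) st'
  | iteFalse {q a b st st' T} : ¬ Cond.Holds st q → Runs E b st T st' →
      Runs E (.ite q a b) st (1 + T + 1) st'
  | loopEnd {q a st} : ¬ Cond.Holds st q → Runs E (.loop q a) st 2 st
  | loopStep {q a st st' st'' T T'} : Cond.Holds st q → Runs E a st T st' →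
      Runs E (.loop q a) st' T' st'' → Runs E (.loop q a) st (1 + T + 1 + T') st''

end Commands

section Compile

variable {V : Type} {s : ℕ} (e : V ≃ Fin s)

/-- The number of instructions of the compiled program. -/
def Com.size : Com V → ℕ
  | .block l => l.length
  | .seq a b => a.size + b.size
  | .ite _ a b => b.size + a.size + 2
  | .loop _ a => a.size + 3

/-- The machine instruction for an instruction that does not jump. -/
def Basic.compile : Basic V → Instr s
  | .const d v => .const (e d) v
  | .op f d a b => .op f (e d) (e a) (e b)
  | .load d a => .load (e d) (e a)
  | .store a b => .store (e a) (e b)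
  | .read x d a => .read x (e d) (e a)
  | .report a => .report (e a)

/-- The jump to instruction `l` under a condition. -/
def Cond.compile (l : ℕ) : Cond V → Instr s
  | .eq a b => .jumpEq (e a) (e b) l
  | .lt a b => .jumpLt (e a) (e b) l

/-- The machine code of a command, to be placed at instruction number `pc`. -/
def Com.compile : Com V → ℕ → Program s
  | .block l, _ => l.map (Basic.compile e)
  | .seq a b, pc => a.compile pc ++ b.compile (pc + a.size)
  | .ite q a b, pc =>
      q.compile e (pc + 1 + b.size + 1) :: (b.compile (pc + 1) ++
        .jump (pc + 1 + b.size + 1 + a.size) :: a.compile (pc + 1 + b.size + 1))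
  | .loop q a, pc =>
      q.compile e (pc + 1 + 1) :: .jump (pc + 1 + 1 + a.size + 1) ::
        (a.compile (pc + 1 + 1) ++ [.jump pc])

theorem Com.length_compile (c : Com V) (pc : ℕ) : (c.compile e pc).length = c.size := by
  induction c generalizing pc with
  | block l => simp [Com.compile, Com.size]
  | seq a b iha ihb => simp [Com.compile, Com.size, iha, ihb]
  | ite q a b iha ihb => simp [Com.compile, Com.size, iha, ihb]; omega
  | loop q a ih => simp [Com.compile, Com.size, ih]

/-- The machine configuration that represents a store. -/
def Store.config (st : Store V) (pc : ℕ) : Config s :=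
  ⟨pc, st.reg ∘ e.symm, st.mem, st.out⟩

/-- The program contains `code`, starting at instruction number `pc`. -/
def CodeAt (prog : Program s) (pc : ℕ) (code : Program s) : Prop :=
  ∀ j i, code[j]? = some i → prog[pc + j]? = some i

theorem CodeAt.head {prog code : Program s} {pc : ℕ} {i : Instr s}
    (h : CodeAt prog pc (i :: code)) : prog[pc]? = some i :=
  h 0 i rfl

theorem CodeAt.tail {prog code : Program s} {pc : ℕ} {i : Instr s}
    (h : CodeAt prog pc (i :: code)) : CodeAt prog (pc + 1) code := fun j i' hj => by
  rw [add_assoc, add_comm 1]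
  exact h (j + 1) i' hj

theorem CodeAt.left {prog code code' : Program s} {pc : ℕ} (h : CodeAt prog pc (code ++ code')) :
    CodeAt prog pc code := fun j i hj =>
  h j i (by rw [List.getElem?_append_left (List.getElem?_eq_some_iff.mp hj).1, hj])

theorem CodeAt.right {prog code code' : Program s} {pc : ℕ} (h : CodeAt prog pc (code ++ code')) :
    CodeAt prog (pc + code.length) code' := fun j i hj => by
  rw [add_assoc]
  exact h _ i (by
    rw [List.getElem?_append_right (Nat.le_add_right ..), Nat.add_sub_cancel_left, hj])

/-- `T` steps lead from `c` to `c'`, and they respect the bound on the work memory. -/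
def Reaches (E : Env) (prog : Program s) (c : Config s) (T : ℕ) (c' : Config s) : Prop :=
  (step prog E.w E.input)^[T] c = c' ∧
    ∀ t < T, ∀ x, Accesses prog ((step prog E.w E.input)^[t] c) x → x < E.bound

variable {E : Env} {prog : Program s} {c c' c'' : Config s} {T T' : ℕ}

theorem Reaches.refl (E : Env) (prog : Program s) (c : Config s) : Reaches E prog c 0 c :=
  ⟨rfl, by simp⟩

theorem Reaches.trans (h : Reaches E prog c T c') (h' : Reaches E prog c' T' c'') :
    Reaches E prog c (T + T') c'' := by
  refine ⟨by rw [add_comm, Function.iterate_add_apply, h.1, h'.1], fun t ht x hx => ?_⟩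
  by_cases htT : t < T
  · exact h.2 t htT x hx
  · obtain ⟨u, rfl⟩ := Nat.exists_eq_add_of_le (not_lt.mp htT)
    rw [add_comm, Function.iterate_add_apply, h.1] at hx
    exact h'.2 u (by omega) x hx

theorem Reaches.of_current {i : Instr s} (hi : prog[c.pc]? = some i)
    (h : i.exec E.w E.input c = c')
    (hx : ∀ x, Accesses prog c x → x < E.bound) : Reaches E prog c 1 c' := by
  refine ⟨?_, fun t ht x => ?_⟩
  · simpa [step, current, hi] using h
  · obtain rfl : t = 0 := by omega
    exact hx x

theorem reaches_jump {pc l : ℕ} (h : prog[pc]? = some (.jump l)) (st : Store V) :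
    Reaches E prog (st.config e pc) 1 (st.config e l) :=
  .of_current h rfl (by simp [Accesses, current, Store.config, h])

theorem reaches_compile_cond {q : Cond V} {pc l : ℕ} (h : prog[pc]? = some (q.compile e l))
    (st : Store V) [Decidable (q.Holds st)] :
    Reaches E prog (st.config e pc) 1 (st.config e (if q.Holds st then l else pc + 1)) := by
  refine .of_current h ?_ fun x => ?_
  · cases q <;> simp [Cond.compile, Instr.exec, Store.config] <;> congr
  · cases q <;> simp [Accesses, current, Store.config, h, Cond.compile]

variable [DecidableEq V]

theorem reaches_compile_basic {i : Basic V} {pc : ℕ} (h : prog[pc]? = some (i.compile e))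
    {st : Store V} (hi : i.Safe E st) :
    Reaches E prog (st.config e pc) 1 ((i.exec E st).config e (pc + 1)) := by
  refine .of_current h ?_ fun x hx => ?_
  · cases i <;> simp [Basic.compile, Instr.exec, Store.config, Config.set,
      Function.update_comp_equiv]
  · cases i <;> simp_all [Accesses, current, Store.config, Basic.compile]

theorem reaches_compile_block {l : List (Basic V)} {pc : ℕ}
    (h : CodeAt prog pc (l.map (Basic.compile e))) {st : Store V} (hl : SafeAll E l st) :
    Reaches E prog (st.config e pc) l.length ((execAll E l st).config e (pc + l.length)) := by
  induction l generalizing pc st with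
  | nil => exact .refl ..
  | cons i l ih =>
    have := (reaches_compile_basic e h.head hl.1).trans (ih h.tail hl.2)
    rwa [add_assoc, add_comm 1] at this

theorem Runs.reaches {a : Com V} {st st' : Store V} (h : Runs E a st T st') {pc : ℕ}
    (hp : CodeAt prog pc (a.compile e pc)) :
    Reaches E prog (st.config e pc) T (st'.config e (pc + a.size)) := by
  classical
  induction h generalizing pc with
  | block l st hl => exact reaches_compile_block e hp hl
  | @seq a b _ _ _ _ _ _ _ iha ihb =>
    have hb := hp.right
    rw [Com.length_compile] at hb
    simpa only [Com.size, add_assoc] using (iha hp.left).trans (ihb hb)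
  | @iteTrue q a b st _ _ hq _ ih =>
    have ha := hp.tail.right.tail
    rw [Com.length_compile] at ha
    have hjump := reaches_compile_cond (E := E) e hp.head st
    rw [if_pos hq] at hjump
    convert hjump.trans (ih ha) using 2
    simp only [Com.size]; omega
  | @iteFalse q a b st st' _ hq _ ih =>
    have hend := hp.tail.right.head
    rw [Com.length_compile] at hend
    have hjump := reaches_compile_cond (E := E) e hp.head st
    rw [if_neg hq] at hjump
    convert (hjump.trans (ih hp.tail.left)).trans (reaches_jump e hend st') using 2
    simp only [Com.size]; omega
  | @loopEnd q a st hq =>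
    have hjump := reaches_compile_cond (E := E) e hp.head st
    rw [if_neg hq] at hjump
    convert hjump.trans (reaches_jump e hp.tail.head st) using 2
    simp only [Com.size]; omega
  | @loopStep q a st st' _ _ _ hq _ _ iha ihl =>
    have hback := hp.tail.tail.right.head
    rw [Com.length_compile] at hback
    have hjump := reaches_compile_cond (E := E) e hp.head st
    rw [if_pos hq] at hjump
    exact ((hjump.trans (iha hp.tail.tail.left)).trans (reaches_jump e hback st')).trans (ihl hp)

end Compile

section Frame

variable {V : Type}

/-- The register that an instruction assigns to, if there is one. -/
def Basic.target : Basic V → Option V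
  | .const d _ | .op _ d _ _ | .load d _ | .read _ d _ => some d
  | .store _ _ | .report _ => none

/-- Whether an instruction writes to the work memory. -/
def Basic.isStore : Basic V → Bool
  | .store _ _ => true
  | _ => false

/-- Whether an instruction writes to the output. -/
def Basic.isReport : Basic V → Bool
  | .report _ => true
  | _ => false

/-- The instructions that occur in a command. -/
def Com.basics : Com V → List (Basic V)
  | .block l => l
  | .seq a b => a.basics ++ b.basics
  | .ite _ a b => a.basics ++ b.basics
  | .loop _ a => a.basics

/-- The registers that a command may change. -/
def Com.targets (c : Com V) : List V := c.basics.filterMap Basic.target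

/-- `st'` differs from `st` only where the command `c` can have changed it, judging by the
instructions that occur in `c`. -/
structure Frame (c : Com V) (st st' : Store V) : Prop where
  reg_eq : ∀ r ∉ c.targets, st'.reg r = st.reg r
  mem_eq : c.basics.any Basic.isStore = false → st'.mem = st.mem
  out_eq : c.basics.any Basic.isReport = false → st'.out = st.out

variable {c : Com V} {st st' st'' : Store V}

theorem Frame.reg (h : Frame c st st') (r : V) (hr : r ∉ c.targets := by decide) :
    st'.reg r = st.reg r :=
  h.reg_eq r hr

theorem Frame.mem (h : Frame c st st') (hc : c.basics.any Basic.isStore = false := by decide) :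
    st'.mem = st.mem :=
  h.mem_eq hc

theorem Frame.out (h : Frame c st st') (hc : c.basics.any Basic.isReport = false := by decide) :
    st'.out = st.out :=
  h.out_eq hc

theorem Frame.refl (c : Com V) (st : Store V) : Frame c st st :=
  ⟨fun _ _ => rfl, fun _ => rfl, fun _ => rfl⟩

theorem Frame.trans (h : Frame c st st') (h' : Frame c st' st'') : Frame c st st'' :=
  ⟨fun r hr => (h'.reg r hr).trans (h.reg r hr), fun hc => (h'.mem hc).trans (h.mem hc),
    fun hc => (h'.out hc).trans (h.out hc)⟩

theorem Frame.mono {c' : Com V} (h : Frame c st st') (hc : c.basics ⊆ c'.basics) :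
    Frame c' st st' := by
  refine ⟨fun r hr => h.reg r fun hr' => hr (List.filterMap_subset _ hc hr'), fun h' => h.mem ?_,
    fun h' => h.out ?_⟩
  all_goals
    rw [List.any_eq_false] at h' ⊢
    exact fun i hi => h' i (hc hi)

variable [DecidableEq V]

theorem Basic.frame_exec (E : Env) (i : Basic V) (st : Store V) :
    Frame (.block [i]) st (i.exec E st) := by
  refine ⟨fun r => ?_, ?_, ?_⟩ <;> cases i <;>
    simp +contextual [Com.targets, Com.basics, Basic.target, Basic.isStore, Basic.isReport]

theorem frame_execAll (E : Env) (l : List (Basic V)) (st : Store V) :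
    Frame (.block l) st (execAll E l st) := by
  induction l generalizing st with
  | nil => exact .refl _ _
  | cons i l ih =>
    exact ((i.frame_exec E st).mono (by simp [Com.basics])).trans
      ((ih _).mono (by simp [Com.basics]))

theorem Runs.frame {E : Env} {T : ℕ} (h : Runs E c st T st') : Frame c st st' := by
  induction h with
  | block l st => exact frame_execAll E l st
  | seq _ _ iha ihb =>
    exact (iha.mono (List.subset_append_left ..)).trans (ihb.mono (List.subset_append_right ..))
  | iteTrue _ _ ih => exact ih.mono (List.subset_append_left ..)
  | iteFalse _ _ ih => exact ih.mono (List.subset_append_right ..)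
  | loopEnd => exact .refl _ _
  | loopStep _ _ _ iha ihl => exact Frame.trans ⟨iha.1, iha.2, iha.3⟩ ihl

end Frame

section TotalCorrectness

variable {V : Type} [DecidableEq V] {E : Env} {a b : Com V} {q : Cond V} {st : Store V}
  {P Q : ℕ → Store V → Prop}

/-- The command terminates, and its running time and final store satisfy `Q`. -/
def Ends (E : Env) (c : Com V) (st : Store V) (Q : ℕ → Store V → Prop) : Prop :=
  ∃ T st', Runs E c st T st' ∧ Q T st'

theorem Ends.mono_frame (h : Ends E a st P) (hQ : ∀ T st', P T st' → Frame a st st' → Q T st') :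
    Ends E a st Q := by
  obtain ⟨T, st', hr, hp⟩ := h
  exact ⟨T, st', hr, hQ T st' hp hr.frame⟩

theorem Ends.block {l : List (Basic V)} (hs : SafeAll E l st) (hQ : Q l.length (execAll E l st)) :
    Ends E (.block l) st Q :=
  ⟨_, _, .block l st hs, hQ⟩

theorem Ends.seq (ha : Ends E a st P)
    (hb : ∀ T st', P T st' → Frame a st st' → Ends E b st' fun T' => Q (T + T')) :
    Ends E (.seq a b) st Q := by
  obtain ⟨T, st', hr, hp⟩ := ha
  obtain ⟨T', st'', hr', hq⟩ := hb T st' hp hr.frame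
  exact ⟨_, _, hr.seq hr', hq⟩

theorem Ends.block_seq {l : List (Basic V)} (hs : SafeAll E l st)
    (hb : Ends E b (execAll E l st) fun T => Q (l.length + T)) :
    Ends E (.seq (.block l) b) st Q := by
  obtain ⟨T, st', hr, hq⟩ := hb
  exact ⟨_, _, (Runs.block l st hs).seq hr, hq⟩

theorem Ends.ite (ht : q.Holds st → Ends E a st fun T => Q (1 + T))
    (hf : ¬ q.Holds st → Ends E b st fun T => Q (1 + T + 1)) : Ends E (.ite q a b) st Q := by
  by_cases hq : q.Holds st
  · obtain ⟨T, st', hr, h⟩ := ht hq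
    exact ⟨_, _, .iteTrue hq hr, h⟩
  · obtain ⟨T, st', hr, h⟩ := hf hq
    exact ⟨_, _, .iteFalse hq hr, h⟩

/-- The potential `μ` pays for every round, including its two jumps. -/
theorem Ends.loop {I : Store V → Prop} (μ : Store V → ℕ) (h₀ : I st)
    (hround : ∀ st', Frame a st st' → I st' → q.Holds st' →
      Ends E a st' fun T st'' => I st'' ∧ μ st'' + T + 2 ≤ μ st') :
    Ends E (.loop q a) st fun T st' => I st' ∧ ¬ q.Holds st' ∧ T + μ st' ≤ μ st + 2 := by
  suffices h : ∀ φ st', μ st' = φ → Frame a st st' → I st' → Ends E (.loop q a) st'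
      fun T st'' => I st'' ∧ ¬ q.Holds st'' ∧ T + μ st'' ≤ φ + 2 from h _ st rfl (.refl _ _) h₀
  intro φ
  induction φ using Nat.strong_induction_on with
  | _ φ ih =>
    rintro st' rfl hframe hI
    by_cases hq : q.Holds st'
    · obtain ⟨T, st₁, hr, hI₁, hT⟩ := hround st' hframe hI hq
      obtain ⟨T', st₂, hr', hI₂, hq₂, hT'⟩ :=
        ih (μ st₁) (by omega) st₁ rfl (hframe.trans hr.frame) hI₁
      exact ⟨_, _, .loopStep hq hr hr', hI₂, hq₂, by omega⟩
    · exact ⟨2, st', .loopEnd hq, hI, hq, by omega⟩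

end TotalCorrectness

theorem run_eq_of_halted {s : ℕ} {prog : Program s} {w : ℕ} {input : Port → ℕ → ℕ}
    {params : List ℕ} {t t' : ℕ} (h : Halted prog (run prog w input params t)) (ht : t ≤ t') :
    run prog w input params t' = run prog w input params t := by
  obtain ⟨u, rfl⟩ := Nat.exists_eq_add_of_le' ht
  have hfix : step prog w input (run prog w input params t) = run prog w input params t := by
    rw [step, h]; rfl
  rw [run, Function.iterate_add_apply]
  exact Function.iterate_fixed hfix u

theorem Ends.halted_and_spaceWithin {V : Type} [DecidableEq V] {s : ℕ} (e : V ≃ Fin s) {E : Env}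
    {a : Com V} {params : List ℕ} {Q : ℕ → Store V → Prop}
    (h : Ends E a ⟨fun v => params.getD (e v) 0, fun _ => 0, []⟩ Q) :
    ∃ T st, Q T st ∧ (∀ T' ≥ T, (run (a.compile e 0) E.w E.input params T').out = st.out ∧
      Halted (a.compile e 0) (run (a.compile e 0) E.w E.input params T')) ∧
      SpaceWithin (a.compile e 0) E.w E.input params (s + E.bound) := by
  obtain ⟨T, st, hr, hq⟩ := h
  obtain ⟨hrun, hsafe⟩ := hr.reaches e (prog := a.compile e 0) (pc := 0) fun j i => by simp
  have hinit : Store.config e ⟨fun v => params.getD (e v) 0, fun _ => 0, []⟩ 0 =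
      initial s params := by
    simp [Store.config, initial, funext_iff]
  rw [hinit] at hrun hsafe
  change run _ _ _ _ T = _ at hrun
  have hhalt : Halted (a.compile e 0) (run (a.compile e 0) E.w E.input params T) := by
    rw [hrun]
    simp [Halted, current, Store.config, Com.length_compile]
  refine ⟨T, st, hq, fun T' hT' => ?_, by omega, fun t x hx => ?_⟩
  · rw [run_eq_of_halted hhalt hT']
    exact ⟨by rw [hrun]; rfl, hhalt⟩
  · by_cases ht : t < T
    · have := hsafe t ht x hx; omega
    · rw [run_eq_of_halted hhalt (by omega), Accesses, hhalt] at hx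
      exact hx.elim

section WordArithmetic

variable {w a b : ℕ}

theorem BinOp.eval_lt {w : ℕ} (f : BinOp) (a b : ℕ) : f.eval w a b < 2 ^ w := by
  cases f <;> exact Nat.mod_lt _ (by positivity)

theorem BinOp.eval_add (h : a + b < 2 ^ w) : BinOp.eval w .add a b = a + b :=
  Nat.mod_eq_of_lt h

theorem BinOp.eval_sub (h : b ≤ a) (ha : a < 2 ^ w) : BinOp.eval w .sub a b = a - b := by
  rw [BinOp.eval, show a + (2 ^ w - b) = a - b + 2 ^ w by omega, Nat.add_mod_right]
  exact Nat.mod_eq_of_lt (by omega)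

theorem BinOp.eval_mul (h : a * b < 2 ^ w) : BinOp.eval w .mul a b = a * b :=
  Nat.mod_eq_of_lt h

theorem BinOp.eval_div (h : a < 2 ^ w) : BinOp.eval w .div a b = a / b :=
  Nat.mod_eq_of_lt ((Nat.div_le_self _ _).trans_lt h)

theorem BinOp.eval_mod (h : a < 2 ^ w) : BinOp.eval w .mod a b = a % b :=
  Nat.mod_eq_of_lt ((Nat.mod_le _ _).trans_lt h)

theorem BinOp.eval_shr (h : a < 2 ^ w) : BinOp.eval w .shr a b = a / 2 ^ b := by
  rw [BinOp.eval, Nat.shiftRight_eq_div_pow]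
  exact Nat.mod_eq_of_lt ((Nat.div_le_self _ _).trans_lt h)

theorem BinOp.eval_shl (h : a * 2 ^ b < 2 ^ w) : BinOp.eval w .shl a b = a * 2 ^ b := by
  rw [BinOp.eval, Nat.shiftLeft_eq]
  exact Nat.mod_eq_of_lt h

theorem BinOp.eval_land (h : a < 2 ^ w) : BinOp.eval w .land a b = a &&& b :=
  Nat.mod_eq_of_lt (Nat.and_le_left.trans_lt h)

/-- This includes `b = w`, where the left shift overflows to `0`. -/
theorem BinOp.eval_sub_eval_shl_one (hw : 1 ≤ w) (h : b ≤ w) :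
    BinOp.eval w .sub (BinOp.eval w .shl 1 b) 1 = 2 ^ b - 1 := by
  have h1 : 1 < 2 ^ w := Nat.one_lt_two_pow (by omega)
  rcases h.lt_or_eq with h | rfl
  · have := Nat.pow_lt_pow_right (a := 2) (by norm_num) h
    rw [eval_shl (by simpa using this), one_mul, eval_sub Nat.one_le_two_pow this]
  · simp only [BinOp.eval, Nat.shiftLeft_eq, one_mul, Nat.mod_self, zero_add]
    exact Nat.mod_eq_of_lt (by omega)

end WordArithmetic

end WordRAM

namespace PackedMatching

open WordRAM

/-! ### Packed characters and alignments -/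

/-- The number whose base-`2 ^ c` digits are `a i, …, a (i + L - 1)`, lowest first. -/
def chunk (c : ℕ) (a : ℕ → ℕ) (i L : ℕ) : ℕ :=
  ∑ r ∈ Finset.range L, a (i + r) * 2 ^ (c * r)

theorem chunk_one (c : ℕ) (a : ℕ → ℕ) (i : ℕ) : chunk c a i 1 = a i := by simp [chunk]

theorem chunk_add (c : ℕ) (a : ℕ → ℕ) (i L L' : ℕ) :
    chunk c a i (L + L') = chunk c a i L + 2 ^ (c * L) * chunk c a (i + L) L' := by
  simp only [chunk, Finset.sum_range_add, Finset.mul_sum]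
  congr 1
  refine Finset.sum_congr rfl fun r _ => ?_
  rw [mul_add, pow_add, add_assoc]; ring

section Chunk

variable {c : ℕ} {a b : ℕ → ℕ}

theorem chunk_lt (ha : ∀ i, a i < 2 ^ c) (i L : ℕ) : chunk c a i L < 2 ^ (c * L) := by
  induction L generalizing i with
  | zero => simp [chunk]
  | succ L ih =>
    rw [chunk_add, chunk_one, mul_add, pow_add, mul_one]
    have h1 := ih i
    have h2 : a (i + L) + 1 ≤ 2 ^ c := ha _
    nlinarith [Nat.zero_le (2 ^ (c * L))]

theorem chunk_mod (ha : ∀ i, a i < 2 ^ c) (i : ℕ) {L L' : ℕ} (h : L ≤ L') :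
    chunk c a i L' % 2 ^ (c * L) = chunk c a i L := by
  obtain ⟨d, rfl⟩ := Nat.exists_eq_add_of_le h
  rw [chunk_add, Nat.add_mul_mod_self_left, Nat.mod_eq_of_lt (chunk_lt ha _ _)]

theorem chunk_div (ha : ∀ i, a i < 2 ^ c) (i : ℕ) {L L' : ℕ} (h : L ≤ L') :
    chunk c a i L' / 2 ^ (c * L) = chunk c a (i + L) (L' - L) := by
  obtain ⟨d, rfl⟩ := Nat.exists_eq_add_of_le h
  rw [chunk_add, Nat.add_mul_div_left _ _ (by positivity), Nat.div_eq_of_lt (chunk_lt ha _ _)]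
  simp

theorem chunk_eq_chunk (ha : ∀ i, a i < 2 ^ c) (hb : ∀ i, b i < 2 ^ c) (i j L : ℕ) :
    chunk c a i L = chunk c b j L ↔ ∀ r < L, a (i + r) = b (j + r) := by
  constructor
  · intro h r hr
    have key : ∀ (a : ℕ → ℕ), (∀ i, a i < 2 ^ c) → ∀ i,
        chunk c a i L / 2 ^ (c * r) % 2 ^ (c * 1) = a (i + r) := by
      intro a ha i
      rw [chunk_div ha _ hr.le, chunk_mod ha _ (by omega), chunk_one]
    rw [← key a ha, ← key b hb, h]
  · intro h
    exact Finset.sum_congr rfl fun r hr => by rw [h r (Finset.mem_range.mp hr)]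

theorem mod_two_pow_div_mod (x : ℕ) {N B L : ℕ} (h : B + L ≤ N) :
    x % 2 ^ N / 2 ^ B % 2 ^ L = x / 2 ^ B % 2 ^ L := by
  apply Nat.eq_of_testBit_eq
  intro j
  simp only [Nat.testBit_mod_two_pow, Nat.testBit_div_two_pow]
  by_cases hj : j < L
  · simp [hj, show j + B < N by omega]
  · simp [hj]

/-- At most two consecutive words of the packed string cover `L ≤ k` characters. -/
theorem fetch_value (ha : ∀ i, a i < 2 ^ c) {w k i L : ℕ} (hk : 1 ≤ k) (hw : k * c ≤ w)
    (hi : i < 2 ^ w) (hL : L ≤ k) :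
    BinOp.eval w .land
      (BinOp.eval w .add
        (BinOp.eval w .shr (chunk c a (i / k * k) k) (c * (i % k)))
        (BinOp.eval w .shl (chunk c a (BinOp.eval w .add (i / k) 1 * k) k) (c * (k - i % k))))
      (2 ^ (c * L) - 1) = chunk c a i L := by
  have hr : i % k < k := Nat.mod_lt _ hk
  have hik : i / k * k + i % k = i := by rw [mul_comm]; exact Nat.div_add_mod i k
  have hcL : c * L ≤ w := by nlinarith
  have hd : 2 ^ (c * L) ∣ 2 ^ w := pow_dvd_pow _ hcL
  have hword : chunk c a (i / k * k) k < 2 ^ w :=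
    (chunk_lt ha _ k).trans_le (Nat.pow_le_pow_right (by norm_num) (by rwa [mul_comm]))
  rw [BinOp.eval_land (BinOp.eval_lt ..), Nat.and_two_pow_sub_one_eq_mod, BinOp.eval_shr hword]
  simp only [BinOp.eval]
  rw [Nat.add_mod_mod, Nat.mod_mod_of_dvd _ hd, Nat.shiftLeft_eq, chunk_div ha _ hr.le, hik]
  rcases Nat.eq_zero_or_pos (i % k) with h0 | h0
  · rw [h0, Nat.sub_zero]
    have : 2 ^ (c * L) ∣ chunk c a ((i / k + 1) % 2 ^ w * k) k * 2 ^ (c * k) :=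
      Dvd.dvd.mul_left (pow_dvd_pow _ (by nlinarith)) _
    rw [Nat.add_mod, Nat.mod_eq_zero_of_dvd this, add_zero, Nat.mod_mod, chunk_mod ha _ hL]
  · have hlt : i / k + 1 < 2 ^ w := by nlinarith [Nat.zero_le (i / k)]
    have hnext : (i / k + 1) * k = i + (k - i % k) := by rw [add_mul]; omega
    rw [Nat.mod_eq_of_lt hlt, hnext, mul_comm (chunk _ _ _ k), ← chunk_add,
      chunk_mod ha _ (by omega)]

end Chunk

/-- The `2 * t` characters around position `q` of `p`, the positions before the start of `p`
being filled with zeros. -/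
def window (c t : ℕ) (p : ℕ → ℕ) (q : ℕ) : ℕ :=
  if q < t then (chunk c p 0 (2 * t) <<< (c * (t - q))) % 2 ^ (c * (2 * t))
  else chunk c p (q - t) (2 * t)

theorem window_lt {c t : ℕ} {p : ℕ → ℕ} (hp : ∀ i, p i < 2 ^ c) (q : ℕ) :
    window c t p q < 2 ^ (c * (2 * t)) := by
  unfold window
  split_ifs
  · exact Nat.mod_lt _ (by positivity)
  · exact chunk_lt hp _ _

theorem window_shift {c t : ℕ} {p : ℕ → ℕ} (hp : ∀ i, p i < 2 ^ c) {q d L : ℕ} (hq : d ≤ q)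
    (hd : d ≤ t) (hL : L ≤ t) :
    window c t p q / 2 ^ (c * (t - d)) % 2 ^ (c * L) = chunk c p (q - d) L := by
  unfold window
  split_ifs with h
  · rw [mod_two_pow_div_mod _ (by rw [← mul_add]; exact Nat.mul_le_mul_left _ (by omega)),
      Nat.shiftLeft_eq]
    have : c * (t - d) = c * (t - q) + c * (q - d) := by rw [← mul_add]; congr 1; omega
    rw [this, pow_add, mul_comm (chunk _ _ _ _), Nat.mul_div_mul_left _ _ (by positivity),
      chunk_div hp _ (by omega), chunk_mod hp _ (by omega), zero_add]
  · rw [chunk_div hp _ (by omega), chunk_mod hp _ (by omega)]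
    congr 1; omega

/-- The pattern `p`, aligned with position `s` of `f`, agrees with `f` before position `i`. -/
def Agrees (p f : ℕ → ℕ) (s i : ℕ) : Prop :=
  s ≤ i ∧ ∀ r, s + r < i → f (s + r) = p r

section Agrees

variable {p f : ℕ → ℕ} {s s' i j : ℕ}

theorem agrees_self (p f : ℕ → ℕ) (i : ℕ) : Agrees p f i i := ⟨le_rfl, fun r hr => by omega⟩

theorem agrees_zero (p : ℕ → ℕ) (i : ℕ) : Agrees p p 0 i := ⟨Nat.zero_le _, fun r _ => by simp⟩

theorem Agrees.anti (h : Agrees p f s i) (hs : s ≤ j) (hj : j ≤ i) : Agrees p f s j :=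
  ⟨hs, fun r hr => h.2 r (by omega)⟩

theorem Agrees.shift_iff (h : Agrees p f s i) (hs : s ≤ s') :
    Agrees p f s' i ↔ Agrees p p (s' - s) (i - s) := by
  obtain ⟨d, rfl⟩ := Nat.exists_eq_add_of_le hs
  obtain ⟨e, rfl⟩ := Nat.exists_eq_add_of_le h.1
  simp only [Agrees, Nat.add_sub_cancel_left]
  refine and_congr (by omega) (forall_congr' fun r => ?_)
  rw [show s + d + r < s + e ↔ d + r < e by omega]
  refine imp_congr_right fun hr => ?_
  rw [add_assoc, h.2 (d + r) (by omega)]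

theorem agrees_add_iff (L : ℕ) (hs : s ≤ i) :
    Agrees p f s (i + L) ↔ Agrees p f s i ∧ ∀ r < L, p (i - s + r) = f (i + r) := by
  constructor
  · intro h
    refine ⟨h.anti hs (by omega), fun r hr => ?_⟩
    have := h.2 (i - s + r) (by omega)
    rw [← this]; congr 1; omega
  · rintro ⟨h, h'⟩
    refine ⟨by omega, fun r hr => ?_⟩
    by_cases hi : s + r < i
    · exact h.2 r hi
    · have := h' (s + r - i) (by omega)
      rw [show i + (s + r - i) = s + r by omega, show i - s + (s + r - i) = r by omega] at this
      exact this.symm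

end Agrees

/-- `v` is the length of the longest border of the prefix of length `q` of `p` that is shorter than
the prefix by at least `o`. -/
def Border (p : ℕ → ℕ) (o q v : ℕ) : Prop :=
  v + o ≤ q ∧ Agrees p p (q - v) q ∧ ∀ s, o ≤ s → s + v < q → ¬ Agrees p p s q

/-- `s`, at distance `q` before position `i`, is an alignment of `p` from `o` on that agrees with
`f` before position `i`, and no earlier alignment from `o` on that reaches position `j` agrees with
`f` before position `j`. -/
structure Candidate (p f : ℕ → ℕ) (m o i j q s : ℕ) : Prop where
  add_eq : s + q = i
  le : o ≤ s
  agrees : Agrees p f s i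
  not_agrees : ∀ s', o ≤ s' → s' < s → j ≤ s' + m → ¬ Agrees p f s' j

section Candidate

variable {p f : ℕ → ℕ} {n m o i j q s v : ℕ}

theorem Border.self (p : ℕ → ℕ) (o : ℕ) : Border p o o 0 :=
  ⟨by omega, by simpa using agrees_self p p o, fun s h h' => by omega⟩

theorem Border.agrees (h : Border p o q v) (hs : s + q = i) (ha : Agrees p f s i) :
    Agrees p f (i - v) i := by
  have := h.1
  rw [ha.shift_iff (by omega), show i - v - s = q - v by omega, show i - s = q by omega]
  exact h.2.1

theorem Border.not_agrees (h : Border p o q v) (hs : s + q = i) (ha : Agrees p f s i) {s' : ℕ}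
    (hss : s + o ≤ s') (hsv : s' < i - v) : ¬ Agrees p f s' i := by
  rw [ha.shift_iff (by omega), show i - s = q by omega]
  exact h.2.2 (s' - s) (by omega) (by omega)

theorem exists_candidate_iff_border (hi : i ≤ m) :
    (∃ s, Candidate p p m o i i q s) ↔ Border p o i q := by
  constructor
  · rintro ⟨s, rfl, h2, h3, h4⟩
    exact ⟨by omega, by simpa using h3, fun s' h h' => h4 s' h (by omega) (by omega)⟩
  · rintro ⟨h1, h2, h3⟩
    exact ⟨i - q, by omega, by omega, h2, fun s' h h' _ => h3 s' h (by omega)⟩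

theorem Candidate.mono {m' : ℕ} (h : Candidate p f m o i j q s) (hm : m' ≤ m) :
    Candidate p f m' o i j q s :=
  ⟨h.add_eq, h.le, h.agrees, fun s' ho hs hj => h.not_agrees s' ho hs (by omega)⟩

theorem Candidate.succ_right (h : Candidate p f (m - 1) o i i q s) :
    Candidate p f m o i (i + 1) q s :=
  ⟨h.add_eq, h.le, h.agrees, fun s' ho hs hj ha =>
    have := h.add_eq
    h.not_agrees s' ho hs (by omega) (ha.anti (by omega) (by omega))⟩

theorem Candidate.extend (h : Candidate p f m o i (i + 1) q s) (heq : p q = f i) :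
    Candidate p f m o (i + 1) (i + 1) (q + 1) s := by
  obtain ⟨rfl, ho, ha, hno⟩ := h
  refine ⟨by omega, ho, ?_, hno⟩
  rw [agrees_add_iff _ (by omega)]
  refine ⟨ha, fun r hr => ?_⟩
  obtain rfl : r = 0 := by omega
  simpa using heq

theorem Candidate.not_agrees_succ (h : Candidate p f m o i j q s) (hne : p q ≠ f i) :
    ¬ Agrees p f s (i + 1) := fun ha =>
  hne (h.add_eq ▸ (ha.2 q (by have := h.add_eq; omega)).symm)

theorem Candidate.restart (h : Candidate p f m o i (i + 1) 0 s) (hne : p 0 ≠ f i) :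
    Candidate p f m o (i + 1) (i + 1) 0 (i + 1) := by
  refine ⟨rfl, by have := h.le; have := h.add_eq; omega, agrees_self .., fun s' ho hs hj => ?_⟩
  rcases (show s' < s ∨ s' = s by have := h.add_eq; omega) with hlt | rfl
  · exact h.not_agrees s' ho hlt hj
  · exact h.not_agrees_succ hne

theorem Candidate.fallBack (h : Candidate p f m o i (i + 1) q s) (hne : p q ≠ f i)
    (hb : Border p 1 q v) : Candidate p f m o i (i + 1) v (i - v) := by
  have hs := h.add_eq
  have hv := hb.1
  refine ⟨by omega, by have := h.le; omega, hb.agrees hs h.agrees, fun s' ho hs' hj => ?_⟩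
  rcases lt_trichotomy s' s with hlt | rfl | hlt
  · exact h.not_agrees s' ho hlt hj
  · exact h.not_agrees_succ hne
  · exact fun ha => hb.not_agrees hs h.agrees hlt hs' (ha.anti (by omega) (by omega))

theorem Candidate.next (h : Candidate p f m o i i m s) (hm : 1 ≤ m) (hb : Border p 1 m v) :
    Candidate p f (m - 1) o i i v (i - v) := by
  have hs := h.add_eq
  have hv := hb.1
  refine ⟨by omega, by have := h.le; omega, hb.agrees hs h.agrees, fun s' _ hs' hj => ?_⟩
  exact hb.not_agrees hs h.agrees (by omega) hs'

end Candidate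

/-- The `d`-th bit of `D` tells whether `d < t` is a period of the prefix of length `q` of `p`. -/
def PeriodMask (p : ℕ → ℕ) (t q D : ℕ) : Prop :=
  ∀ d, D.testBit d ↔ d < t ∧ Agrees p p d q

theorem PeriodMask.lt {p : ℕ → ℕ} {t q D : ℕ} (h : PeriodMask p t q D) : D < 2 ^ t := by
  apply Nat.lt_pow_two_of_testBit
  intro i hi
  rw [← Bool.not_eq_true, h i]
  omega

theorem periodMask_zero {p : ℕ → ℕ} {t : ℕ} (ht : 1 ≤ t) : PeriodMask p t 0 1 := by
  intro d
  rw [Nat.testBit_one_eq_true_iff_self_eq_zero]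
  constructor
  · rintro rfl; exact ⟨ht, agrees_self _ _ _⟩
  · rintro ⟨_, h⟩; exact Nat.le_zero.mp h.1

theorem PeriodMask.of_border {p : ℕ → ℕ} {t q v D w : ℕ} (hw : t ≤ w) (hv : Border p 1 q v)
    (h : PeriodMask p t v D) :
    PeriodMask p t q ((1 ||| (D <<< (q - v)) % 2 ^ w) &&& (2 ^ t - 1)) := by
  intro d
  obtain ⟨h1, h2, h3⟩ := hv
  rw [Nat.and_two_pow_sub_one_eq_mod, Nat.testBit_mod_two_pow, Nat.testBit_or,
    Nat.testBit_mod_two_pow, Nat.testBit_shiftLeft]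
  by_cases hd : d < t
  · simp only [hd, decide_true, Bool.true_and, true_and, show d < w by omega, Bool.or_eq_true,
      Nat.testBit_one_eq_true_iff_self_eq_zero, Bool.and_eq_true, decide_eq_true_eq, ge_iff_le]
    rcases Nat.eq_zero_or_pos d with rfl | h0
    · simp [agrees_zero]
    · by_cases hqv : q - v ≤ d
      · rw [h2.shift_iff hqv, h (d - (q - v)), show q - (q - v) = v by omega]
        constructor
        · rintro (h' | h')
          · omega
          · exact h'.2.2
        · intro h'; exact Or.inr ⟨hqv, by omega, h'⟩
      · constructor
        · rintro (h' | h')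
          · omega
          · exact absurd h'.1 hqv
        · intro h'; exact absurd h' (h3 d h0 (by omega))
  · simp [hd]

/-- `v` is the first number from `lo` on that is at least `t` or satisfies `H`. -/
def IsFirst (H : ℕ → Prop) (lo t v : ℕ) : Prop :=
  v ≤ t ∧ (v < t → lo ≤ v ∧ H v) ∧ ∀ d, lo ≤ d → d < v → ¬ H d

/-- Shifting the pattern by `d`, which is allowed by `D`, makes its window `x` agree with the block
`u`, as far as the pattern reaches; `h` characters are left of it, or more if `h = t`. -/
def ShiftHit (c t h D x u d : ℕ) : Prop :=
  D.testBit d ∧ x / 2 ^ (c * (t - d)) % 2 ^ (c * min t (h + d)) = u % 2 ^ (c * min t (h + d))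

/-- The pattern, which starts with `y`, may start inside the block `u` at offset `d`. -/
def StartHit (c t m y u d : ℕ) : Prop :=
  u / 2 ^ (c * d) % 2 ^ (c * min m (t - d)) = y % 2 ^ (c * min m (t - d))

section Hits

variable {c : ℕ} {p f : ℕ → ℕ}

theorem shiftHit_iff (hp : ∀ i, p i < 2 ^ c) (hf : ∀ i, f i < 2 ^ c) {t m s q i d D : ℕ}
    (hi : s + q = i) (hq : q ≤ m) (hD : PeriodMask p t q D) (hs : Agrees p f s i) (hd : d < t) :
    ShiftHit c t (min t (m - q)) D (window c t p q) (chunk c f i t) d ↔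
      s + d ≤ i ∧ Agrees p f (s + d) (min (i + t) (s + d + m)) := by
  have hL : min t (min t (m - q) + d) ≤ t := min_le_left _ _
  have hmin : d ≤ q → min (i + t) (s + d + m) = i + min t (min t (m - q) + d) := by
    intro _; omega
  unfold ShiftHit
  rw [hD d, chunk_mod hf _ hL]
  constructor
  · rintro ⟨⟨_, h1⟩, h2⟩
    have hdq : d ≤ q := h1.1
    refine ⟨by omega, ?_⟩
    rw [window_shift hp hdq hd.le hL, chunk_eq_chunk hp hf] at h2
    rw [hmin hdq, agrees_add_iff _ (by omega)]
    refine ⟨(hs.shift_iff (by omega)).mpr ?_, fun r hr => ?_⟩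
    · rwa [Nat.add_sub_cancel_left, ← hi, Nat.add_sub_cancel_left]
    · rw [← h2 r hr]; congr 2; omega
  · rintro ⟨h0, h1⟩
    have hdq : d ≤ q := by omega
    rw [hmin hdq, agrees_add_iff _ (by omega)] at h1
    refine ⟨⟨hd, ?_⟩, ?_⟩
    · have := (hs.shift_iff (show s ≤ s + d by omega)).mp h1.1
      rwa [Nat.add_sub_cancel_left, ← hi, Nat.add_sub_cancel_left] at this
    · rw [window_shift hp hdq hd.le hL, chunk_eq_chunk hp hf]
      intro r hr
      rw [← h1.2 r hr]; congr 2; omega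

theorem startHit_iff (hp : ∀ i, p i < 2 ^ c) (hf : ∀ i, f i < 2 ^ c) {t m i d : ℕ} (hd : d ≤ t) :
    StartHit c t m (chunk c p 0 t) (chunk c f i t) d ↔
      Agrees p f (i + d) (min (i + t) (i + d + m)) := by
  have hmin : min (i + t) (i + d + m) = i + d + min m (t - d) := by omega
  unfold StartHit
  rw [hmin, agrees_add_iff _ le_rfl, chunk_div hf _ hd, chunk_mod hf _ (min_le_right _ _),
    chunk_mod hp _ (by omega), eq_comm, chunk_eq_chunk hp hf]
  simp [agrees_self]

end Hits

/-! ### The registers -/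

section Registers

/-- The registers of the search program. The first four hold the parameters of the input. -/
inductive Var where
  | n | m | c | k | zero | one | t | ct | cw | maskC | maskT | maskW | maskD
  | baseD | baseJ | baseT | baseU | head | lim | base
  | f₁ | f₂ | f₃ | q | x | y | go | i | idx | d | res | u | dm | h | lo | len | z | v
  | pos | rem | more | off
  deriving DecidableEq

/-- The numbering of the registers. -/
def Var.equiv : Var ≃ Fin 42 where
  toFun r := ⟨r.ctorIdx, by cases r <;> decide⟩
  invFun i := Var.ofNat i
  left_inv r := by cases r <;> rfl
  right_inv i := by revert i; decide

/-- A matching problem in the environment `E`: the packed pattern `p`, of length `m`, and the packed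
text `f`, of length `n`. Both are infinite sequences, continued in an arbitrary way. -/
structure Problem (E : Env) (n m c k : ℕ) (p f : ℕ → ℕ) : Prop where
  p_lt : ∀ i, p i < 2 ^ c
  f_lt : ∀ i, f i < 2 ^ c
  pattern : ∀ j, E.input .pattern j = chunk c p (j * k) k
  text : ∀ j, E.input .text j = chunk c f (j * k) k
  one_le_c : 1 ≤ c
  one_le_k : 1 ≤ k
  word : k * c ≤ E.w
  one_le_m : 1 ≤ m
  m_le : m ≤ n
  n_lt : n < 2 ^ E.w
  m_lt_bound : m < E.bound
  bound_le : E.bound ≤ 2 ^ E.w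

/-- The registers with the parameters and the basic constants have their intended contents. -/
structure Basics (n m c k : ℕ) (st : Store Var) : Prop where
  reg_n : st.reg .n = n
  reg_m : st.reg .m = m
  reg_c : st.reg .c = c
  reg_k : st.reg .k = k
  reg_zero : st.reg .zero = 0
  reg_one : st.reg .one = 1
  reg_maskC : st.reg .maskC = 2 ^ c - 1

variable {E : Env} {n m c k : ℕ} {p f : ℕ → ℕ} {st : Store Var}

theorem Basics.of_frame {a : Com Var} {st' : Store Var} (h : Basics n m c k st)
    (hF : Frame a st st')
    (ha : ∀ r ∈ [Var.n, .m, .c, .k, .zero, .one, .maskC], r ∉ a.targets := by decide) :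
    Basics n m c k st' := by
  have hreg r (hr : r ∈ [Var.n, .m, .c, .k, .zero, .one, .maskC]) : st'.reg r = st.reg r :=
    hF.reg r (ha r hr)
  constructor
  all_goals rw [hreg _ (by simp)]
  exacts [h.reg_n, h.reg_m, h.reg_c, h.reg_k, h.reg_zero, h.reg_one, h.reg_maskC]

theorem Problem.one_le_w (h : Problem E n m c k p f) : 1 ≤ E.w :=
  (Nat.mul_pos h.one_le_k h.one_le_c).trans_le h.word

/-- Fetch the characters of an input array from position `loc` on that are covered by `mask`. They
are spread over at most two consecutive words. -/
def fetch (x : Port) (dst loc mask : Var) : Com Var :=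
  .block [.op .div .f₁ loc .k, .op .mod .f₂ loc .k, .read x dst .f₁, .op .mul .f₃ .c .f₂,
    .op .shr dst dst .f₃, .op .add .f₁ .f₁ .one, .read x .f₁ .f₁, .op .sub .f₂ .k .f₂,
    .op .mul .f₂ .c .f₂, .op .shl .f₁ .f₁ .f₂, .op .add dst dst .f₁, .op .land dst dst mask]

theorem fetch_ends (hB : Basics n m c k st) {x : Port} (hp : ∀ i, p i < 2 ^ c)
    (hx : ∀ j, E.input x j = chunk c p (j * k) k) (hk : 1 ≤ k) (hc : 1 ≤ c) (hkw : k * c ≤ E.w)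
    {dst loc mask : Var} {i L : ℕ} (hloc : st.reg loc = i) (hi : i < 2 ^ E.w)
    (hmask : st.reg mask = 2 ^ (c * L) - 1) (hL : L ≤ k)
    (h1 : loc ∉ [Var.f₁, .f₂, .f₃] := by decide) (h2 : mask ∉ [dst, Var.f₁, .f₂, .f₃] := by decide)
    (h3 : dst ∉ [Var.f₁, .f₂, .f₃, .k, .c, .one] := by decide) :
    Ends E (fetch x dst loc mask) st fun T st' => T = 12 ∧ st'.reg dst = chunk c p i L := by
  have hmod : i % k < k := Nat.mod_lt _ hk
  have hw : E.w < 2 ^ E.w := Nat.lt_two_pow_self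
  have hlt r (hr : r ≤ k) : c * r < 2 ^ E.w := by nlinarith
  have hkw' : k < 2 ^ E.w := by nlinarith
  have e1 := hlt (i % k) hmod.le
  have e2 := hlt (k - i % k) (Nat.sub_le _ _)
  simp only [List.mem_cons, List.not_mem_nil, or_false, not_or, ← ne_eq] at h1 h2 h3
  refine .block (by simp) ⟨rfl, ?_⟩
  simp [h1, h2, h3, h3.1.symm, h3.2.1.symm,
    h3.2.2.2.1.symm, h3.2.2.2.2.1.symm, h3.2.2.2.2.2.symm, hB.reg_k, hB.reg_c, hB.reg_one, hloc,
    hmask, hx, BinOp.eval_div hi, BinOp.eval_mod hi, BinOp.eval_mul e1,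
    BinOp.eval_sub hmod.le hkw', BinOp.eval_mul e2, fetch_value hp hk hkw hi hL]

theorem fetch_char_ends (hB : Basics n m c k st) (hI : Problem E n m c k p f) {g : ℕ → ℕ}
    {x : Port} (hg : ∀ i, g i < 2 ^ c) (hx : ∀ j, E.input x j = chunk c g (j * k) k)
    {dst loc : Var} {i : ℕ} (hloc : st.reg loc = i) (hi : i < 2 ^ E.w)
    (h1 : loc ∉ [Var.f₁, .f₂, .f₃] := by decide)
    (h2 : Var.maskC ∉ [dst, Var.f₁, .f₂, .f₃] := by decide)
    (h3 : dst ∉ [Var.f₁, .f₂, .f₃, .k, .c, .one] := by decide) :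
    Ends E (fetch x dst loc .maskC) st fun T st' => T = 12 ∧ st'.reg dst = g i := by
  simpa only [chunk_one] using fetch_ends (L := 1) hB hg hx hI.one_le_k hI.one_le_c hI.word hloc hi
    (by rw [mul_one, hB.reg_maskC]) hI.one_le_k h1 h2 h3

end Registers

/-! ### Borders and short periods -/

section Borders

variable {E : Env} {n m c k : ℕ} {p f g : ℕ → ℕ} {st : Store Var} {o i s : ℕ}

/-- Compare the character `x` with the pattern character at `q`; on a mismatch, fall back to the
longest border. `go` is cleared when the character has been processed. -/
def advanceRound : Com Var :=
  .seq (fetch .pattern .y .q .maskC)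
    (.ite (.eq .y .x) (.block [.op .add .q .q .one, .const .go 0])
      (.ite (.eq .q .zero) (.block [.const .go 0]) (.block [.load .q .q])))

/-- One step of the Knuth–Morris–Pratt automaton: read the character `x` in the state `q < m`, with
the failure function at address `0`. -/
def advance : Com Var :=
  .seq (.block [.const .go 1]) (.loop (.lt .zero .go) advanceRound)

/-- The invariant of `advance`: the next character of the best remaining alignment is to be compared
with the character of the text at position `i`, or this has already succeeded. -/
def AdvanceInv (p g : ℕ → ℕ) (m o i q : ℕ) (st : Store Var) : Prop :=
  (st.reg .go = 1 ∧ st.reg .q ≤ q ∧ ∃ s, Candidate p g m o i (i + 1) (st.reg .q) s) ∨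
  (st.reg .go = 0 ∧ st.reg .q ≤ m ∧ ∃ s, Candidate p g m o (i + 1) (i + 1) (st.reg .q) s)

theorem advanceRound_ends (hI : Problem E n m c k p f) (hB : Basics n m c k st)
    (hx : st.reg .x = g i) (hgo : st.reg .go = 1) (hqm : st.reg .q < m)
    (hcand : Candidate p g m o i (i + 1) (st.reg .q) s)
    (hπ : 1 ≤ st.reg .q → Border p 1 (st.reg .q) (st.mem (st.reg .q))) :
    Ends E advanceRound st fun T st' => AdvanceInv p g m o i (st.reg .q) st' ∧
      20 * st'.reg .q + 40 * st'.reg .go + T + 2 ≤ 20 * st.reg .q + 40 := by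
  have hmw : m < 2 ^ E.w := hI.m_le.trans_lt hI.n_lt
  refine (fetch_char_ends hB hI hI.p_lt hI.pattern rfl (hqm.trans hmw)).seq ?_
  rintro T st₁ ⟨rfl, hy⟩ hF
  have hB₁ := hB.of_frame hF
  have hx₁ : st₁.reg .x = g i := (hF.reg .x).trans hx
  have hq₁ := hF.reg .q
  refine .ite (fun heq => .block (by simp) ?_) fun hne => .ite (fun h0 => .block (by simp) ?_)
    fun h0 => .block ?_ ?_
  · have hadd := BinOp.eval_add (w := E.w) (a := st.reg .q) (b := 1) (by omega)
    have hnext := hcand.extend (by simpa [hy, hx₁] using heq)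
    constructor
    · simpa [AdvanceInv, hq₁, hB₁.reg_one, hadd] using ⟨hqm, s, hnext⟩
    · simp only [List.length, execAll, Basic.exec, Store.set, hq₁, hB₁.reg_one, hadd]
      simp only [Function.update_self, ne_eq, reduceCtorEq, not_false_eq_true,
        Function.update_of_ne, Nat.zero_mod]
      omega
  · have hq0 : st.reg .q = 0 := by simpa [hq₁, hB₁.reg_zero] using h0
    rw [hq0] at hcand hy
    have hnext := hcand.restart (by simpa [hy, hx₁] using hne)
    simpa [AdvanceInv, hq₁, hq0] using ⟨_, hnext⟩
  · simpa [hq₁] using hqm.trans hI.m_lt_bound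
  · have hb := hπ (Nat.pos_of_ne_zero (by simpa [hq₁, hB₁.reg_zero] using h0))
    have hnext := hcand.fallBack (by simpa [hy, hx₁] using hne) hb
    have := hb.1
    constructor
    · simpa [AdvanceInv, hq₁, hF.mem, hF.reg .go, hgo] using ⟨by omega, _, hnext⟩
    · simp [hq₁, hF.mem, hF.reg .go, hgo]
      omega

theorem advance_ends (hI : Problem E n m c k p f) (hB : Basics n m c k st)
    (hx : st.reg .x = g i) (hqm : st.reg .q < m)
    (hcand : Candidate p g (m - 1) o i i (st.reg .q) s)
    (hπ : ∀ j, 1 ≤ j → j ≤ st.reg .q → Border p 1 j (st.mem j)) :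
    Ends E advance st fun T st' => st'.reg .q ≤ m ∧
      (∃ s, Candidate p g m o (i + 1) (i + 1) (st'.reg .q) s) ∧
      T + 20 * st'.reg .q ≤ 20 * st.reg .q + 43 := by
  have h1w : 1 < 2 ^ E.w := Nat.one_lt_two_pow (by have := hI.one_le_w; omega)
  refine .block_seq (by simp) ((Ends.loop (fun st => 20 * st.reg .q + 40 * st.reg .go)
    (I := AdvanceInv p g m o i (st.reg .q)) ?_ ?_).mono_frame ?_)
  · left
    simpa [Nat.mod_eq_of_lt h1w] using ⟨s, hcand.succ_right⟩
  · intro st₁ hF hinv hgo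
    have hB₁ := (hB.of_frame (frame_execAll E [.const .go 1] st)).of_frame hF
    obtain ⟨hgo₁, hqq, s₁, hs₁⟩ | ⟨hgo₁, -⟩ := hinv
    · refine (advanceRound_ends hI hB₁ ((hF.reg .x).trans (by simpa using hx)) hgo₁ (by omega) hs₁
        fun hq => ?_).mono_frame ?_
      · simpa [hF.mem] using hπ _ hq hqq
      · rintro T st₂ ⟨⟨hgo₂, hq₂, hs₂⟩ | hdone, hT⟩ -
        · exact ⟨.inl ⟨hgo₂, hq₂.trans hqq, hs₂⟩, by omega⟩
        · exact ⟨.inr hdone, by omega⟩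
    · simp [hB₁.reg_zero, hgo₁] at hgo
  · rintro T st₁ ⟨⟨hgo₁, -⟩ | ⟨-, hq₁, hs₁⟩, hgo, hT⟩ hF
    · have hB₁ := (hB.of_frame (frame_execAll E [.const .go 1] st)).of_frame hF
      simp [hB₁.reg_zero, hgo₁] at hgo
    · refine ⟨hq₁, hs₁, ?_⟩
      simp [Nat.mod_eq_of_lt h1w] at hT ⊢
      omega

/-- The memory `μ'` arises from `μ` by writing a table, with entries related to their indices
`j ∈ [lo, hi)` by `R`, to the addresses `b + j`. -/
structure Tabulates (R : ℕ → ℕ → Prop) (b lo hi : ℕ) (μ μ' : ℕ → ℕ) : Prop where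
  entry : ∀ j, lo ≤ j → j < hi → R j (μ' (b + j))
  mem_eq : ∀ a, a < b + lo ∨ b + hi ≤ a → μ' a = μ a

section Tabulates

variable {R : ℕ → ℕ → Prop} {b lo hi x : ℕ} {μ μ' : ℕ → ℕ}

theorem Tabulates.empty (R : ℕ → ℕ → Prop) (b lo : ℕ) (μ : ℕ → ℕ) : Tabulates R b lo lo μ μ :=
  ⟨by omega, fun _ _ => rfl⟩

theorem Tabulates.update (h : Tabulates R b lo hi μ μ') (hle : lo ≤ hi) (hx : R hi x) :
    Tabulates R b lo (hi + 1) μ (Function.update μ' (b + hi) x) := by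
  refine ⟨fun j hj hj' => ?_, fun a ha => ?_⟩
  · rcases Nat.lt_succ_iff_lt_or_eq.mp hj' with hlt | rfl
    · rw [Function.update_of_ne (by omega)]
      exact h.entry j hj hlt
    · rwa [Function.update_self]
  · rw [Function.update_of_ne (by omega), h.mem_eq a (by omega)]

theorem tabulates_singleton (b : ℕ) (μ : ℕ → ℕ) (hx : R lo x) :
    Tabulates R b lo (lo + 1) μ (Function.update μ (b + lo) x) :=
  (Tabulates.empty R b lo μ).update le_rfl hx

end Tabulates

/-- Store, for all prefixes of length at least `i`, the longest border that is shorter than the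
prefix by at least the initial value of `i`. -/
def borderTable : Com Var :=
  .seq (.block [.const .q 0, .op .add .f₁ .base .i, .store .f₁ .zero])
    (.loop (.lt .i .m)
      (.seq (fetch .pattern .x .i .maskC)
        (.seq advance
          (.block [.op .add .i .i .one, .op .add .f₁ .base .i, .store .f₁ .q]))))

/-- The invariant of `borderTable`, with the memory `μ` at its start. -/
structure BorderInv (p : ℕ → ℕ) (m o b : ℕ) (μ : ℕ → ℕ) (st : Store Var) : Prop where
  le : o ≤ st.reg .i
  le_max : st.reg .i ≤ max o m
  border : Border p o (st.reg .i) (st.reg .q)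
  table : Tabulates (Border p o) b o (st.reg .i + 1) μ st.mem

theorem borderTable_round_ends (hI : Problem E n m c k p f) (hB : Basics n m c k st) {b : ℕ}
    (hb : st.reg .base = b) (hbm : b + m < E.bound) {μ : ℕ → ℕ} (hinv : BorderInv p m o b μ st)
    (him : st.reg .i < m) (hπ : ∀ j, 1 ≤ j → j ≤ st.reg .q → Border p 1 j (st.mem j)) :
    Ends E (.seq (fetch .pattern .x .i .maskC) (.seq advance
        (.block [.op .add .i .i .one, .op .add .f₁ .base .i, .store .f₁ .q]))) st
      fun T st' => BorderInv p m o b μ st' ∧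
        60 * (m - st'.reg .i) + 20 * st'.reg .q + T + 2 ≤
          60 * (m - st.reg .i) + 20 * st.reg .q := by
  have hbw := hI.bound_le
  have hmw := hI.m_le.trans_lt hI.n_lt
  obtain ⟨s, hs⟩ := (exists_candidate_iff_border him.le).mpr hinv.border
  have hqi := hs.add_eq
  refine (fetch_char_ends hB hI hI.p_lt hI.pattern rfl (him.trans hmw)).seq ?_
  rintro T₁ st₁ ⟨rfl, hx⟩ hF₁
  have hq₁ := hF₁.reg .q
  refine (advance_ends hI (hB.of_frame hF₁) hx (by omega)
    (by rw [hq₁]; exact hs.mono (Nat.sub_le m 1)) (by rwa [hq₁, hF₁.mem])).seq ?_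
  rintro T₂ st₂ ⟨-, hcand, hT₂⟩ hF₂
  have hi₂ : st₂.reg .i = st.reg .i := (hF₂.reg .i).trans (hF₁.reg .i)
  have hb₂ : st₂.reg .base = b := ((hF₂.reg .base).trans (hF₁.reg .base)).trans hb
  have hone : st₂.reg .one = 1 := ((hB.of_frame hF₁).of_frame hF₂).reg_one
  have hmem₂ : st₂.mem = st.mem := hF₂.mem.trans hF₁.mem
  have e1 := BinOp.eval_add (w := E.w) (a := st.reg .i) (b := 1) (by omega)
  have e2 := BinOp.eval_add (w := E.w) (a := b) (b := st.reg .i + 1) (by omega)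
  have hborder := (exists_candidate_iff_border him).mp hcand
  have hle := hinv.le
  refine .block ?_ ⟨⟨?_, ?_, ?_, ?_⟩, ?_⟩
  · simp only [SafeAll, Basic.Safe, Basic.exec, Store.set, Function.update_self, hi₂, hb₂, hone,
      e1, e2, ne_eq, reduceCtorEq, not_false_eq_true, Function.update_of_ne]
    exact ⟨trivial, trivial, by omega, trivial⟩
  · simp [hi₂, hone, e1]; omega
  · simp [hi₂, hone, e1]; omega
  · simpa [hi₂, hone, e1] using hborder
  · simpa [hi₂, hone, hb₂, e1, e2, hmem₂] using hinv.table.update (by omega) hborder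
  · simp [hi₂, hone, e1]; omega

theorem borderTable_ends (hI : Problem E n m c k p f) (hB : Basics n m c k st) {b : ℕ}
    (hi : st.reg .i = o) (hb : st.reg .base = b) (hbm : b + max o m < E.bound)
    (hπ : (b = 0 ∧ o = 1) ∨ (m < b ∧ ∀ j, 1 ≤ j → j ≤ m → Border p 1 j (st.mem j))) :
    Ends E borderTable st fun T st' =>
      Tabulates (Border p o) b o (max o m + 1) st.mem st'.mem ∧ T ≤ 60 * m + 5 := by
  have hbw := hI.bound_le
  have hadd := BinOp.eval_add (w := E.w) (a := b) (b := o) (by omega)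
  refine .block_seq ?_ ((Ends.loop (fun st => 60 * (m - st.reg .i) + 20 * st.reg .q)
    (I := BorderInv p m o b st.mem) ?_ fun st₁ hF hinv him => ?_).mono_frame ?_)
  · simp [hb, hi, hadd]; omega
  · refine ⟨?_, ?_, ?_, ?_⟩
    · simp [hi]
    · simp [hi]
    · simpa [hi] using Border.self p o
    · simpa [hi, hb, hadd, hB.reg_zero] using tabulates_singleton b st.mem (Border.self p o)
  all_goals have hB₀ := hB.of_frame (frame_execAll E
    [.const .q 0, .op .add .f₁ .base .i, .store .f₁ .zero] st)
  · have hB₁ := hB₀.of_frame hF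
    have hle := hinv.le
    have hq := hinv.border.1
    have him : st₁.reg .i < m := by simpa [hB₁.reg_m] using him
    refine borderTable_round_ends hI hB₁ ?_ (by omega) hinv him fun j hj hjq => ?_
    · simpa [hb] using hF.reg .base
    · rcases hπ with ⟨rfl, rfl⟩ | ⟨hmb, hπ⟩
      · simpa using hinv.table.entry j hj (by omega)
      · rw [hinv.table.mem_eq j (by omega)]
        exact hπ j hj (by omega)
  · rintro T st₁ ⟨hinv, him, hT⟩ hF
    have hle := hinv.le
    have hle' := hinv.le_max
    simp only [Cond.Holds, (hB₀.of_frame hF).reg_m] at him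
    have hend : st₁.reg .i = max o m := by omega
    refine ⟨hend ▸ hinv.table, ?_⟩
    simp [hi] at hT ⊢
    omega

/-- Store the period masks of all prefixes. -/
def periodTable : Com Var :=
  .seq (.block [.store .baseD .one, .const .i 0])
    (.loop (.lt .i .m)
      (.block [.op .add .i .i .one, .load .x .i, .op .sub .y .i .x, .op .add .x .x .baseD,
        .load .x .x, .op .shl .x .x .y, .op .lor .x .one .x, .op .land .x .x .maskD,
        .op .add .y .baseD .i, .store .y .x]))

/-- The invariant of `periodTable`, with the memory `μ` at its start. -/
structure PeriodInv (p : ℕ → ℕ) (m t : ℕ) (μ : ℕ → ℕ) (st : Store Var) : Prop where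
  le : st.reg .i ≤ m
  table : Tabulates (PeriodMask p t) (m + 1) 0 (st.reg .i + 1) μ st.mem

theorem periodTable_round_ends (hI : Problem E n m c k p f) (hB : Basics n m c k st) {t : ℕ}
    (htw : t ≤ E.w) (hb : 2 * m + 1 < E.bound) (hD : st.reg .baseD = m + 1)
    (hmask : st.reg .maskD = 2 ^ t - 1) {μ : ℕ → ℕ} (hinv : PeriodInv p m t μ st)
    (him : st.reg .i < m) (hπ : Border p 1 (st.reg .i + 1) (μ (st.reg .i + 1))) :
    Ends E (.block [.op .add .i .i .one, .load .x .i, .op .sub .y .i .x, .op .add .x .x .baseD,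
        .load .x .x, .op .shl .x .x .y, .op .lor .x .one .x, .op .land .x .x .maskD,
        .op .add .y .baseD .i, .store .y .x]) st
      fun T st' => PeriodInv p m t μ st' ∧ 12 * (m - st'.reg .i) + T + 2 ≤
        12 * (m - st.reg .i) := by
  have hbw := hI.bound_le
  generalize hi : st.reg .i = i at *
  have hmem : st.mem (i + 1) = μ (i + 1) := hinv.table.mem_eq _ (by omega)
  generalize μ (i + 1) = v at *
  have hv := hπ.1
  have hnew := PeriodMask.of_border htw hπ (hinv.table.entry v (by omega) (by omega))
  have e1 := BinOp.eval_add (w := E.w) (a := i) (b := 1) (by omega)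
  have e2 := BinOp.eval_sub (w := E.w) (a := i + 1) (b := v) (by omega) (by omega)
  have e3 := BinOp.eval_add (w := E.w) (a := v) (b := m + 1) (by omega)
  have e4 := BinOp.eval_add (w := E.w) (a := m + 1) (b := i + 1) (by omega)
  have hor x : BinOp.eval E.w .land (BinOp.eval E.w .lor 1 (BinOp.eval E.w .shl x (i + 1 - v)))
      (2 ^ t - 1) = (1 ||| (x <<< (i + 1 - v)) % 2 ^ E.w) &&& (2 ^ t - 1) := by
    rw [BinOp.eval_land (BinOp.eval_lt ..)]
    simp only [BinOp.eval]
    rw [Nat.mod_eq_of_lt (Nat.or_lt_two_pow (Nat.one_lt_two_pow (Nat.ne_of_gt hI.one_le_w))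
      (Nat.mod_lt _ (by positivity)))]
  refine .block ?_ ⟨⟨?_, ?_⟩, ?_⟩
  · simp [hi, hB.reg_one, hD, hmem, e1, e2, e3, e4]; omega
  · simp [hi, hB.reg_one, e1]; omega
  · rw [add_comm (m + 1) v] at hnew
    simpa [hi, hB.reg_one, hD, hmask, hmem, e1, e2, e3, e4, hor] using
      hinv.table.update (Nat.zero_le _) (by rw [hi]; simpa using hnew)
  · simp [hi, hB.reg_one, e1]; omega

theorem periodTable_ends (hI : Problem E n m c k p f) (hB : Basics n m c k st) {t : ℕ}
    (ht : 1 ≤ t) (htw : t ≤ E.w) (hb : 2 * m + 1 < E.bound) (hD : st.reg .baseD = m + 1)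
    (hmask : st.reg .maskD = 2 ^ t - 1) (hπ : ∀ j, 1 ≤ j → j ≤ m → Border p 1 j (st.mem j)) :
    Ends E periodTable st fun T st' =>
      Tabulates (PeriodMask p t) (m + 1) 0 (m + 1) st.mem st'.mem ∧ T ≤ 12 * m + 4 := by
  refine .block_seq ?_ ((Ends.loop (fun st => 12 * (m - st.reg .i))
    (I := PeriodInv p m t st.mem) ?_ fun st₁ hF hinv him => ?_).mono_frame ?_)
  · simp [hD]; omega
  · refine ⟨by simp, ?_⟩
    simpa [hD, hB.reg_one] using tabulates_singleton (m + 1) st.mem (periodMask_zero (p := p) ht)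
  all_goals have hB₀ := hB.of_frame (frame_execAll E [.store .baseD .one, .const .i 0] st)
  · have hB₁ := hB₀.of_frame hF
    have him : st₁.reg .i < m := by simpa [hB₁.reg_m] using him
    exact periodTable_round_ends hI hB₁ htw hb (by simpa [hD] using hF.reg .baseD)
      (by simpa [hmask] using hF.reg .maskD) hinv him (hπ _ (by omega) him)
  · rintro T st₁ ⟨hinv, him, hT⟩ hF
    have hle := hinv.le
    simp only [Cond.Holds, (hB₀.of_frame hF).reg_m] at him
    have hend : st₁.reg .i = m := by omega
    refine ⟨hend ▸ hinv.table, ?_⟩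
    simp at hT ⊢
    omega

end Borders

/-! ### Search character by character -/

section CharSearch

variable {E : Env} {n m c k : ℕ} {p f : ℕ → ℕ} {st : Store Var} {i q s : ℕ}

/-- An occurrence of `p`, of length `m`, at position `s` of the text `f` of length `n`. -/
def Occurs (p f : ℕ → ℕ) (n m s : ℕ) : Prop :=
  Agrees p f s (s + m) ∧ s + m ≤ n

open Classical in
/-- The occurrences before position `S`, in increasing order. -/
noncomputable def occList (p f : ℕ → ℕ) (n m S : ℕ) : List ℕ :=
  (List.range S).filter fun s => Occurs p f n m s

theorem occList_succ (p f : ℕ → ℕ) (n m S : ℕ) [Decidable (Occurs p f n m S)] :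
    occList p f n m (S + 1) =
      if Occurs p f n m S then occList p f n m S ++ [S] else occList p f n m S := by
  simp only [occList, List.range_succ, List.filter_append, List.filter_singleton]
  split_ifs <;> simp_all

theorem occList_eq_of_le {S S' : ℕ} (h : S ≤ S')
    (hn : ∀ s, S ≤ s → s < S' → ¬ Occurs p f n m s) :
    occList p f n m S' = occList p f n m S := by
  classical
  induction S', h using Nat.le_induction with
  | base => rfl
  | succ S' h ih =>
    rw [occList_succ, if_neg (hn S' h (by omega)), ih fun s h1 h2 => hn s h1 (by omega)]

theorem Candidate.occurs_iff (h : Candidate p f m 0 i i q s) (hq : q ≤ m) (hmi : m ≤ i)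
    (hin : i ≤ n) : Occurs p f n m (i - m) ↔ q = m := by
  have hs := h.add_eq
  rw [Occurs, Nat.sub_add_cancel hmi, and_iff_left hin]
  constructor
  · intro ha
    by_contra hne
    exact h.not_agrees (i - m) (Nat.zero_le _) (by omega) (by omega) ha
  · rintro rfl
    rw [show i - q = s by omega]
    exact h.agrees

theorem Candidate.occList_eq (h : Candidate p f m 0 i i q s) (hq : q ≤ m) (hin : i ≤ n) :
    occList p f n m (i + 1 - m) =
      if q = m then occList p f n m (i - m) ++ [i - m] else occList p f n m (i - m) := by
  classical
  have hs := h.add_eq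
  by_cases hmi : m ≤ i
  · simp only [Nat.sub_add_comm hmi, occList_succ, h.occurs_iff hq hmi hin]
  · rw [if_neg (by omega), show i + 1 - m = i - m by omega]

/-- In the state `q` after reading `i` characters, report a match if there is one and fall back to a
state smaller than `m`. -/
def reportMatch : Com Var :=
  .ite (.eq .q .m) (.block [.op .sub .y .i .m, .report .y, .load .q .m]) (.block [])

/-- Search character by character, with the failure function at address `0`. -/
def charSearch : Com Var :=
  .seq (.block [.const .i 0, .const .q 0])
    (.loop (.lt .i .n)
      (.seq (fetch .text .x .i .maskC)
        (.seq advance (.seq (.block [.op .add .i .i .one]) reportMatch))))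

/-- The invariant of `charSearch`: all occurrences within the first `i` characters are reported. -/
structure CharInv (p f : ℕ → ℕ) (n m : ℕ) (st : Store Var) : Prop where
  le : st.reg .i ≤ n
  lt : st.reg .q < m
  candidate : ∃ s, Candidate p f (m - 1) 0 (st.reg .i) (st.reg .i) (st.reg .q) s
  out : st.out = occList p f n m (st.reg .i + 1 - m)

theorem reportMatch_ends (hI : Problem E n m c k p f) (hB : Basics n m c k st)
    (hin : st.reg .i ≤ n) (hqm : st.reg .q ≤ m)
    (hs : Candidate p f m 0 (st.reg .i) (st.reg .i) (st.reg .q) s)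
    (hout : st.out = occList p f n m (st.reg .i - m)) (hπ : Border p 1 m (st.mem m)) :
    Ends E reportMatch st fun T st' => CharInv p f n m st' ∧ st'.reg .i = st.reg .i ∧
      T + 20 * st'.reg .q ≤ 20 * st.reg .q + 4 := by
  have hocc := hs.occList_eq hqm hin
  have hv := hπ.1
  refine .ite (fun hq => .block ?_ ⟨⟨?_, ?_, ?_, ?_⟩, ?_, ?_⟩) fun hq =>
    .block (by simp) ⟨⟨hin, ?_, ⟨s, hs.mono (Nat.sub_le m 1)⟩, ?_⟩, rfl, by simp; omega⟩
  all_goals simp only [Cond.Holds, hB.reg_m] at hq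
  · simpa [hB.reg_m] using hI.m_lt_bound
  · simpa using hin
  · simp [hB.reg_m]; omega
  · rw [hq] at hs
    simpa [hB.reg_m] using ⟨_, hs.next hI.one_le_m hπ⟩
  · have hsi := hs.add_eq
    have hsub := BinOp.eval_sub (w := E.w) (a := st.reg .i) (b := m) (by omega)
      (hin.trans_lt hI.n_lt)
    simp [hocc, hq, hB.reg_m, hsub, hout]
  · simp
  · simp [hB.reg_m]; omega
  · exact hqm.lt_of_ne hq
  · rw [execAll, hocc, if_neg hq, hout]

theorem charSearch_round_ends (hI : Problem E n m c k p f) (hB : Basics n m c k st)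
    (hπ : ∀ j, 1 ≤ j → j ≤ m → Border p 1 j (st.mem j)) (hinv : CharInv p f n m st)
    (hin : st.reg .i < n) :
    Ends E (.seq (fetch .text .x .i .maskC)
        (.seq advance (.seq (.block [.op .add .i .i .one]) reportMatch))) st
      fun T st' => CharInv p f n m st' ∧ 62 * (n - st'.reg .i) + 20 * st'.reg .q + T + 2 ≤
        62 * (n - st.reg .i) + 20 * st.reg .q := by
  obtain ⟨s, hs⟩ := hinv.candidate
  have hqm := hinv.lt
  refine (fetch_char_ends hB hI hI.f_lt hI.text rfl (hin.trans hI.n_lt)).seq ?_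
  rintro T₁ st₁ ⟨rfl, hx⟩ hF₁
  have hB₁ := hB.of_frame hF₁
  have hq₁ := hF₁.reg .q
  refine (advance_ends hI hB₁ hx (by rwa [hq₁]) (by rwa [hq₁]) (fun j h1 h2 => ?_)).seq ?_
  · rw [hF₁.mem]
    exact hπ j h1 (by omega)
  rintro T₂ st₂ ⟨hq₂, ⟨s₂, hs₂⟩, hT₂⟩ hF₂
  have hB₂ := hB₁.of_frame hF₂
  have hi₂ : st₂.reg .i = st.reg .i := (hF₂.reg .i).trans (hF₁.reg .i)
  have hadd := BinOp.eval_add (w := E.w) (a := st.reg .i) (b := 1)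
    (Nat.lt_of_le_of_lt hin hI.n_lt)
  refine .block_seq (by simp) ((reportMatch_ends (s := s₂) hI
    (hB₂.of_frame (frame_execAll E [.op .add .i .i .one] st₂)) ?_ ?_ ?_ ?_ ?_).mono_frame ?_)
  · simpa [hi₂, hB₂.reg_one, hadd] using hin
  · simpa using hq₂
  · simpa [hi₂, hB₂.reg_one, hadd] using hs₂
  · simpa [hi₂, hB₂.reg_one, hadd, hF₂.out, hF₁.out] using hinv.out
  · simpa [hF₂.mem, hF₁.mem] using hπ m hI.one_le_m le_rfl
  · rintro T₃ st₃ ⟨hinv₃, hi₃, hT₃⟩ -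
    refine ⟨hinv₃, ?_⟩
    simp [hi₂, hB₂.reg_one, hadd] at hi₃ hT₃ ⊢
    omega

theorem charSearch_ends (hI : Problem E n m c k p f) (hB : Basics n m c k st)
    (hπ : ∀ j, 1 ≤ j → j ≤ m → Border p 1 j (st.mem j)) (hout : st.out = []) :
    Ends E charSearch st fun T st' => st'.out = occList p f n m (n + 1) ∧ T ≤ 62 * n + 4 := by
  have hm := hI.one_le_m
  refine .block_seq (by simp) ((Ends.loop (fun st => 62 * (n - st.reg .i) + 20 * st.reg .q)
    (I := CharInv p f n m) ?_ fun st₁ hF hinv hin => ?_).mono_frame ?_)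
  · refine ⟨by simp, by simp; omega, ?_, ?_⟩
    · simpa using ⟨0, rfl, le_rfl, agrees_self p f 0, fun s' _ h => (Nat.not_lt_zero _ h).elim⟩
    · simp [hout, occList, Nat.sub_eq_zero_of_le hm]
  all_goals have hB₀ := hB.of_frame (frame_execAll E [.const .i 0, .const .q 0] st)
  · have hB₁ := hB₀.of_frame hF
    refine charSearch_round_ends hI hB₁ ?_ hinv (by simpa [hB₁.reg_n] using hin)
    simpa [hF.mem] using hπ
  · rintro T st₁ ⟨hinv, hin, hT⟩ hF
    simp only [Cond.Holds, (hB₀.of_frame hF).reg_n] at hin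
    have hend : st₁.reg .i = n := le_antisymm hinv.le (not_lt.mp hin)
    refine ⟨?_, by simp at hT ⊢; omega⟩
    rw [hinv.out, hend]
    refine (occList_eq_of_le (by omega) fun s hs _ hocc => ?_).symm
    have := hocc.2
    omega

end CharSearch

/-! ### Filling a table -/

section Fill

section IsFirst

variable {G : ℕ → Prop} {lo t v d : ℕ}

theorem isFirst_self (G : ℕ → Prop) (t : ℕ) : IsFirst G t t t :=
  ⟨le_rfl, by omega, by omega⟩

theorem isFirst_of_hit (hd : d < t) (hG : G d) : IsFirst G d t d :=
  ⟨hd.le, fun _ => ⟨le_rfl, hG⟩, by omega⟩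

theorem IsFirst.of_not_hit (h : IsFirst G (d + 1) t v) (hG : ¬ G d) : IsFirst G d t v := by
  refine ⟨h.1, fun hv => ⟨by have := (h.2.1 hv).1; omega, (h.2.1 hv).2⟩, fun a ha hav => ?_⟩
  obtain rfl | hda := ha.eq_or_lt
  · exact hG
  · exact h.2.2 a hda hav

theorem isFirst_and_le_iff {G : ℕ → Prop} {lo t v : ℕ} :
    IsFirst (fun d => lo ≤ d ∧ G d) 0 t v ↔ IsFirst G lo t v := by
  simp [IsFirst]
  tauto

end IsFirst

/-- Set `res` to the first `d < t` for which `hit` assigns `d` to `res`, or to `t`. -/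
def firstHit (hit : Com Var) : Com Var :=
  .seq (.block [.op .add .res .zero .t, .op .add .d .zero .t])
    (.loop (.lt .zero .d) (.seq (.block [.op .sub .d .d .one]) hit))

theorem firstHit_ends {E : Env} {hit : Com Var} {G : ℕ → Prop} {t K : ℕ} {st : Store Var}
    (hz : st.reg .zero = 0) (h1 : st.reg .one = 1) (ht : st.reg .t = t) (htw : t < 2 ^ E.w)
    (hkeep : ∀ r ∈ [Var.d, .zero, .one], r ∉ hit.targets)
    (hhit : ∀ st', Frame (firstHit hit) st st' → st'.reg .d < t →
      Ends E hit st' fun T st'' => (G (st'.reg .d) ∧ st''.reg .res = st'.reg .d ∨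
        ¬ G (st'.reg .d) ∧ st''.reg .res = st'.reg .res) ∧ T ≤ K) :
    Ends E (firstHit hit) st fun T st' =>
      IsFirst G 0 t (st'.reg .res) ∧ T ≤ (K + 3) * t + 4 := by
  have hadd := BinOp.eval_add (w := E.w) (a := 0) (b := t) (by omega)
  simp only [List.forall_mem_cons, List.not_mem_nil, false_imp_iff, implies_true, and_true] at hkeep
  obtain ⟨hd, hzero, hone⟩ := hkeep
  have hbody {r : Var} (hr : r ∉ hit.targets) (hrd : r ≠ .d) :
      r ∉ (Com.seq (.block [.op .sub .d .d .one]) hit).targets := by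
    simpa [Com.targets, Com.basics, Basic.target, hrd] using hr
  refine .block_seq (by simp) ((Ends.loop (fun st => (K + 3) * st.reg .d)
    (I := fun st => IsFirst G (st.reg .d) t (st.reg .res) ∧ st.reg .d ≤ t) ?_ ?_).mono_frame ?_)
  · simpa [hz, ht, hadd] using isFirst_self G t
  · rintro st₁ hF ⟨hfirst, hdt⟩ hpos
    have hz₁ : st₁.reg .zero = 0 := by simpa [hz] using hF.reg .zero (hbody hzero (by decide))
    have h1₁ : st₁.reg .one = 1 := by simpa [h1] using hF.reg .one (hbody hone (by decide))
    simp only [Cond.Holds, hz₁] at hpos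
    obtain ⟨d, hd₁⟩ := Nat.exists_eq_add_one.mpr hpos
    rw [hd₁] at hfirst hdt
    have hsub := BinOp.eval_sub (w := E.w) (a := d + 1) (b := 1) (by omega) (by omega)
    have hF₁ := ((frame_execAll E _ st).mono (c' := firstHit hit)
      (List.subset_append_left ..)).trans (hF.mono (List.subset_append_right ..))
    refine .block_seq (by simp) ((hhit _ (hF₁.trans ((frame_execAll E _ st₁).mono
      (by simp [firstHit, Com.basics]))) (by simpa [hd₁, h1₁, hsub] using hdt)).mono_frame ?_)
    rintro T st₂ ⟨hcase, hT⟩ hF₂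
    have hd₂ : st₂.reg .d = d := by simp [hF₂.reg .d hd, hd₁, h1₁, hsub]
    replace hcase : G d ∧ st₂.reg .res = d ∨ ¬ G d ∧ st₂.reg .res = st₁.reg .res := by
      simpa [hd₁, h1₁, hsub] using hcase
    rw [hd₂, hd₁, mul_add]
    obtain ⟨hG, hres⟩ | ⟨hG, hres⟩ := hcase <;> rw [hres]
    · exact ⟨⟨isFirst_of_hit hdt hG, by omega⟩, by simp; omega⟩
    · exact ⟨⟨hfirst.of_not_hit hG, by omega⟩, by simp; omega⟩
  · rintro T st₁ ⟨⟨hfirst, -⟩, hneg, hT⟩ hF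
    have hz₁ : st₁.reg .zero = 0 := by simpa [hz] using hF.reg .zero (hbody hzero (by decide))
    simp only [Cond.Holds, hz₁] at hneg
    rw [show st₁.reg .d = 0 by omega] at hfirst
    exact ⟨hfirst, by simp [hz, ht, hadd] at hT ⊢; omega⟩

/-- Fill the table of length `lim` at address `base` with the results of `entry`, which computes
`res` from the index `idx`. -/
def fill (entry : Com Var) : Com Var :=
  .seq (.block [.const .idx 0])
    (.loop (.lt .idx .lim)
      (.seq entry (.block [.op .add .f₁ .base .idx, .store .f₁ .res, .op .add .idx .idx .one])))

theorem fill_ends {E : Env} {entry : Com Var} {R : ℕ → ℕ → Prop} {b N K : ℕ} {st : Store Var}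
    (h1 : st.reg .one = 1) (hb : st.reg .base = b) (hN : st.reg .lim = N)
    (hbN : b + N ≤ E.bound) (hbw : E.bound ≤ 2 ^ E.w) (hNw : N < 2 ^ E.w)
    (hkeep : ∀ r ∈ [Var.one, .base, .lim, .idx], r ∉ entry.targets)
    (hstore : entry.basics.any Basic.isStore = false)
    (hentry : ∀ st', Frame (fill entry) st st' → st'.reg .idx < N →
      Ends E entry st' fun T st'' => R (st'.reg .idx) (st''.reg .res) ∧ T ≤ K) :
    Ends E (fill entry) st fun T st' =>
      Tabulates R b 0 N st.mem st'.mem ∧ T ≤ (K + 5) * N + 3 := by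
  simp only [List.forall_mem_cons, List.not_mem_nil, false_imp_iff, implies_true, and_true] at hkeep
  obtain ⟨hone, hbase, hlim, hidx⟩ := hkeep
  have hbody {r : Var} (hr : r ∉ entry.targets) (hr₁ : r ≠ .f₁) (hr₂ : r ≠ .idx) : r ∉ (Com.seq
      entry (.block [.op .add .f₁ .base .idx, .store .f₁ .res, .op .add .idx .idx .one])).targets :=
    by simpa [Com.targets, Com.basics, Basic.target, hr₁, hr₂.symm] using hr
  refine .block_seq (by simp) ((Ends.loop (fun st => (K + 5) * (N - st.reg .idx))
    (I := fun st' => Tabulates R b 0 (st'.reg .idx) st.mem st'.mem ∧ st'.reg .idx ≤ N)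
    ?_ ?_).mono_frame ?_)
  · simpa using Tabulates.empty R b 0 st.mem
  · rintro st₁ hF ⟨htab, -⟩ hlt
    have hlim₁ : st₁.reg .lim = N := by
      simpa [hN] using hF.reg .lim (hbody hlim (by decide) (by decide))
    simp only [Cond.Holds, hlim₁] at hlt
    have hF₁ := ((frame_execAll E _ st).mono (c' := fill entry)
      (List.subset_append_left ..)).trans (hF.mono (List.subset_append_right ..))
    refine (hentry st₁ hF₁ hlt).seq ?_
    rintro T st₂ ⟨hres, hT⟩ hF₂
    have hF' := hF.trans (hF₂.mono (List.subset_append_left ..))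
    have h1₂ : st₂.reg .one = 1 := by
      simpa [h1] using hF'.reg .one (hbody hone (by decide) (by decide))
    have hb₂ : st₂.reg .base = b := by
      simpa [hb] using hF'.reg .base (hbody hbase (by decide) (by decide))
    have hidx₂ := hF₂.reg .idx hidx
    have hadd := BinOp.eval_add (w := E.w) (a := b) (b := st₁.reg .idx) (by omega)
    have hinc := BinOp.eval_add (w := E.w) (a := st₁.reg .idx) (b := 1) (by omega)
    refine .block (by simp [hb₂, hidx₂, hadd]; omega) ⟨?_, ?_⟩
    · simpa [h1₂, hb₂, hidx₂, hadd, hinc, hF₂.mem hstore] using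
        ⟨htab.update (Nat.zero_le _) hres, by omega⟩
    · obtain ⟨e, rfl⟩ := Nat.exists_eq_add_of_lt hlt
      simp [h1₂, hidx₂, hinc, show st₁.reg .idx + e + 1 - st₁.reg .idx = e + 1 by omega, mul_add]
      omega
  · rintro T st₁ ⟨⟨htab, hle⟩, hge, hT⟩ hF
    have hlim₁ : st₁.reg .lim = N := by
      simpa [hN] using hF.reg .lim (hbody hlim (by decide) (by decide))
    simp only [Cond.Holds, hlim₁] at hge
    rw [show st₁.reg .idx = N by omega] at htab
    exact ⟨htab, by simp at hT ⊢; omega⟩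

end Fill

/-! ### The entries of the lookup tables -/

section Entries

/-- The length of the table of shifts. Its index consists of the number of pattern characters that
follow the window, the mask of admissible shifts, the window and the block. -/
def shiftSize (c t : ℕ) : ℕ := 2 ^ (c * t + c * (2 * t) + t + t)

/-- The length of the table of starts. Its index consists of a lower bound and the block. -/
def startSize (c t : ℕ) : ℕ := 2 ^ (c * t + t)

/-- The block length `t` is admissible, and the tables fill the memory. -/
structure Fits (E : Env) (m k c t : ℕ) : Prop where
  one_le_t : 1 ≤ t
  two_t_le : 2 * t ≤ k
  bound_eq : E.bound = 3 * (m + 1) + shiftSize c t + startSize c t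

/-- The registers that depend on the block length `t` have their intended contents: lengths and
masks of bit fields, base addresses of the tables, and the first characters of the pattern. -/
structure Layout (m c t : ℕ) (p : ℕ → ℕ) (st : Store Var) : Prop where
  reg_t : st.reg .t = t
  reg_ct : st.reg .ct = c * t
  reg_cw : st.reg .cw = c * (2 * t)
  reg_maskT : st.reg .maskT = 2 ^ (c * t) - 1
  reg_maskW : st.reg .maskW = 2 ^ (c * (2 * t)) - 1
  reg_maskD : st.reg .maskD = 2 ^ t - 1
  reg_baseD : st.reg .baseD = m + 1
  reg_baseJ : st.reg .baseJ = 2 * (m + 1)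
  reg_baseT : st.reg .baseT = 3 * (m + 1)
  reg_baseU : st.reg .baseU = 3 * (m + 1) + shiftSize c t
  reg_head : st.reg .head = chunk c p 0 t

variable {E : Env} {n m c k t : ℕ} {p f : ℕ → ℕ} {st : Store Var}

theorem Layout.of_frame {a : Com Var} {st' : Store Var} (h : Layout m c t p st)
    (hF : Frame a st st')
    (ha : ∀ r ∈ [Var.t, .ct, .cw, .maskT, .maskW, .maskD, .baseD, .baseJ, .baseT, .baseU, .head],
      r ∉ a.targets := by decide) : Layout m c t p st' := by
  have hreg r (hr : r ∈ [Var.t, .ct, .cw, .maskT, .maskW, .maskD, .baseD, .baseJ, .baseT, .baseU,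
    .head]) : st'.reg r = st.reg r := hF.reg r (ha r hr)
  constructor
  all_goals rw [hreg _ (by simp)]
  exacts [h.reg_t, h.reg_ct, h.reg_cw, h.reg_maskT, h.reg_maskW, h.reg_maskD, h.reg_baseD,
    h.reg_baseJ, h.reg_baseT, h.reg_baseU, h.reg_head]

theorem Problem.mul_le (hI : Problem E n m c k p f) {r : ℕ} (hr : r ≤ k) : c * r ≤ E.w :=
  (Nat.mul_le_mul_left c hr).trans (mul_comm c k ▸ hI.word)

theorem Problem.mul_lt (hI : Problem E n m c k p f) {r : ℕ} (hr : r ≤ k) : c * r < 2 ^ E.w :=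
  (hI.mul_le hr).trans_lt Nat.lt_two_pow_self

theorem Fits.two_pow_add_lt (hI : Problem E n m c k p f) (hF : Fits E m k c t) :
    2 ^ t + t < 2 ^ E.w := by
  have hk : k ≤ E.w := (Nat.le_mul_of_pos_right k hI.one_le_c).trans hI.word
  have hpow : 2 ^ (t + 1) ≤ 2 ^ E.w := Nat.pow_le_pow_right (by norm_num) (by
    have := hF.one_le_t; have := hF.two_t_le; omega)
  have ht : t < 2 ^ t := Nat.lt_two_pow_self
  rw [pow_succ] at hpow
  omega

theorem Fits.lt_two_pow (hI : Problem E n m c k p f) (hF : Fits E m k c t) : t < 2 ^ E.w :=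
  (Nat.le_add_left ..).trans_lt (hF.two_pow_add_lt hI)

/-- Replace `dst` by its minimum with `bd`. -/
def cap (dst bd : Var) : Com Var :=
  .ite (.lt bd dst) (.block [.op .add dst .zero bd]) (.block [])

theorem cap_ends (hB : Basics n m c k st) {dst bd : Var} (hl : st.reg bd < 2 ^ E.w) :
    Ends E (cap dst bd) st fun T st' => T = 2 ∧ st'.reg dst = min (st.reg bd) (st.reg dst) := by
  have hadd := BinOp.eval_add (w := E.w) (a := 0) (b := st.reg bd) (by omega)
  refine .ite (fun hc => .block (by simp) ⟨by simp, ?_⟩) fun hc => .block (by simp) ⟨by simp, ?_⟩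
  · simp only [Cond.Holds] at hc
    simp [hB.reg_zero, hadd, hc.le]
  · simp only [Cond.Holds, not_lt] at hc
    simp [hc]

/-- Compute, in `y` and `z`, the parts of the shifted window and of the block that overlap, and, in
`len`, whether the mask allows the shift. -/
def shiftFields : Com Var :=
  .seq (.block [.op .add .len .h .d])
    (.seq (cap .len .t)
      (.block [.op .sub .y .t .d, .op .mul .y .c .y, .op .shr .y .x .y, .op .mul .len .c .len,
        .op .shl .z .one .len, .op .sub .z .z .one, .op .land .y .y .z, .op .land .z .u .z,
        .op .shr .len .dm .d, .op .land .len .len .one]))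

/-- Set `res` to `d` if shifting the pattern by `d` is a hit. -/
def shiftTest : Com Var :=
  .seq shiftFields
    (.ite (.eq .y .z)
      (.ite (.eq .len .one) (.block [.op .add .res .zero .d]) (.block []))
      (.block []))

theorem shiftFields_ends (hI : Problem E n m c k p f) (hF : Fits E m k c t)
    (hB : Basics n m c k st) {h D x u d : ℕ} (ht : st.reg .t = t) (hh : st.reg .h = h)
    (hD : st.reg .dm = D) (hx : st.reg .x = x) (hu : st.reg .u = u) (hd : st.reg .d = d)
    (hdt : d < t) (hht : h < 2 ^ t) (hDw : D < 2 ^ E.w) (hxw : x < 2 ^ E.w) (huw : u < 2 ^ E.w) :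
    Ends E shiftFields st fun T st' => T = 13 ∧ (ShiftHit c t h D x u d ↔
      st'.reg .y = st'.reg .z ∧ st'.reg .len = 1) := by
  have hw := hF.two_pow_add_lt hI
  have htk := hF.two_t_le
  have hlen : min t (h + d) ≤ t := min_le_left _ _
  have hadd := BinOp.eval_add (w := E.w) (a := h) (b := d) (by omega)
  refine .block_seq (by simp) ((cap_ends (hB.of_frame (frame_execAll ..)) (by
    simp [ht]; omega)).seq ?_)
  rintro T st₁ ⟨rfl, hlen₁⟩ hF₁
  replace hlen₁ : st₁.reg .len = min t (h + d) := by simpa [ht, hh, hd, hadd] using hlen₁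
  replace hF₁ : Frame (.seq (.block [.op .add .len .h .d]) (cap .len .t)) st st₁ :=
    ((frame_execAll E _ st).mono (by simp [Com.basics])).trans (hF₁.mono (by simp [Com.basics]))
  have hB₁ := hB.of_frame hF₁
  have hsub := BinOp.eval_sub (w := E.w) (a := t) (b := d) hdt.le (by omega)
  have hmul := BinOp.eval_mul (hI.mul_lt (r := t - d) (by omega))
  have hmul' := BinOp.eval_mul (hI.mul_lt (r := min t (h + d)) (by omega))
  have hmask := BinOp.eval_sub_eval_shl_one hI.one_le_w
    (hI.mul_le (r := min t (h + d)) (by omega))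
  have hland := BinOp.eval_land (b := 2 ^ (c * min t (h + d)) - 1)
    ((Nat.div_le_self x (2 ^ (c * (t - d)))).trans_lt hxw)
  have hland' := BinOp.eval_land (b := 1) ((Nat.div_le_self D (2 ^ d)).trans_lt hDw)
  refine .block (by simp) ⟨rfl, ?_⟩
  simp [ShiftHit, hF₁.reg .t, hF₁.reg .d, hF₁.reg .x, hF₁.reg .u, hF₁.reg .dm, hB₁.reg_c,
    hB₁.reg_one, ht, hd, hx, hu, hD, hlen₁, hsub, hmul, hmul', hmask, hland, hland',
    BinOp.eval_shr hxw, BinOp.eval_land huw, BinOp.eval_shr hDw, Nat.testBit_eq_decide_div_mod_eq,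
    and_comm]

theorem shiftTest_ends (hI : Problem E n m c k p f) (hF : Fits E m k c t) (hB : Basics n m c k st)
    {h D x u d : ℕ} (ht : st.reg .t = t) (hh : st.reg .h = h) (hD : st.reg .dm = D)
    (hx : st.reg .x = x) (hu : st.reg .u = u) (hd : st.reg .d = d) (hdt : d < t) (hht : h < 2 ^ t)
    (hDw : D < 2 ^ E.w) (hxw : x < 2 ^ E.w) (huw : u < 2 ^ E.w) :
    Ends E shiftTest st fun T st' => (ShiftHit c t h D x u d ∧ st'.reg .res = d ∨
      ¬ ShiftHit c t h D x u d ∧ st'.reg .res = st.reg .res) ∧ T ≤ 18 := by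
  have hw := hF.two_pow_add_lt hI
  have hcopy := BinOp.eval_add (w := E.w) (a := 0) (b := d) (by omega)
  refine (shiftFields_ends hI hF hB ht hh hD hx hu hd hdt hht hDw hxw huw).seq ?_
  rintro T st₁ ⟨rfl, hiff⟩ hF₁
  have hB₁ := hB.of_frame hF₁
  rw [← hB₁.reg_one] at hiff
  refine .ite (fun hq => .ite (fun hq' => .block (by simp) ⟨.inl ⟨hiff.mpr ⟨hq, hq'⟩, ?_⟩, ?_⟩)
    fun hq' => .block (by simp) ⟨.inr ⟨fun h => hq' (hiff.mp h).2, ?_⟩, ?_⟩)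
    fun hq => .block (by simp) ⟨.inr ⟨fun h => hq (hiff.mp h).1, ?_⟩, ?_⟩ <;>
    simp [hB₁.reg_zero, hF₁.reg .d, hF₁.reg .res, hd, hcopy]

/-- Compute, in `y` and `z`, the parts of the block and of the pattern that overlap if the pattern
starts at offset `d` of the block. -/
def startFields : Com Var :=
  .seq (.block [.op .sub .len .t .d])
    (.seq (cap .len .m)
      (.block [.op .mul .y .c .d, .op .shr .y .u .y, .op .mul .len .c .len, .op .shl .z .one .len,
        .op .sub .z .z .one, .op .land .y .y .z, .op .land .z .head .z]))

/-- Set `res` to `d` if the pattern may start at offset `d`, at least `lo`, of the block. -/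
def startTest : Com Var :=
  .seq startFields
    (.ite (.eq .y .z)
      (.ite (.lt .d .lo) (.block []) (.block [.op .add .res .zero .d]))
      (.block []))

theorem startFields_ends (hI : Problem E n m c k p f) (hF : Fits E m k c t)
    (hB : Basics n m c k st) {x u d : ℕ} (ht : st.reg .t = t) (hx : st.reg .head = x)
    (hu : st.reg .u = u) (hd : st.reg .d = d) (hdt : d < t) (hxw : x < 2 ^ E.w)
    (huw : u < 2 ^ E.w) :
    Ends E startFields st fun T st' => T = 10 ∧
      (StartHit c t m x u d ↔ st'.reg .y = st'.reg .z) := by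
  have hw := hF.lt_two_pow hI
  have hmw := hI.m_le.trans_lt hI.n_lt
  have htk := hF.two_t_le
  have hsub := BinOp.eval_sub (w := E.w) (a := t) (b := d) hdt.le (by omega)
  refine .block_seq (by simp) ((cap_ends (hB.of_frame (frame_execAll ..)) (by
    simpa [hB.reg_m] using hmw)).seq ?_)
  rintro T st₁ ⟨rfl, hlen₁⟩ hF₁
  replace hlen₁ : st₁.reg .len = min m (t - d) := by simpa [ht, hB.reg_m, hd, hsub] using hlen₁
  replace hF₁ : Frame (.seq (.block [.op .sub .len .t .d]) (cap .len .m)) st st₁ :=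
    ((frame_execAll E _ st).mono (by simp [Com.basics])).trans (hF₁.mono (by simp [Com.basics]))
  have hB₁ := hB.of_frame hF₁
  have hmul := BinOp.eval_mul (hI.mul_lt (r := d) (by omega))
  have hmul' := BinOp.eval_mul (hI.mul_lt (r := min m (t - d)) (by omega))
  have hmask := BinOp.eval_sub_eval_shl_one hI.one_le_w
    (hI.mul_le (r := min m (t - d)) (by omega))
  have hland := BinOp.eval_land (b := 2 ^ (c * min m (t - d)) - 1)
    ((Nat.div_le_self u (2 ^ (c * d))).trans_lt huw)
  refine .block (by simp) ⟨rfl, ?_⟩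
  simp [StartHit, hF₁.reg .d, hF₁.reg .u, hF₁.reg .head, hB₁.reg_c, hB₁.reg_one, hd, hx, hu, hlen₁,
    hmul, hmul', hmask, hland, BinOp.eval_shr huw, BinOp.eval_land hxw]

theorem startTest_ends (hI : Problem E n m c k p f) (hF : Fits E m k c t) (hB : Basics n m c k st)
    {a x u d : ℕ} (ht : st.reg .t = t) (ha : st.reg .lo = a) (hx : st.reg .head = x)
    (hu : st.reg .u = u) (hd : st.reg .d = d) (hdt : d < t) (hxw : x < 2 ^ E.w)
    (huw : u < 2 ^ E.w) :
    Ends E startTest st fun T st' => ((a ≤ d ∧ StartHit c t m x u d) ∧ st'.reg .res = d ∨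
      ¬ (a ≤ d ∧ StartHit c t m x u d) ∧ st'.reg .res = st.reg .res) ∧ T ≤ 18 := by
  have hw := hF.lt_two_pow hI
  have hcopy := BinOp.eval_add (w := E.w) (a := 0) (b := d) (by omega)
  refine (startFields_ends hI hF hB ht hx hu hd hdt hxw huw).seq ?_
  rintro T st₁ ⟨rfl, hiff⟩ hF₁
  have hB₁ := hB.of_frame hF₁
  have hlo : a ≤ d ↔ ¬ st₁.reg .d < st₁.reg .lo := by rw [hF₁.reg .d, hF₁.reg .lo, hd, ha, not_lt]
  refine .ite (fun hq => .ite (fun hq' => .block (by simp) ⟨.inr ⟨fun h => hlo.mp h.1 hq', ?_⟩, ?_⟩)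
    fun hq' => .block (by simp) ⟨.inl ⟨⟨hlo.mpr hq', hiff.mpr hq⟩, ?_⟩, ?_⟩)
    fun hq => .block (by simp) ⟨.inr ⟨fun h => hq (hiff.mp h.2), ?_⟩, ?_⟩ <;>
    simp [hB₁.reg_zero, hF₁.reg .d, hF₁.reg .res, hd, hcopy]

/-- The entry number `a` of the table of shifts is `r`. -/
def ShiftEntry (c t a r : ℕ) : Prop :=
  IsFirst (ShiftHit c t (a / 2 ^ (c * t) / 2 ^ (c * (2 * t)) / 2 ^ t)
    (a / 2 ^ (c * t) / 2 ^ (c * (2 * t)) % 2 ^ t) (a / 2 ^ (c * t) % 2 ^ (c * (2 * t)))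
    (a % 2 ^ (c * t))) 0 t r

/-- The entry number `a` of the table of starts, for a pattern that starts with `y`, is `r`. -/
def StartEntry (c t m y a r : ℕ) : Prop :=
  IsFirst (StartHit c t m y (a % 2 ^ (c * t))) (a / 2 ^ (c * t)) t r

/-- Compute the entry number `idx` of the table of shifts. -/
def shiftEntry : Com Var :=
  .seq (.block [.op .land .u .idx .maskT, .op .shr .z .idx .ct, .op .land .x .z .maskW,
      .op .shr .z .z .cw, .op .land .dm .z .maskD, .op .shr .h .z .t])
    (firstHit shiftTest)

/-- Compute the entry number `idx` of the table of starts. -/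
def startEntry : Com Var :=
  .seq (.block [.op .land .u .idx .maskT, .op .shr .lo .idx .ct]) (firstHit startTest)

theorem shiftEntry_ends (hI : Problem E n m c k p f) (hF : Fits E m k c t)
    (hB : Basics n m c k st) (hl : Layout m c t p st) (ha : st.reg .idx < shiftSize c t) :
    Ends E shiftEntry st fun T st' =>
      ShiftEntry c t (st.reg .idx) (st'.reg .res) ∧ T ≤ 21 * t + 10 := by
  have hw := hF.lt_two_pow hI
  have hbound := hF.bound_eq
  have hbw := hI.bound_le
  generalize ha' : st.reg .idx = a at ha ⊢
  have haw : a < 2 ^ E.w := by omega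
  have hzw : a / 2 ^ (c * t) < 2 ^ E.w := (Nat.div_le_self ..).trans_lt haw
  have hyw : a / 2 ^ (c * t) / 2 ^ (c * (2 * t)) < 2 ^ E.w := (Nat.div_le_self ..).trans_lt hzw
  have hht : a / 2 ^ (c * t) / 2 ^ (c * (2 * t)) / 2 ^ t < 2 ^ t := by
    rw [Nat.div_div_eq_div_mul, Nat.div_div_eq_div_mul, Nat.div_lt_iff_lt_mul (by positivity),
      ← pow_add, ← pow_add, ← pow_add]
    exact ha.trans_eq (by rw [shiftSize]; ring)
  refine .block_seq (by simp) ((firstHit_ends (t := t) (K := 18)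
    (G := ShiftHit c t (a / 2 ^ (c * t) / 2 ^ (c * (2 * t)) / 2 ^ t)
      (a / 2 ^ (c * t) / 2 ^ (c * (2 * t)) % 2 ^ t) (a / 2 ^ (c * t) % 2 ^ (c * (2 * t)))
      (a % 2 ^ (c * t)))
    (by simp [hB.reg_zero]) (by simp [hB.reg_one]) (by simp [hl.reg_t]) (by omega) (by decide)
    fun st₁ hF₁ hd => ?_).mono_frame ?_)
  · refine shiftTest_ends hI hF ((hB.of_frame (frame_execAll ..)).of_frame hF₁)
      (by simp [hF₁.reg .t, hl.reg_t]) ?_ ?_ ?_ ?_ rfl hd hht ((Nat.mod_le ..).trans_lt hyw)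
      ((Nat.mod_le ..).trans_lt hzw) ((Nat.mod_le ..).trans_lt haw)
    all_goals simp [hF₁.reg .h, hF₁.reg .dm, hF₁.reg .x, hF₁.reg .u, ha', hl.reg_maskT, hl.reg_ct,
      hl.reg_maskW, hl.reg_cw, hl.reg_maskD, hl.reg_t, BinOp.eval_land haw, BinOp.eval_shr haw,
      BinOp.eval_land hzw, BinOp.eval_shr hzw, BinOp.eval_land hyw, BinOp.eval_shr hyw,
      Nat.and_two_pow_sub_one_eq_mod]
  · rintro T st₂ ⟨hfirst, hT⟩ -
    exact ⟨hfirst, by simp; omega⟩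

theorem startEntry_ends (hI : Problem E n m c k p f) (hF : Fits E m k c t)
    (hB : Basics n m c k st) (hl : Layout m c t p st) (ha : st.reg .idx < startSize c t) :
    Ends E startEntry st fun T st' =>
      StartEntry c t m (chunk c p 0 t) (st.reg .idx) (st'.reg .res) ∧ T ≤ 21 * t + 10 := by
  have hw := hF.lt_two_pow hI
  have htk := hF.two_t_le
  have hbound := hF.bound_eq
  have hbw := hI.bound_le
  generalize ha' : st.reg .idx = a at ha ⊢
  have haw : a < 2 ^ E.w := by omega
  have hhead : chunk c p 0 t < 2 ^ E.w := (chunk_lt hI.p_lt 0 t).trans_le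
    (Nat.pow_le_pow_right (by norm_num) (hI.mul_le (by omega)))
  refine .block_seq (by simp) ((firstHit_ends (t := t) (K := 18)
    (G := fun d => a / 2 ^ (c * t) ≤ d ∧ StartHit c t m (chunk c p 0 t) (a % 2 ^ (c * t)) d)
    (by simp [hB.reg_zero]) (by simp [hB.reg_one]) (by simp [hl.reg_t]) (by omega) (by decide)
    fun st₁ hF₁ hd => ?_).mono_frame ?_)
  · refine startTest_ends hI hF ((hB.of_frame (frame_execAll ..)).of_frame hF₁)
      (by simp [hF₁.reg .t, hl.reg_t]) ?_ (by simp [hF₁.reg .head, hl.reg_head]) ?_ rfl hd hhead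
      ((Nat.mod_le ..).trans_lt haw)
    all_goals simp [hF₁.reg .lo, hF₁.reg .u, ha', hl.reg_maskT, hl.reg_ct, BinOp.eval_land haw,
      BinOp.eval_shr haw, Nat.and_two_pow_sub_one_eq_mod]
  · rintro T st₂ ⟨hfirst, hT⟩ -
    exact ⟨isFirst_and_le_iff.mp hfirst, by simp; omega⟩

end Entries

/-! ### Table lookups -/

section Lookups

/-- The text before position `e` does not rule out an occurrence of `p`, of length `m`, at `s`. -/
def Survives (p f : ℕ → ℕ) (m e s : ℕ) : Prop :=
  Agrees p f s (min e (s + m))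

/-- All tables have been computed: the masks of the short periods of the prefixes of `p`, their
borders with period at least `t`, the table of shifts and the table of starts. -/
structure Tables (m c t : ℕ) (p mem : ℕ → ℕ) : Prop where
  masks : ∀ j ≤ m, PeriodMask p t j (mem (m + 1 + j))
  borders : ∀ j, t ≤ j → j ≤ m → Border p t j (mem (2 * (m + 1) + j))
  shifts : ∀ a < shiftSize c t, ShiftEntry c t a (mem (3 * (m + 1) + a))
  starts : ∀ a < startSize c t,
    StartEntry c t m (chunk c p 0 t) a (mem (3 * (m + 1) + shiftSize c t + a))

section Index

theorem IsFirst.congr {G G' : ℕ → Prop} {lo t v : ℕ} (hG : ∀ d < t, G d ↔ G' d)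
    (h : IsFirst G lo t v) : IsFirst G' lo t v :=
  ⟨h.1, fun hv => ⟨(h.2.1 hv).1, (hG v hv).mp (h.2.1 hv).2⟩,
    fun d hd hdv hd' => h.2.2 d hd hdv ((hG d (hdv.trans_le h.1)).mpr hd')⟩

theorem IsFirst.le {G : ℕ → Prop} {lo t v : ℕ} (h : IsFirst G lo t v) (hlo : lo ≤ t) : lo ≤ v := by
  by_contra! hv
  have := (h.2.1 (by omega)).1
  omega

theorem shiftHit_div_mul_iff {c t h D a x u d : ℕ} :
    ShiftHit c t h (D / 2 ^ a * 2 ^ a) x u d ↔ a ≤ d ∧ ShiftHit c t h D x u d := by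
  rw [ShiftHit, ShiftHit, Nat.testBit_mul_two_pow, Nat.testBit_div_two_pow]
  by_cases had : a ≤ d <;> simp [had]

/-- The index of the table of shifts with the fields `h`, `D`, `x` and `u`. -/
def shiftIndex (c t h D x u : ℕ) : ℕ :=
  ((h * 2 ^ t + D) * 2 ^ (c * (2 * t)) + x) * 2 ^ (c * t) + u

variable {w c t h D x u : ℕ}

theorem mul_two_pow_add_lt {a b A L : ℕ} (ha : a < 2 ^ A) (hb : b < 2 ^ L) :
    a * 2 ^ L + b < 2 ^ (A + L) := by
  rw [mul_comm, pow_add]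
  exact Nat.mul_add_lt_mul_of_lt_of_lt ha hb

theorem mul_add_div_of_lt {a b r : ℕ} (hr : r < b) : (a * b + r) / b = a := by
  rw [mul_comm, Nat.mul_add_div (by omega), Nat.div_eq_of_lt hr, add_zero]

theorem shiftIndex_lt (hh : h < 2 ^ t) (hD : D < 2 ^ t) (hx : x < 2 ^ (c * (2 * t)))
    (hu : u < 2 ^ (c * t)) : shiftIndex c t h D x u < shiftSize c t :=
  (mul_two_pow_add_lt (mul_two_pow_add_lt (mul_two_pow_add_lt hh hD) hx) hu).trans_eq
    (by rw [shiftSize]; congr 1; ring)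

theorem shiftEntry_shiftIndex (hD : D < 2 ^ t) (hx : x < 2 ^ (c * (2 * t))) (hu : u < 2 ^ (c * t))
    (r : ℕ) : ShiftEntry c t (shiftIndex c t h D x u) r ↔ IsFirst (ShiftHit c t h D x u) 0 t r := by
  rw [ShiftEntry, shiftIndex, mul_add_div_of_lt hu, Nat.mul_add_mod_of_lt hu, mul_add_div_of_lt hx,
    Nat.mul_add_mod_of_lt hx, mul_add_div_of_lt hD, Nat.mul_add_mod_of_lt hD]

theorem eval_add_eval_shl {a b r : ℕ} (h : a * 2 ^ b + r < 2 ^ w) :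
    BinOp.eval w .add (BinOp.eval w .shl a b) r = a * 2 ^ b + r := by
  rw [BinOp.eval_shl (by omega), BinOp.eval_add h]

theorem eval_shiftIndex (hw : shiftIndex c t h D x u < 2 ^ w) :
    BinOp.eval w .add (BinOp.eval w .shl (BinOp.eval w .add (BinOp.eval w .shl (BinOp.eval w .add
      (BinOp.eval w .shl h t) D) (c * (2 * t))) x) (c * t)) u = shiftIndex c t h D x u := by
  unfold shiftIndex at hw ⊢
  have hfst : h * 2 ^ t + D ≤ (h * 2 ^ t + D) * 2 ^ (c * (2 * t)) :=
    Nat.le_mul_of_pos_right _ (by positivity)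
  have hsnd := Nat.le_mul_of_pos_right ((h * 2 ^ t + D) * 2 ^ (c * (2 * t)) + x)
    (show 0 < 2 ^ (c * t) by positivity)
  rw [eval_add_eval_shl (a := h) (by omega), eval_add_eval_shl (b := c * (2 * t)) (by omega),
    eval_add_eval_shl hw]

end Index

/-- Load the window around position `q` of the pattern. -/
def fetchWindow : Com Var :=
  .ite (.lt .q .t)
    (.seq (fetch .pattern .x .zero .maskW)
      (.block [.op .sub .y .t .q, .op .mul .y .c .y, .op .shl .x .x .y, .op .land .x .x .maskW]))
    (.seq (.block [.op .sub .y .q .t]) (fetch .pattern .x .y .maskW))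

/-- Look up the first shift, at least `lo`, in the table of shifts. -/
def readShift : Com Var :=
  .block [.op .add .z .baseD .q, .load .dm .z, .op .shr .dm .dm .lo, .op .shl .dm .dm .lo,
    .op .shl .v .h .t, .op .add .v .v .dm, .op .shl .v .v .cw, .op .add .v .v .x,
    .op .shl .v .v .ct, .op .add .v .v .u, .op .add .v .baseT .v, .load .v .v]

/-- Find the first shift, at least `lo`, that survives the block `u` in the state `q`. -/
def lookupShift : Com Var :=
  .seq (.block [.op .sub .h .m .q]) (.seq (cap .h .t) (.seq fetchWindow readShift))

/-- Find the first offset, at least `lo`, in the block `u` at which the pattern may start. -/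
def lookupStart : Com Var :=
  .block [.op .shl .v .lo .ct, .op .add .v .v .u, .op .add .v .baseU .v, .load .v .v,
    .op .add .y .v .m]

section Lookup

variable {E : Env} {n m c k t : ℕ} {p f : ℕ → ℕ} {st : Store Var}

theorem fetchWindow_ends (hI : Problem E n m c k p f) (hF : Fits E m k c t)
    (hB : Basics n m c k st) (hl : Layout m c t p st) {q : ℕ} (hq : st.reg .q = q) (hqm : q ≤ m) :
    Ends E fetchWindow st fun T st' => T ≤ 17 ∧ st'.reg .x = window c t p q := by
  have htw := hF.lt_two_pow hI
  have htk := hF.two_t_le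
  have hnw := hI.n_lt
  have hmn := hI.m_le
  refine .ite (fun hc => ?_) fun hc => .block_seq (by simp) ?_ <;>
    simp only [Cond.Holds, hq, hl.reg_t] at hc
  · refine (fetch_ends hB hI.p_lt hI.pattern hI.one_le_k hI.one_le_c hI.word hB.reg_zero
      (by positivity) hl.reg_maskW htk).seq ?_
    rintro T st₁ ⟨rfl, hx₁⟩ hF₁
    have hsub := BinOp.eval_sub hc.le htw
    have hmul := BinOp.eval_mul (hI.mul_lt (r := t - q) (by omega))
    have hmod : BinOp.eval E.w .land (BinOp.eval E.w .shl (chunk c p 0 (2 * t)) (c * (t - q)))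
        (2 ^ (c * (2 * t)) - 1) = (chunk c p 0 (2 * t) <<< (c * (t - q))) % 2 ^ (c * (2 * t)) := by
      rw [BinOp.eval_land (BinOp.eval_lt ..), Nat.and_two_pow_sub_one_eq_mod, BinOp.eval,
        Nat.mod_mod_of_dvd _ (pow_dvd_pow _ (hI.mul_le htk))]
    refine .block (by simp) ⟨by simp, ?_⟩
    simpa [hF₁.reg .q, hF₁.reg .t, hF₁.reg .c, hF₁.reg .maskW, hq, hl.reg_t, hB.reg_c, hl.reg_maskW,
      hsub, hmul, hx₁, window, hc] using hmod
  · have hsub := BinOp.eval_sub (w := E.w) (a := q) (b := t) (by omega) (by omega)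
    refine (fetch_ends (hB.of_frame (frame_execAll ..)) hI.p_lt hI.pattern hI.one_le_k hI.one_le_c
      hI.word (i := q - t) (L := 2 * t) (by simp [hq, hl.reg_t, hsub]) (by omega)
      (by simp [hl.reg_maskW]) htk).mono_frame ?_
    rintro T st₁ ⟨rfl, hx₁⟩ -
    exact ⟨by simp, by rw [hx₁, window, if_neg hc]⟩

theorem readShift_ends (hI : Problem E n m c k p f) (hF : Fits E m k c t)
    (hl : Layout m c t p st) (hT : Tables m c t p st.mem) {q a h x u : ℕ} (hq : st.reg .q = q)
    (hqm : q ≤ m) (ha : st.reg .lo = a) (hh : st.reg .h = h) (hx : st.reg .x = x)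
    (hu : st.reg .u = u) (hht : h < 2 ^ t) (hxt : x < 2 ^ (c * (2 * t))) (hut : u < 2 ^ (c * t)) :
    Ends E readShift st fun T st' => T = 12 ∧
      IsFirst (ShiftHit c t h (st.mem (m + 1 + q)) x u) a t (st'.reg .v) := by
  have hw := hF.two_pow_add_lt hI
  have hbound := hF.bound_eq
  have hbw := hI.bound_le
  have hDt := (hT.masks q hqm).lt
  have hbase := BinOp.eval_add (w := E.w) (a := m + 1) (b := q) (by omega)
  generalize hD : st.mem (m + 1 + q) = D at hDt ⊢
  have hDa : D / 2 ^ a * 2 ^ a < 2 ^ t := (Nat.div_mul_le_self ..).trans_lt hDt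
  have hidx := shiftIndex_lt hht hDa hxt hut
  have hentry := (shiftEntry_shiftIndex hDa hxt hut _).mp (hT.shifts _ hidx)
  have hshr := BinOp.eval_shr (w := E.w) (a := D) (b := a) (by omega)
  have hshl := BinOp.eval_shl (w := E.w) (a := D / 2 ^ a) (b := a) (by omega)
  have hindex := eval_shiftIndex (w := E.w) (hidx.trans_le (by omega))
  have haddr := BinOp.eval_add (w := E.w) (a := 3 * (m + 1))
    (b := shiftIndex c t h (D / 2 ^ a * 2 ^ a) x u) (by omega)
  refine .block ?_ ⟨rfl, ?_⟩
  · simp [hq, ha, hh, hx, hu, hl.reg_baseD, hl.reg_t, hl.reg_cw, hl.reg_ct, hl.reg_baseT, hbase, hD,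
      hshr, hshl, hindex, haddr]
    omega
  · refine isFirst_and_le_iff.mp (.congr (fun d _ => shiftHit_div_mul_iff) ?_)
    simpa [hq, ha, hh, hx, hu, hl.reg_baseD, hl.reg_t, hl.reg_cw, hl.reg_ct, hl.reg_baseT, hbase,
      hD, hshr, hshl, hindex, haddr] using hentry

theorem lookupShift_ends (hI : Problem E n m c k p f) (hF : Fits E m k c t)
    (hB : Basics n m c k st) (hl : Layout m c t p st) (hT : Tables m c t p st.mem) {q a s i : ℕ}
    (hq : st.reg .q = q) (hqm : q ≤ m) (ha : st.reg .lo = a) (hu : st.reg .u = chunk c f i t)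
    (hi : s + q = i) (hs : Agrees p f s i) :
    Ends E lookupShift st fun T st' => T ≤ 32 ∧ st'.reg .h = min t (m - q) ∧
      IsFirst (fun d => s + d ≤ i ∧ Survives p f m (i + t) (s + d)) a t (st'.reg .v) := by
  have hw := hF.lt_two_pow hI
  have hsub := BinOp.eval_sub (w := E.w) hqm (hI.m_le.trans_lt hI.n_lt)
  refine .block_seq (by simp) ((cap_ends (hB.of_frame (frame_execAll ..)) (by
    simpa [hl.reg_t] using hw)).seq ?_)
  rintro T₁ st₁ ⟨rfl, hh₁⟩ hF₁
  replace hh₁ : st₁.reg .h = min t (m - q) := by simpa [hl.reg_t, hB.reg_m, hq, hsub] using hh₁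
  replace hF₁ : Frame (.seq (.block [.op .sub .h .m .q]) (cap .h .t)) st st₁ :=
    ((frame_execAll E _ st).mono (by simp [Com.basics])).trans (hF₁.mono (by simp [Com.basics]))
  refine (fetchWindow_ends hI hF (hB.of_frame hF₁) (hl.of_frame hF₁) (hF₁.reg .q) (hq ▸ hqm)).seq ?_
  rintro T₂ st₂ ⟨hT₂, hx₂⟩ hF₂
  refine (readShift_ends hI hF ((hl.of_frame hF₁).of_frame hF₂) (by rwa [hF₂.mem, hF₁.mem])
    (by rw [hF₂.reg .q, hF₁.reg .q, hq]) hqm (by rw [hF₂.reg .lo, hF₁.reg .lo, ha])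
    (by rw [hF₂.reg .h, hh₁]) (by rw [hx₂, hq]) (by rw [hF₂.reg .u, hF₁.reg .u, hu])
    ((min_le_left ..).trans_lt Nat.lt_two_pow_self) (window_lt hI.p_lt q)
    (chunk_lt hI.f_lt i t)).mono_frame ?_
  rintro T₃ st₃ ⟨rfl, hv⟩ hF₃
  refine ⟨by simp; omega, by rw [hF₃.reg .h, hF₂.reg .h, hh₁], hv.congr fun d hd => ?_⟩
  rw [hF₂.mem, hF₁.mem]
  exact shiftHit_iff hI.p_lt hI.f_lt hi hqm (hT.masks q hqm) hs hd

theorem lookupStart_ends (hI : Problem E n m c k p f) (hF : Fits E m k c t)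
    (hB : Basics n m c k st) (hl : Layout m c t p st) (hT : Tables m c t p st.mem) {a i : ℕ}
    (ha : st.reg .lo = a) (hat : a ≤ t) (hu : st.reg .u = chunk c f i t) :
    Ends E lookupStart st fun T st' => T = 5 ∧ st'.reg .y = st'.reg .v + m ∧
      IsFirst (fun d => Survives p f m (i + t) (i + d)) a t (st'.reg .v) := by
  have hbw := hI.bound_le
  have hbound := hF.bound_eq
  have hut := chunk_lt hI.f_lt i t
  generalize hu' : chunk c f i t = u at hu hut
  have hidx : a * 2 ^ (c * t) + u < startSize c t :=
    (mul_two_pow_add_lt (hat.trans_lt Nat.lt_two_pow_self) hut).trans_eq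
      (by rw [startSize, add_comm])
  have hv := hT.starts _ hidx
  rw [StartEntry, mul_add_div_of_lt hut, Nat.mul_add_mod_of_lt hut] at hv
  have htS : t < shiftSize c t :=
    Nat.lt_two_pow_self.trans_le (Nat.pow_le_pow_right (by norm_num) (by omega))
  have hindex := eval_add_eval_shl (w := E.w) (a := a) (b := c * t) (r := u) (by omega)
  have haddr := BinOp.eval_add (w := E.w) (a := 3 * (m + 1) + shiftSize c t)
    (b := a * 2 ^ (c * t) + u) (by omega)
  have hadd := BinOp.eval_add (w := E.w) (b := m) ((Nat.add_le_add_right hv.1 m).trans_lt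
    (by omega))
  refine .block ?_ ⟨rfl, ?_, ?_⟩
  · simp [ha, hl.reg_ct, hu, hl.reg_baseU, hindex, haddr]
    omega
  · simp [ha, hl.reg_ct, hu, hl.reg_baseU, hB.reg_m, hindex, haddr, hadd]
  · simpa [ha, hl.reg_ct, hu, hl.reg_baseU, hindex, haddr, Survives] using
      hv.congr fun d hd => hu' ▸ startHit_iff hI.p_lt hI.f_lt hd.le

end Lookup

end Lookups

/-! ### Alignments that start inside a block -/

section Starts

section Resolved

open Classical in
/-- The number of alignments in `[S, X)` with a full match, possibly beyond the end of the text. -/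
noncomputable def fullMatches (p f : ℕ → ℕ) (m X S : ℕ) : ℕ :=
  ((Finset.Ico S X).filter fun s => Agrees p f s (s + m)).card

variable {p f : ℕ → ℕ} {n m X S S' e : ℕ} {out : List ℕ}

theorem fullMatches_anti (p f : ℕ → ℕ) (m X : ℕ) (h : S ≤ S') :
    fullMatches p f m X S' ≤ fullMatches p f m X S := by
  classical
  exact Finset.card_le_card (Finset.filter_subset_filter _ (Finset.Ico_subset_Ico_left h))

theorem fullMatches_succ (hX : S < X) (h : Agrees p f S (S + m)) :
    fullMatches p f m X (S + 1) + 1 ≤ fullMatches p f m X S := by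
  classical
  unfold fullMatches
  rw [← Finset.insert_Ico_add_one_left_eq_Ico hX, Finset.filter_insert, if_pos h,
    Finset.card_insert_of_notMem (by simp)]

/-- The alignments before `S` are settled by the text before `e`: the occurrences among them have
been reported, and none of the alignments that reach position `e` can still become one. -/
structure Resolved (p f : ℕ → ℕ) (n m e S : ℕ) (out : List ℕ) : Prop where
  out_eq : out = occList p f n m S
  not_agrees : ∀ s < S, e ≤ s + m → ¬ Agrees p f s e

theorem Resolved.skip (h : Resolved p f n m e S out) (hS : S ≤ S') (he : S' ≤ e)
    (hn : ∀ s, S ≤ s → s < S' → ¬ Survives p f m e s) : Resolved p f n m e S' out := by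
  refine ⟨?_, fun s hs hes ha => ?_⟩
  · rw [h.out_eq, occList_eq_of_le hS fun s h1 h2 ho =>
      hn s h1 h2 (ho.1.anti (by omega) (min_le_right ..))]
  · by_cases hlt : s < S
    · exact h.not_agrees s hlt hes ha
    · exact hn s (by omega) hs (by rwa [Survives, min_eq_left hes])

theorem Resolved.report (h : Resolved p f n m e S out) (ha : Agrees p f S (S + m)) (he : S + m < e)
    (hn : S + m ≤ n) : Resolved p f n m e (S + 1) (out ++ [S]) := by
  classical
  refine ⟨by rw [occList_succ, if_pos ⟨ha, hn⟩, h.out_eq], fun s hs hes => ?_⟩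
  exact h.not_agrees s (by omega) hes

theorem Resolved.discard (h : Resolved p f n m e S out) (he : S + m < e) (hn : n < S + m) :
    Resolved p f n m e (S + 1) out := by
  classical
  refine ⟨by rw [occList_succ, if_neg fun ho => hn.not_ge ho.2, h.out_eq], fun s hs hes => ?_⟩
  exact h.not_agrees s (by omega) hes

theorem Resolved.advance {e' : ℕ} (h : Resolved p f n m e S out) (he : e ≤ e') (hS : S ≤ e) :
    Resolved p f n m e' S out :=
  ⟨h.out_eq, fun s hs hes ha => h.not_agrees s hs (he.trans hes) (ha.anti (by omega) he)⟩

end Resolved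

/-- Report the occurrence at position `z`, unless it ends, `y` characters after the start of the
block, beyond the end of the text. -/
def reportIfFits : Com Var :=
  .ite (.lt .rem .y) (.block []) (.block [.report .z])

/-- Report the match that starts at offset `v` of the block, and find the next start. -/
def startScanRound : Com Var :=
  .seq (.block [.op .add .z .pos .v])
    (.seq reportIfFits (.seq (.block [.op .add .lo .v .one]) lookupStart))

/-- Report the occurrences inside the block `u` from offset `1` on, and pass to the first alignment
that survives the block. -/
def startScan : Com Var :=
  .seq (.block [.const .lo 1])
    (.seq lookupStart
      (.seq (.loop (.lt .y .t) startScanRound)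
        (.block [.op .sub .q .t .v, .const .lo 0, .op .add .off .zero .t])))

/-- The block of the text at position `i` has been loaded; parameters and tables are in place. -/
structure Loaded (n m c k t : ℕ) (p f : ℕ → ℕ) (i : ℕ) (st : Store Var) : Prop where
  basics : Basics n m c k st
  layout : Layout m c t p st
  tables : Tables m c t p st.mem
  le_n : i ≤ n
  reg_u : st.reg .u = chunk c f i t
  reg_pos : st.reg .pos = i
  reg_rem : st.reg .rem = n - i

variable {E : Env} {n m c k t : ℕ} {p f : ℕ → ℕ} {i X : ℕ} {st : Store Var}

theorem Loaded.of_frame {a : Com Var} {st' : Store Var} (h : Loaded n m c k t p f i st)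
    (hF : Frame a st st')
    (hb : ∀ r ∈ [Var.n, .m, .c, .k, .zero, .one, .maskC], r ∉ a.targets := by decide)
    (hl : ∀ r ∈ [Var.t, .ct, .cw, .maskT, .maskW, .maskD, .baseD, .baseJ, .baseT, .baseU, .head],
      r ∉ a.targets := by decide)
    (hu : ∀ r ∈ [Var.u, .pos, .rem], r ∉ a.targets := by decide)
    (hm : a.basics.any Basic.isStore = false := by decide) : Loaded n m c k t p f i st' :=
  ⟨h.basics.of_frame hF hb, h.layout.of_frame hF hl, by rw [hF.mem hm]; exact h.tables, h.le_n,
    by rw [hF.reg .u (hu _ (by simp)), h.reg_u], by rw [hF.reg .pos (hu _ (by simp)), h.reg_pos],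
    by rw [hF.reg .rem (hu _ (by simp)), h.reg_rem]⟩

theorem reportIfFits_ends {e S : ℕ} (hrem : st.reg .rem < st.reg .y ↔ n < S + m)
    (hz : S + m ≤ n → st.reg .z = S) (ha : Agrees p f S (S + m)) (he : S + m < e)
    (hR : Resolved p f n m e S st.out) :
    Ends E reportIfFits st fun T st' => T ≤ 3 ∧ Resolved p f n m e (S + 1) st'.out := by
  refine .ite (fun hc => .block (by simp) ⟨by simp, ?_⟩)
    fun hc => .block (by simp) ⟨by simp, ?_⟩ <;> simp only [Cond.Holds, hrem] at hc
  · exact hR.discard he hc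
  · simpa [hz (not_lt.mp hc)] using hR.report ha he (not_lt.mp hc)

/-- The invariant of the search for starts in the block at position `i`. -/
structure ScanInv (p f : ℕ → ℕ) (n m t i : ℕ) (st : Store Var) : Prop where
  one_le : 1 ≤ st.reg .lo
  le_t : st.reg .lo ≤ t
  first : IsFirst (fun d => Survives p f m (i + t) (i + d)) (st.reg .lo) t (st.reg .v)
  reg_y : st.reg .y = st.reg .v + m
  resolved : Resolved p f n m (i + t) (i + st.reg .lo) st.out

theorem ScanInv.resolved_v (h : ScanInv p f n m t i st) :
    Resolved p f n m (i + t) (i + st.reg .v) st.out := by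
  have hle := h.first.le h.le_t
  refine h.resolved.skip (by omega) (by have := h.first.1; omega) fun s hs hsv => ?_
  obtain ⟨d, rfl⟩ := Nat.exists_eq_add_of_le (show i ≤ s by omega)
  exact h.first.2.2 d (by omega) (by omega)

theorem startScanRound_ends (hI : Problem E n m c k p f) (hF : Fits E m k c t)
    (hC : Loaded n m c k t p f i st) (hX : i + t ≤ X) (hinv : ScanInv p f n m t i st)
    (hy : st.reg .y < t) :
    Ends E startScanRound st fun T st' => ScanInv p f n m t i st' ∧
      60 * fullMatches p f m X (i + st'.reg .lo) + T + 2 ≤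
        60 * fullMatches p f m X (i + st.reg .lo) := by
  have htw := hF.lt_two_pow hI
  have hnw := hI.n_lt
  have hin := hC.le_n
  have hyv := hinv.reg_y
  have hm := hI.one_le_m
  obtain ⟨hlo, hsur⟩ := hinv.first.2.1 (by omega)
  rw [Survives, min_eq_right (by omega)] at hsur
  have hcount : fullMatches p f m X (i + (st.reg .v + 1)) + 1 ≤
      fullMatches p f m X (i + st.reg .v) := fullMatches_succ (S := i + st.reg .v) (by omega) hsur
  have hanti := fullMatches_anti p f m X (Nat.add_le_add_left hlo i)
  have hR := hinv.resolved_v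
  generalize hv : st.reg .v = v at *
  have hvt : v < t := by omega
  have hone := BinOp.eval_add (w := E.w) (a := v) (b := 1) (by omega)
  refine .block_seq (by simp) ((reportIfFits_ends (e := i + t) (S := i + v) ?_ (fun hn => ?_) hsur
    (by omega) (by simpa using hR)).seq ?_)
  · simp [hC.reg_rem, hyv]
    omega
  · have hadd := BinOp.eval_add (w := E.w) (a := i) (b := v) (by omega)
    simp [hC.reg_pos, hv, hadd]
  rintro T₁ st₁ ⟨hT₁, hR₁⟩ hF₁
  replace hF₁ : Frame (.seq (.block [.op .add .z .pos .v]) reportIfFits) st st₁ :=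
    ((frame_execAll E _ st).mono (by simp [Com.basics])).trans (hF₁.mono (by simp [Com.basics]))
  have hC₁ := hC.of_frame hF₁
  have hC₂ := hC₁.of_frame (frame_execAll E [.op .add .lo .v .one] st₁)
  have hlo₂ : (execAll E [.op .add .lo .v .one] st₁).reg .lo = v + 1 := by
    simp [hF₁.reg .v, hv, hC₁.basics.reg_one, hone]
  refine .block_seq (by simp) ((lookupStart_ends hI hF hC₂.basics hC₂.layout hC₂.tables (i := i)
    hlo₂ (by omega) hC₂.reg_u).mono_frame ?_)
  rintro T st₂ ⟨rfl, hy₂, hfirst⟩ hF₂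
  have hlo₃ : st₂.reg .lo = v + 1 := (hF₂.reg .lo).trans hlo₂
  refine ⟨⟨by omega, by omega, by rwa [hlo₃], hy₂, ?_⟩, by rw [hlo₃]; simp; omega⟩
  rw [hlo₃, hF₂.out]
  exact hR₁

/-- The current alignment `s` agrees with the text before position `i`, and the alignments before
`s + a` are settled by the text before `e`. -/
structure Aligned (p f : ℕ → ℕ) (n m i e a : ℕ) (st : Store Var) (s : ℕ) : Prop where
  add_eq : s + st.reg .q = i
  q_le : st.reg .q ≤ m
  agrees : Agrees p f s i
  resolved : Resolved p f n m e (s + a) st.out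

theorem Aligned.congr {e a s : ℕ} {st' : Store Var} (h : Aligned p f n m i e a st s)
    (hq : st'.reg .q = st.reg .q) (hout : st'.out = st.out) : Aligned p f n m i e a st' s :=
  ⟨hq ▸ h.add_eq, hq ▸ h.q_le, h.agrees, hout ▸ h.resolved⟩

theorem ScanInv.aligned (h : ScanInv p f n m t i st) (hy : ¬ st.reg .y < t) {st' : Store Var}
    (hq : st'.reg .q = t - st.reg .v) (hout : st'.out = st.out) :
    Aligned p f n m (i + t) (i + t) 0 st' (i + st.reg .v) := by
  have hvt := h.first.1
  have hyv := h.reg_y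
  refine ⟨by omega, by omega, ?_, hout ▸ h.resolved_v⟩
  rcases hvt.lt_or_eq with hlt | heq
  · simpa [Survives, min_eq_left (show i + t ≤ i + st.reg .v + m by omega)] using
      (h.first.2.1 hlt).2
  · exact heq ▸ agrees_self ..

theorem startScan_ends (hI : Problem E n m c k p f) (hF : Fits E m k c t)
    (hC : Loaded n m c k t p f i st) (hX : i + t ≤ X)
    (hR : Resolved p f n m (i + t) (i + 1) st.out) :
    Ends E startScan st fun T st' => ∃ s', Aligned p f n m (i + t) (i + t) 0 st' s' ∧ i < s' ∧
      st'.reg .lo = 0 ∧ st'.reg .off = t ∧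
      T + 60 * fullMatches p f m X s' ≤ 60 * fullMatches p f m X (i + 1) + 11 := by
  have ht := hF.one_le_t
  have htw := hF.lt_two_pow hI
  have hC₁ := hC.of_frame (frame_execAll E [.const .lo 1] st)
  have hlo₁ : (execAll E [.const .lo 1] st).reg .lo = 1 := by
    simp [Nat.mod_eq_of_lt (show 1 < 2 ^ E.w by omega)]
  refine .block_seq (by simp) ((lookupStart_ends hI hF hC₁.basics hC₁.layout hC₁.tables (i := i)
    hlo₁ ht hC₁.reg_u).seq ?_)
  rintro T₁ st₁ ⟨rfl, hy₁, hfirst⟩ hF₁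
  replace hlo₁ := (hF₁.reg .lo).trans hlo₁
  replace hC₁ := hC₁.of_frame hF₁
  refine (Ends.loop (fun st => 60 * fullMatches p f m X (i + st.reg .lo)) (I := ScanInv p f n m t i)
    ⟨hlo₁.ge, by omega, by rwa [hlo₁], hy₁, ?_⟩ fun st₂ hF₂ hinv hc => ?_).seq ?_
  · rw [hlo₁, hF₁.out]
    exact hR
  · exact startScanRound_ends hI hF (hC₁.of_frame hF₂) hX hinv
      (by simpa [(hC₁.of_frame hF₂).layout.reg_t] using hc)
  rintro T₂ st₂ ⟨hinv, hc, hT₂⟩ hF₂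
  have hC₂ := hC₁.of_frame hF₂
  have hvt := hinv.first.1
  have hv := hinv.first.le hinv.le_t
  have hlo := hinv.one_le
  have hsub := BinOp.eval_sub hvt htw
  have hadd := BinOp.eval_add (w := E.w) (a := 0) (b := t) (by omega)
  have hanti := fullMatches_anti p f m X (Nat.add_le_add_left hv i)
  rw [hlo₁] at hT₂
  refine .block (by simp) ⟨i + st₂.reg .v, hinv.aligned (by simpa [hC₂.layout.reg_t] using hc)
    (by simp [hC₂.layout.reg_t, hsub]) (by simp), by omega, by simp,
    by simp [hC₂.layout.reg_t, hC₂.basics.reg_zero, hadd], by simp; omega⟩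

end Starts

/-! ### Processing a block -/

section Blocks

/-- Report the full match that results from shifting the pattern by `v`. -/
def fullShift : Com Var :=
  .seq (.block [.op .sub .z .pos .q, .op .add .z .z .v])
    (.seq reportIfFits (.block [.op .add .lo .v .one]))

/-- Shift the pattern by `v`, and pass the block. -/
def keepShift : Com Var :=
  .block [.op .sub .q .q .v, .op .add .q .q .t, .const .lo 0, .op .add .off .zero .t]

/-- Shift the pattern to its next border of period at least `t`. -/
def fallBack : Com Var :=
  .block [.op .add .z .baseJ .q, .load .q .z, .const .lo 0]

/-- Find the next surviving shift of the pattern. If it is below `t`, the match is completed inside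
the block or remains open at the end of the block. Otherwise all alignments within distance `t` are
excluded. -/
def shiftRound : Com Var :=
  .seq lookupShift
    (.ite (.lt .v .t)
      (.seq (.block [.op .add .y .h .v]) (.ite (.lt .y .t) fullShift keepShift))
      (.ite (.lt .q .t) startScan fallBack))

/-- Pass from the state before the block `u` to the state after it, and report the occurrences whose
ends are found on the way. The register `off` is `0`, and `t` as soon as the block is passed. -/
def processBlock : Com Var :=
  .seq (.block [.const .lo 0, .const .off 0]) (.loop (.lt .off .t) shiftRound)

variable {E : Env} {n m c k t : ℕ} {p f : ℕ → ℕ} {i s X : ℕ} {st : Store Var}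

/-- The invariant inside the block at position `i`. The block has been passed if `off` is `t`. -/
structure BlockInv (p f : ℕ → ℕ) (n m t i : ℕ) (st : Store Var) (s : ℕ) : Prop extends
    Aligned p f n m (i + st.reg .off) (i + t) (st.reg .lo) st s where
  off_eq : st.reg .off = 0 ∨ st.reg .off = t ∧ st.reg .lo = 0
  lo_le : st.reg .lo ≤ t
  lo_le_q : st.reg .lo ≤ st.reg .q + 1

theorem Aligned.blockInv_of_passed (h : Aligned p f n m (i + t) (i + t) 0 st s)
    (hlo : st.reg .lo = 0) (hoff : st.reg .off = t) : BlockInv p f n m t i st s :=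
  { toAligned := by rwa [hlo, hoff]
    off_eq := .inr ⟨hoff, hlo⟩
    lo_le := by omega
    lo_le_q := by omega }

theorem Aligned.blockInv_of_start {st' : Store Var} (h : Aligned p f n m i i 0 st s)
    (hq : st'.reg .q = st.reg .q) (hout : st'.out = st.out) (hlo : st'.reg .lo = 0)
    (hoff : st'.reg .off = 0) : BlockInv p f n m t i st' s :=
  { add_eq := by rw [hq, hoff, h.add_eq, add_zero]
    q_le := hq ▸ h.q_le
    agrees := by
      rw [hoff]
      exact h.agrees
    resolved := by
      rw [hlo, hout]
      exact h.resolved.advance (Nat.le_add_right i t) (h.add_eq ▸ Nat.le_add_right ..)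
    off_eq := .inl hoff
    lo_le := by omega
    lo_le_q := by omega }

theorem BlockInv.start_eq (h : BlockInv p f n m t i st s) : i + st.reg .off - st.reg .q = s := by
  rw [← h.add_eq, Nat.add_sub_cancel]

/-- The potential of the search: 60 steps for every `t` alignments to come before `X`, for every
full match to come, and for passing the current block. -/
noncomputable def blockCost (p f : ℕ → ℕ) (m t X : ℕ) (st : Store Var) (s : ℕ) : ℕ :=
  60 * ((X - s) / t + fullMatches p f m X (s + st.reg .lo) + (1 - st.reg .off))

/-- The invariant inside the block is restored, and the potential pays for `T + K` steps. -/
def Progress (p f : ℕ → ℕ) (n m t i X : ℕ) (st : Store Var) (s K T : ℕ) (st' : Store Var) :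
    Prop :=
  ∃ s', BlockInv p f n m t i st' s' ∧
    blockCost p f m t X st' s' + T + K ≤ blockCost p f m t X st s

theorem Progress.mono {st₁ st' : Store Var} {K K' T T' : ℕ}
    (h : Progress p f n m t i X st₁ s K T st')
    (hcost : blockCost p f m t X st₁ s = blockCost p f m t X st s) (hT : T' + K' ≤ T + K) :
    Progress p f n m t i X st s K' T' st' := by
  obtain ⟨s', hinv, hle⟩ := h
  exact ⟨s', hinv, by omega⟩

/-- The state inside the block after the first surviving shift has been looked up. -/
structure LookedUp (p f : ℕ → ℕ) (n m t i : ℕ) (st : Store Var) (s : ℕ) : Prop extends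
    Aligned p f n m i (i + t) (st.reg .lo) st s where
  reg_off : st.reg .off = 0
  lo_le : st.reg .lo ≤ t
  lo_le_q : st.reg .lo ≤ st.reg .q + 1
  reg_h : st.reg .h = min t (m - st.reg .q)
  first : IsFirst (fun d => s + d ≤ i ∧ Survives p f m (i + t) (s + d)) (st.reg .lo) t
    (st.reg .v)

theorem LookedUp.of_frame {a : Com Var} {st' : Store Var} (h : LookedUp p f n m t i st s)
    (hF : Frame a st st') (ha : ∀ r ∈ [Var.q, .lo, .off, .h, .v], r ∉ a.targets := by decide)
    (hout : a.basics.any Basic.isReport = false := by decide) : LookedUp p f n m t i st' s := by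
  have hreg r (hr : r ∈ [Var.q, .lo, .off, .h, .v]) : st'.reg r = st.reg r := hF.reg r (ha r hr)
  have hq := hreg .q (by simp)
  have hlo := hreg .lo (by simp)
  refine ⟨hlo ▸ h.toAligned.congr hq (hF.out hout), ?_, ?_, ?_, ?_, ?_⟩
  · rw [hreg _ (by simp), h.reg_off]
  · exact hlo ▸ h.lo_le
  · exact hlo ▸ hq ▸ h.lo_le_q
  · rw [hreg _ (by simp), hq, h.reg_h]
  · rw [hlo, hreg .v (by simp)]
    exact h.first

theorem LookedUp.resolved_of_le (h : LookedUp p f n m t i st s) {S : ℕ}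
    (hS : s + st.reg .lo ≤ S) (hSv : S ≤ s + st.reg .v) (hSi : S ≤ i + 1) (ht : 1 ≤ t) :
    Resolved p f n m (i + t) S st.out := by
  refine h.resolved.skip hS (by omega) fun s' hs hs' hsur => ?_
  obtain ⟨d, rfl⟩ := Nat.exists_eq_add_of_le (show s ≤ s' by omega)
  exact h.first.2.2 d (by omega) (by omega) ⟨by omega, hsur⟩

theorem LookedUp.fullShift_ends (hL : LookedUp p f n m t i st s) (hI : Problem E n m c k p f)
    (hF : Fits E m k c t) (hC : Loaded n m c k t p f i st) (hX : i + t ≤ X)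
    (hv : st.reg .v < t) (hy : st.reg .y = st.reg .h + st.reg .v) (hyt : st.reg .y < t) :
    Ends E fullShift st (Progress p f n m t i X st s 45) := by
  have htw := hF.lt_two_pow hI
  have hnw := hI.n_lt
  have hin := hC.le_n
  have hm := hI.one_le_m
  have hadd := hL.add_eq
  have hqm := hL.q_le
  have hh := hL.reg_h
  obtain ⟨hlo, hle, hsur⟩ := hL.first.2.1 hv
  rw [Survives, min_eq_right (by omega)] at hsur
  have hR := hL.resolved_of_le (S := s + st.reg .v) (by omega) le_rfl (by omega) (by omega)
  have hcount : fullMatches p f m X (s + (st.reg .v + 1)) + 1 ≤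
      fullMatches p f m X (s + st.reg .v) := fullMatches_succ (S := s + st.reg .v) (by omega) hsur
  have hanti := fullMatches_anti p f m X (Nat.add_le_add_left hlo s)
  refine .block_seq (by simp) ((reportIfFits_ends (e := i + t) (S := s + st.reg .v) ?_
    (fun hn => ?_) hsur (by omega) (by simpa using hR)).seq ?_)
  · simp [hC.reg_rem]
    omega
  · have hsub := BinOp.eval_sub (w := E.w) (a := i) (b := st.reg .q) (by omega) (by omega)
    have hz := BinOp.eval_add (w := E.w) (a := i - st.reg .q) (b := st.reg .v) (by omega)
    simp [hC.reg_pos, hsub, hz]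
    omega
  rintro T₁ st₁ ⟨hT₁, hR₁⟩ hF₁
  replace hF₁ : Frame (.seq (.block [.op .sub .z .pos .q, .op .add .z .z .v]) reportIfFits) st
      st₁ :=
    ((frame_execAll E _ st).mono (by simp [Com.basics])).trans (hF₁.mono (by simp [Com.basics]))
  have hone := BinOp.eval_add (w := E.w) (a := st.reg .v) (b := 1) (by omega)
  have hone₁ : st₁.reg .one = 1 := (hC.of_frame hF₁).basics.reg_one
  have hlo' : (execAll E [.op .add .lo .v .one] st₁).reg .lo = st.reg .v + 1 := by
    simp [hF₁.reg .v, hone₁, hone]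
  have hq' : (execAll E [.op .add .lo .v .one] st₁).reg .q = st.reg .q := by simp [hF₁.reg .q]
  have hoff' : (execAll E [.op .add .lo .v .one] st₁).reg .off = 0 := by
    simp [hF₁.reg .off, hL.reg_off]
  refine .block (by simp) ⟨s, ⟨⟨by omega, by omega, ?_, ?_⟩, .inl hoff', by omega, by omega⟩,
    ?_⟩
  · rw [hoff']
    exact hL.agrees
  · rw [hlo']
    exact hR₁
  · rw [blockCost, blockCost, hlo', hoff', hL.reg_off]
    simp
    omega

theorem LookedUp.keepShift_ends (hL : LookedUp p f n m t i st s) (hI : Problem E n m c k p f)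
    (hF : Fits E m k c t) (hC : Loaded n m c k t p f i st)
    (hv : st.reg .v < t) (hy : st.reg .y = st.reg .h + st.reg .v) (hyt : t ≤ st.reg .y) :
    Ends E keepShift st (Progress p f n m t i X st s 45) := by
  have ht := hF.one_le_t
  have htw := hF.lt_two_pow hI
  have hnw := hI.n_lt
  have hmn := hI.m_le
  have hadd := hL.add_eq
  have hqm := hL.q_le
  have hh := hL.reg_h
  obtain ⟨hlo, hle, hsur⟩ := hL.first.2.1 hv
  rw [Survives, min_eq_left (by omega)] at hsur
  have hR := hL.resolved_of_le (S := s + st.reg .v) (by omega) le_rfl (by omega) ht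
  have hsub := BinOp.eval_sub (w := E.w) (a := st.reg .q) (b := st.reg .v) (by omega) (by omega)
  have hq := BinOp.eval_add (w := E.w) (a := st.reg .q - st.reg .v) (b := t) (by omega)
  have hoff := BinOp.eval_add (w := E.w) (a := 0) (b := t) (by omega)
  have hanti := fullMatches_anti p f m X (Nat.add_le_add_left hlo s)
  have hdiv := Nat.div_le_div_right (c := t) (show X - (s + st.reg .v) ≤ X - s by omega)
  refine .block (by simp) ⟨s + st.reg .v, Aligned.blockInv_of_passed
    ⟨?_, ?_, hsur, by simpa using hR⟩ (by simp)
    (by simp [hC.basics.reg_zero, hC.layout.reg_t, hoff]), ?_⟩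
  · simp [hC.layout.reg_t, hsub, hq]
    omega
  · simp [hC.layout.reg_t, hsub, hq]
    omega
  · simp [blockCost, hC.basics.reg_zero, hC.layout.reg_t, hoff, hL.reg_off]
    omega

theorem LookedUp.fallBack_ends (hL : LookedUp p f n m t i st s) (hI : Problem E n m c k p f)
    (hF : Fits E m k c t) (hC : Loaded n m c k t p f i st) (hX : i + t ≤ X)
    (hv : st.reg .v = t) (hq : t ≤ st.reg .q) :
    Ends E fallBack st (Progress p f n m t i X st s 45) := by
  have ht := hF.one_le_t
  have hbound := hF.bound_eq
  have hbw := hI.bound_le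
  have hadd := hL.add_eq
  have hqm := hL.q_le
  have hbase := BinOp.eval_add (w := E.w) (a := 2 * (m + 1)) (b := st.reg .q) (by omega)
  have hborder := hC.tables.borders _ hq hqm
  generalize hq' : st.mem (2 * (m + 1) + st.reg .q) = q' at hborder
  have hle := hborder.1
  have hlo := hL.lo_le
  have hR : Resolved p f n m (i + t) (i - q') st.out :=
    (hL.resolved_of_le (S := s + t) (by omega) (by omega) (by omega) ht).skip (by omega) (by omega)
      fun s' hs hs' hsur => hborder.not_agrees hadd hL.agrees hs hs'
        (Agrees.anti hsur (by omega) (by omega))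
  have hdiv : (X - (i - q')) / t + 1 ≤ (X - s) / t := by
    rw [← Nat.add_div_right _ (by omega)]
    exact Nat.div_le_div_right (by omega)
  have hanti := fullMatches_anti p f m X (show s + st.reg .lo ≤ i - q' by omega)
  refine .block ?_ ⟨i - q', ⟨⟨?_, ?_, ?_, by simpa using hR⟩, .inl ?_, ?_, ?_⟩, ?_⟩
  · simp [hC.layout.reg_baseJ, hbase]
    omega
  · simp [hC.layout.reg_baseJ, hbase, hq', hL.reg_off]
    omega
  · simp [hC.layout.reg_baseJ, hbase, hq']
    omega
  · simpa [hL.reg_off] using hborder.agrees hadd hL.agrees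
  · simp [hL.reg_off]
  · simp
  · simp
  · simp [blockCost, hL.reg_off]
    omega

theorem LookedUp.startScan_ends (hL : LookedUp p f n m t i st s) (hI : Problem E n m c k p f)
    (hF : Fits E m k c t) (hC : Loaded n m c k t p f i st) (hX : i + t ≤ X) (hv : st.reg .v = t)
    (hq : st.reg .q < t) : Ends E startScan st (Progress p f n m t i X st s 45) := by
  have ht := hF.one_le_t
  have hadd := hL.add_eq
  have hlo := hL.lo_le_q
  refine (PackedMatching.startScan_ends hI hF hC hX
    (hL.resolved_of_le (by omega) (by omega) le_rfl ht)).mono_frame ?_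
  rintro T st₁ ⟨s', hal, hs', hlo', hoff', hT⟩ -
  refine ⟨s', hal.blockInv_of_passed hlo' hoff', ?_⟩
  have hdiv := Nat.div_le_div_right (c := t) (show X - s' ≤ X - s by omega)
  have hanti := fullMatches_anti p f m X (show s + st.reg .lo ≤ i + 1 by omega)
  rw [blockCost, blockCost, hlo', hoff', hL.reg_off, add_zero]
  omega

theorem LookedUp.reg_y (hL : LookedUp p f n m t i st s) (hI : Problem E n m c k p f)
    (hv : st.reg .v < t) : (execAll E [.op .add .y .h .v] st).reg .y =
      (execAll E [.op .add .y .h .v] st).reg .h + (execAll E [.op .add .y .h .v] st).reg .v := by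
  obtain ⟨-, hle, -⟩ := hL.first.2.1 hv
  have hadd := hL.add_eq
  have hqm := hL.q_le
  have hh := hL.reg_h
  have hmn := hI.m_le
  have hnw := hI.n_lt
  simpa using BinOp.eval_add (w := E.w) (a := st.reg .h) (b := st.reg .v) (by omega)

theorem BlockInv.lookedUp_ends (hI : Problem E n m c k p f) (hF : Fits E m k c t)
    (hC : Loaded n m c k t p f i st) (h : BlockInv p f n m t i st s) (ho : st.reg .off < t) :
    Ends E lookupShift st fun T st' => T ≤ 32 ∧ LookedUp p f n m t i st' s ∧
      blockCost p f m t X st' s = blockCost p f m t X st s := by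
  have hoff : st.reg .off = 0 := h.off_eq.resolve_right fun h' => ho.ne h'.1
  obtain ⟨⟨hadd, hqm, hag, hR⟩, -, hle, hleq⟩ := h
  rw [hoff, add_zero] at hadd hag
  refine (lookupShift_ends hI hF hC.basics hC.layout hC.tables rfl hqm rfl hC.reg_u hadd
    hag).mono_frame ?_
  rintro T st₁ ⟨hT, hh, hfirst⟩ hF₁
  refine ⟨hT, ⟨⟨?_, ?_, hag, ?_⟩, ?_, ?_, ?_, ?_, ?_⟩, ?_⟩
  all_goals simp only [blockCost, hF₁.reg .q, hF₁.reg .lo, hF₁.reg .off, hF₁.out]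
  all_goals assumption

theorem shiftRound_ends (hI : Problem E n m c k p f) (hF : Fits E m k c t)
    (hC : Loaded n m c k t p f i st) (hX : i + t ≤ X) (h : BlockInv p f n m t i st s)
    (ho : st.reg .off < t) : Ends E shiftRound st (Progress p f n m t i X st s 2) := by
  refine (h.lookedUp_ends (X := X) hI hF hC ho).seq ?_
  rintro T₁ st₁ ⟨hT₁, hL, hcost⟩ hF₁
  replace hC := hC.of_frame hF₁
  refine .ite (fun hv => .block_seq (by simp) ?_) fun hv => ?_ <;>
    simp only [Cond.Holds, hC.layout.reg_t] at hv
  · have hL₂ := hL.of_frame (frame_execAll E [.op .add .y .h .v] st₁)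
    have hC₂ := hC.of_frame (frame_execAll E [.op .add .y .h .v] st₁)
    have hv₂ : (execAll E [.op .add .y .h .v] st₁).reg .v < t := by simpa using hv
    have hy₂ := hL.reg_y hI hv
    refine .ite (fun hy => ?_) fun hy => ?_ <;> simp only [Cond.Holds, hC₂.layout.reg_t] at hy
    · exact (hL₂.fullShift_ends hI hF hC₂ hX hv₂ hy₂ hy).mono_frame fun T st' hP _ =>
        hP.mono (by simpa [blockCost] using hcost) (by simp; omega)
    · exact (hL₂.keepShift_ends hI hF hC₂ hv₂ hy₂ (not_lt.mp hy)).mono_frame fun T st' hP _ =>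
        hP.mono (by simpa [blockCost] using hcost) (by simp; omega)
  · have hv' : st₁.reg .v = t := hL.first.1.antisymm (not_lt.mp hv)
    refine .ite (fun hq => ?_) fun hq => ?_ <;> simp only [Cond.Holds, hC.layout.reg_t] at hq
    · exact (hL.startScan_ends hI hF hC hX hv' hq).mono_frame fun T st' hP _ =>
        hP.mono hcost (by omega)
    · exact (hL.fallBack_ends hI hF hC hX hv' (not_lt.mp hq)).mono_frame fun T st' hP _ =>
        hP.mono hcost (by omega)

theorem processBlock_ends (hI : Problem E n m c k p f) (hF : Fits E m k c t)
    (hC : Loaded n m c k t p f i st) (hX : i + t ≤ X) (h : Aligned p f n m i i 0 st s) :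
    Ends E processBlock st fun T st' => ∃ s', Aligned p f n m (i + t) (i + t) 0 st' s' ∧
      T + 60 * ((X - s') / t + fullMatches p f m X s') ≤
        60 * ((X - s) / t + fullMatches p f m X s) + 64 := by
  have ht := hF.one_le_t
  have hF₀ := frame_execAll E [.const .lo 0, .const .off 0] st
  have hinv₀ : BlockInv p f n m t i (execAll E [.const .lo 0, .const .off 0] st) s :=
    h.blockInv_of_start (by simp) (by simp) (by simp) (by simp)
  have hcost₀ : blockCost p f m t X (execAll E [.const .lo 0, .const .off 0] st) s =
      60 * ((X - s) / t + fullMatches p f m X s + 1) := by simp [blockCost]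
  refine .block_seq (by simp) ((Ends.loop
    (fun st => blockCost p f m t X st (i + st.reg .off - st.reg .q))
    (I := fun st => ∃ s, BlockInv p f n m t i st s) ⟨s, hinv₀⟩
    fun st₁ hF₁ ⟨s₁, hinv⟩ hc => ?_).mono_frame ?_)
  · have hC₁ := (hC.of_frame hF₀).of_frame hF₁
    simp only [Cond.Holds, hC₁.layout.reg_t] at hc
    refine (shiftRound_ends hI hF hC₁ hX hinv hc).mono_frame ?_
    rintro T st₂ ⟨s₂, hinv₂, hT⟩ -
    rw [hinv.start_eq, hinv₂.start_eq]
    exact ⟨⟨s₂, hinv₂⟩, by omega⟩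
  rintro T st₁ ⟨⟨s₁, hinv⟩, hc, hT⟩ hF₁
  simp only [Cond.Holds, ((hC.of_frame hF₀).of_frame hF₁).layout.reg_t] at hc
  obtain ⟨hoff, hlo⟩ := hinv.off_eq.resolve_left (by omega)
  refine ⟨s₁, by simpa only [hoff, hlo] using hinv.toAligned, ?_⟩
  rw [hinv.start_eq, hinv₀.start_eq, hcost₀, blockCost, hlo, hoff] at hT
  simp only [add_zero, List.length_cons, List.length_nil] at hT ⊢
  omega

end Blocks

/-! ### Search block by block -/

section BlockSearch

/-- Process the block at position `pos`, and pass to the next block unless the text ends before. -/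
def searchRound : Com Var :=
  .seq (fetch .text .u .pos .maskT)
    (.seq processBlock
      (.ite (.lt .rem .t) (.block [.const .more 0])
        (.block [.op .sub .rem .rem .t, .op .add .pos .pos .t])))

/-- Search the text block by block, given the tables. -/
def blockSearch : Com Var :=
  .seq (.block [.op .add .rem .zero .n, .const .pos 0, .const .q 0, .const .more 1])
    (.loop (.lt .zero .more) searchRound)

variable {E : Env} {n m c k t : ℕ} {p f : ℕ → ℕ} {s X : ℕ} {st : Store Var}

/-- The invariant of the search: the block at position `pos` is the next one to be processed, or
all occurrences have been reported. -/
structure SearchInv (p f : ℕ → ℕ) (n m : ℕ) (st : Store Var) : Prop where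
  reg_more : st.reg .more = 0 ∨ st.reg .more = 1
  out_eq : st.reg .more = 0 → st.out = occList p f n m (n + 1)
  le_n : st.reg .pos ≤ n
  reg_rem : st.reg .rem = n - st.reg .pos
  aligned : st.reg .more = 1 → ∃ s, Aligned p f n m (st.reg .pos) (st.reg .pos) 0 st s

/-- The potential of the search: 90 steps for every block, and 60 steps for every `t` alignments and
for every full match to come before `X`. -/
noncomputable def searchCost (p f : ℕ → ℕ) (n m t X : ℕ) (st : Store Var) : ℕ :=
  st.reg .more * (90 * ((n - st.reg .pos) / t + 1) +
    60 * ((X - (st.reg .pos - st.reg .q)) / t + fullMatches p f m X (st.reg .pos - st.reg .q)))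

theorem Aligned.out_eq {i e : ℕ} (h : Aligned p f n m i e 0 st s) (hi : n < i) :
    st.out = occList p f n m (n + 1) := by
  have hadd := h.add_eq
  have hqm := h.q_le
  rw [h.resolved.out_eq]
  rcases le_total s (n + 1) with hs | hs
  · exact (occList_eq_of_le hs fun s' hs' _ ho => by have := ho.2; omega).symm
  · exact occList_eq_of_le hs fun s' hs' _ ho => by have := ho.2; omega

theorem searchRound_ends (hI : Problem E n m c k p f) (hF : Fits E m k c t)
    (hB : Basics n m c k st) (hl : Layout m c t p st) (hT : Tables m c t p st.mem)
    (hX : n + t ≤ X) (h : SearchInv p f n m st) (hmore : st.reg .more = 1) :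
    Ends E searchRound st fun T st' => SearchInv p f n m st' ∧
      searchCost p f n m t X st' + T + 2 ≤ searchCost p f n m t X st := by
  have ht := hF.one_le_t
  have hnw := hI.n_lt
  have hin := h.le_n
  obtain ⟨s, hal⟩ := h.aligned hmore
  have hcost : searchCost p f n m t X st =
      90 * ((n - st.reg .pos) / t + 1) + 60 * ((X - s) / t + fullMatches p f m X s) := by
    rw [searchCost, hmore, one_mul, ← hal.add_eq, Nat.add_sub_cancel]
  refine (fetch_ends hB hI.f_lt hI.text hI.one_le_k hI.one_le_c hI.word rfl (by omega)
    hl.reg_maskT (by have := hF.two_t_le; omega)).seq ?_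
  rintro _ st₁ ⟨rfl, hu⟩ hF₁
  have hC : Loaded n m c k t p f (st.reg .pos) st₁ := ⟨hB.of_frame hF₁, hl.of_frame hF₁,
    by rwa [hF₁.mem], hin, hu, hF₁.reg .pos, by rw [hF₁.reg .rem, h.reg_rem]⟩
  refine (processBlock_ends (X := X) hI hF hC (by omega)
    (hal.congr (hF₁.reg .q) hF₁.out)).seq ?_
  rintro T st₂ ⟨s₂, hal₂, hT₂⟩ hF₂
  have hC₂ := hC.of_frame hF₂
  refine .ite (fun hc => ?_) fun hc => ?_ <;>
    simp only [Cond.Holds, hC₂.reg_rem, hC₂.layout.reg_t, not_lt] at hc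
  · refine .block (by simp) ⟨⟨by simp, fun _ => ?_, ?_, ?_, by simp⟩, ?_⟩
    · simpa using hal₂.out_eq (by omega)
    · simpa [hC₂.reg_pos] using hin
    · simp [hC₂.reg_pos, hC₂.reg_rem]
    · have hdiv := Nat.zero_le ((n - st.reg .pos) / t)
      simp [searchCost] at hcost ⊢
      omega
  · have hsub := BinOp.eval_sub (w := E.w) hc (by omega)
    have hadd := BinOp.eval_add (w := E.w) (a := st.reg .pos) (b := t) (by omega)
    have hmore₂ : st₂.reg .more = 1 := by rw [hF₂.reg .more, hF₁.reg .more, hmore]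
    have hdiv : (n - (st.reg .pos + t)) / t + 1 = (n - st.reg .pos) / t := by
      rw [← Nat.add_div_right _ ht]
      congr 1
      omega
    have hq : st.reg .pos + t - st₂.reg .q = s₂ := by rw [← hal₂.add_eq, Nat.add_sub_cancel]
    refine .block (by simp) ⟨⟨?_, ?_, ?_, ?_, fun _ => ⟨s₂, ?_⟩⟩, ?_⟩
    · simp [hmore₂]
    · simp [hmore₂]
    · simp [hC₂.reg_pos, hC₂.layout.reg_t, hadd]
      omega
    · simp [hC₂.reg_pos, hC₂.reg_rem, hC₂.layout.reg_t, hadd, hsub]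
      omega
    · simpa [hC₂.reg_pos, hC₂.layout.reg_t, hadd] using hal₂.congr (by simp) (by simp)
    · rw [hcost]
      simp [searchCost, hmore₂, hC₂.reg_pos, hC₂.layout.reg_t, hadd, hdiv, hq]
      omega

theorem blockSearch_ends (hI : Problem E n m c k p f) (hF : Fits E m k c t)
    (hB : Basics n m c k st) (hl : Layout m c t p st) (hT : Tables m c t p st.mem)
    (hout : st.out = []) :
    Ends E blockSearch st fun T st' => st'.out = occList p f n m (n + 1) ∧
      T ≤ 90 * (n / t + 1) + 60 * ((n + t) / t + fullMatches p f m (n + t) 0) + 6 := by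
  have hone : 1 % 2 ^ E.w = 1 := Nat.mod_eq_of_lt (Nat.one_lt_two_pow (Nat.ne_of_gt hI.one_le_w))
  have hn := BinOp.eval_add (w := E.w) (a := 0) (b := n) (by have := hI.n_lt; omega)
  have hF₀ := frame_execAll E
    [.op .add .rem .zero .n, .const .pos 0, .const .q 0, .const .more 1] st
  refine .block_seq (by simp) ((Ends.loop (searchCost p f n m t (n + t)) (I := SearchInv p f n m)
    ?_ fun st₁ hF₁ hinv hc => ?_).mono_frame ?_)
  · refine ⟨?_, ?_, ?_, ?_, fun _ => ⟨0, ?_, ?_, ?_, ?_, ?_⟩⟩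
    all_goals simp [hone, hB.reg_zero, hB.reg_n, hn, hout, agrees_self, occList]
  · replace hF₁ : Frame blockSearch st st₁ :=
      (hF₀.mono (by simp [blockSearch, Com.basics])).trans
        (hF₁.mono fun i hi => by simp [blockSearch, Com.basics, hi])
    have hB₁ := hB.of_frame hF₁
    simp only [Cond.Holds, hB₁.reg_zero] at hc
    exact searchRound_ends hI hF hB₁ (hl.of_frame hF₁) (by rwa [hF₁.mem]) le_rfl hinv
      (hinv.reg_more.resolve_left hc.ne')
  rintro T st₁ ⟨hinv, hc, hT⟩ hF₁
  simp only [Cond.Holds, ((hB.of_frame hF₀).of_frame hF₁).reg_zero, not_lt, nonpos_iff_eq_zero]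
    at hc
  refine ⟨hinv.out_eq hc, ?_⟩
  simp [searchCost, hone] at hT ⊢
  omega

end BlockSearch

/-! ### The whole algorithm -/

section Algorithm

variable {E : Env} {n m c k t : ℕ} {p f : ℕ → ℕ} {st : Store Var}

section Layout

/-- Compute the block length `k / 2 ^ a`. The shift is iterated since `a` need not be a word. -/
def computeBlockLength (a : ℕ) : Com Var :=
  .block (.op .add .t .zero .k :: List.replicate a (.op .shr .t .t .one))

theorem execAll_replicate_shr (a : ℕ) (h1 : st.reg .one = 1) (ht : st.reg .t < 2 ^ E.w) :
    SafeAll E (List.replicate a (.op .shr .t .t .one)) st ∧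
      (execAll E (List.replicate a (.op .shr .t .t .one)) st).reg .t = st.reg .t / 2 ^ a := by
  induction a generalizing st with
  | zero => simp
  | succ a ih =>
    have hhalf := BinOp.eval_shr (b := 1) ht
    obtain ⟨hsafe, hreg⟩ := ih (st := (Basic.op .shr .t .t .one).exec E st) (by simp [h1])
      (by simp [h1, hhalf]; omega)
    exact ⟨⟨trivial, hsafe⟩, hreg.trans (by simp [h1, hhalf, Nat.div_div_eq_div_mul, pow_succ'])⟩

theorem computeBlockLength_ends (hI : Problem E n m c k p f) (hB : Basics n m c k st) (a : ℕ) :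
    Ends E (computeBlockLength a) st fun T st' => T = a + 1 ∧ st'.reg .t = k / 2 ^ a ∧
      Frame (.block [.op .add .t .zero .k, .op .shr .t .t .one]) st st' := by
  have hk : k < 2 ^ E.w := ((Nat.le_mul_of_pos_right k hI.one_le_c).trans hI.word).trans_lt
    Nat.lt_two_pow_self
  have hcopy := BinOp.eval_add (w := E.w) (a := 0) (b := k) (by omega)
  obtain ⟨hsafe, hreg⟩ := execAll_replicate_shr (E := E) a
    (st := (Basic.op .add .t .zero .k).exec E st) (by simp [hB.reg_one])
    (by simp [hB.reg_zero, hB.reg_k, hcopy, hk])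
  refine .block ⟨trivial, hsafe⟩ ⟨by simp, ?_, (frame_execAll E _ st).mono ?_⟩
  · exact hreg.trans (by simp [hB.reg_zero, hB.reg_k, hcopy])
  · simp [Com.basics, List.subset_def]

/-- Compute the lengths and the masks of the bit fields. -/
def computeMasks : Com Var :=
  .block [.op .mul .ct .c .t, .op .add .y .t .t, .op .mul .cw .c .y, .op .shl .maskT .one .ct,
    .op .sub .maskT .maskT .one, .op .shl .maskW .one .cw, .op .sub .maskW .maskW .one,
    .op .shl .maskD .one .t, .op .sub .maskD .maskD .one]

/-- Compute the base addresses of the tables, and in `lim` the length of the table of shifts. -/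
def computeBases : Com Var :=
  .block [.op .add .baseD .m .one, .op .add .baseJ .baseD .baseD, .op .add .baseT .baseJ .baseD,
    .op .add .y .ct .cw, .op .add .y .y .t, .op .add .y .y .t, .op .shl .lim .one .y,
    .op .add .baseU .baseT .lim]

/-- Set the registers that depend on the block length. -/
def computeLayout : Com Var :=
  .seq computeMasks (.seq computeBases (fetch .pattern .head .zero .maskT))

theorem computeMasks_ends (hI : Problem E n m c k p f) (hB : Basics n m c k st)
    (ht : st.reg .t = t) (htk : 2 * t ≤ k) :
    Ends E computeMasks st fun T st' => T = 9 ∧ st'.reg .ct = c * t ∧ st'.reg .cw = c * (2 * t) ∧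
      st'.reg .maskT = 2 ^ (c * t) - 1 ∧ st'.reg .maskW = 2 ^ (c * (2 * t)) - 1 ∧
      st'.reg .maskD = 2 ^ t - 1 := by
  have hk : k ≤ E.w := (Nat.le_mul_of_pos_right k hI.one_le_c).trans hI.word
  have hw : E.w < 2 ^ E.w := Nat.lt_two_pow_self
  have ht' : t ≤ k := by omega
  have hct := BinOp.eval_mul (hI.mul_lt ht')
  have hadd := BinOp.eval_add (w := E.w) (a := t) (b := t) (by omega)
  have hcw := BinOp.eval_mul (hI.mul_lt htk)
  have hmaskT := BinOp.eval_sub_eval_shl_one hI.one_le_w (hI.mul_le ht')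
  have hmaskW := BinOp.eval_sub_eval_shl_one hI.one_le_w (hI.mul_le htk)
  have hmaskD := BinOp.eval_sub_eval_shl_one hI.one_le_w (ht'.trans hk)
  rw [← two_mul] at hadd
  refine .block (by simp) ⟨rfl, ?_⟩
  simp [hB.reg_c, hB.reg_one, ht, hct, hadd, hcw, hmaskT, hmaskW, hmaskD]

theorem computeBases_ends (hI : Problem E n m c k p f) (hF : Fits E m k c t)
    (hB : Basics n m c k st) (ht : st.reg .t = t) (hct : st.reg .ct = c * t)
    (hcw : st.reg .cw = c * (2 * t)) :
    Ends E computeBases st fun T st' => T = 8 ∧ st'.reg .baseD = m + 1 ∧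
      st'.reg .baseJ = 2 * (m + 1) ∧ st'.reg .baseT = 3 * (m + 1) ∧
      st'.reg .baseU = 3 * (m + 1) + shiftSize c t ∧ st'.reg .lim = shiftSize c t := by
  have hbound := hF.bound_eq
  have hbw := hI.bound_le
  have hstart : 0 < startSize c t := Nat.two_pow_pos _
  have hexp : c * t + c * (2 * t) + t + t < shiftSize c t := Nat.lt_two_pow_self
  have hbaseD := BinOp.eval_add (w := E.w) (a := m) (b := 1) (by omega)
  have hbaseJ := BinOp.eval_add (w := E.w) (a := m + 1) (b := m + 1) (by omega)
  have hbaseT := BinOp.eval_add (w := E.w) (a := 2 * (m + 1)) (b := m + 1) (by omega)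
  have hbaseU := BinOp.eval_add (w := E.w) (a := 3 * (m + 1)) (b := shiftSize c t) (by omega)
  have hy := BinOp.eval_add (w := E.w) (a := c * t) (b := c * (2 * t)) (by omega)
  have hy' := BinOp.eval_add (w := E.w) (a := c * t + c * (2 * t)) (b := t) (by omega)
  have hy'' := BinOp.eval_add (w := E.w) (a := c * t + c * (2 * t) + t) (b := t) (by omega)
  have hlim : BinOp.eval E.w .shl 1 (c * t + c * (2 * t) + t + t) = shiftSize c t :=
    (BinOp.eval_shl (by rw [one_mul, ← shiftSize]; omega)).trans (one_mul _)
  rw [← two_mul] at hbaseJ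
  rw [show 2 * (m + 1) + (m + 1) = 3 * (m + 1) by ring] at hbaseT
  refine .block (by simp) ⟨rfl, ?_⟩
  simp [hB.reg_m, hB.reg_one, ht, hct, hcw, hbaseD, hbaseJ, hbaseT, hbaseU, hy, hy', hy'', hlim]

theorem computeLayout_ends (hI : Problem E n m c k p f) (hF : Fits E m k c t)
    (hB : Basics n m c k st) (ht : st.reg .t = t) :
    Ends E computeLayout st fun T st' =>
      T = 29 ∧ Layout m c t p st' ∧ st'.reg .lim = shiftSize c t := by
  have htk := hF.two_t_le
  refine (computeMasks_ends hI hB ht htk).seq ?_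
  rintro _ st₁ ⟨rfl, hct, hcw, hmaskT, hmaskW, hmaskD⟩ hF₁
  have hB₁ := hB.of_frame hF₁
  have ht₁ : st₁.reg .t = t := (hF₁.reg .t).trans ht
  refine (computeBases_ends hI hF hB₁ ht₁ hct hcw).seq ?_
  rintro _ st₂ ⟨rfl, hbaseD, hbaseJ, hbaseT, hbaseU, hlim⟩ hF₂
  have hB₂ := hB₁.of_frame hF₂
  refine (fetch_ends hB₂ hI.p_lt hI.pattern hI.one_le_k hI.one_le_c hI.word hB₂.reg_zero
    (by positivity) ((hF₂.reg .maskT).trans hmaskT) (by omega)).mono_frame ?_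
  rintro _ st₃ ⟨rfl, hhead⟩ hF₃
  refine ⟨rfl, ⟨?_, ?_, ?_, ?_, ?_, ?_, ?_, ?_, ?_, ?_, hhead⟩, (hF₃.reg .lim).trans hlim⟩
  · rw [hF₃.reg .t, hF₂.reg .t, ht₁]
  · rw [hF₃.reg .ct, hF₂.reg .ct, hct]
  · rw [hF₃.reg .cw, hF₂.reg .cw, hcw]
  · rw [hF₃.reg .maskT, hF₂.reg .maskT, hmaskT]
  · rw [hF₃.reg .maskW, hF₂.reg .maskW, hmaskW]
  · rw [hF₃.reg .maskD, hF₂.reg .maskD, hmaskD]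
  · rw [hF₃.reg .baseD, hbaseD]
  · rw [hF₃.reg .baseJ, hbaseJ]
  · rw [hF₃.reg .baseT, hbaseT]
  · rw [hF₃.reg .baseU, hbaseU]

end Layout

section Tables

/-- Compute the masks of the short periods and the borders with period at least `t`. -/
def computePeriods : Com Var :=
  .seq periodTable (.seq (.block [.op .add .base .zero .baseJ, .op .add .i .zero .t]) borderTable)

/-- Compute the table of shifts, whose length is expected in `lim`, and the table of starts. -/
def computeLookupTables : Com Var :=
  .seq (.seq (.block [.op .add .base .zero .baseT]) (fill shiftEntry))
    (.seq (.block [.op .add .base .zero .baseU, .op .add .y .ct .t, .op .shl .lim .one .y])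
      (fill startEntry))

theorem computePeriods_ends (hI : Problem E n m c k p f) (hF : Fits E m k c t)
    (hB : Basics n m c k st) (hl : Layout m c t p st)
    (hπ : ∀ j, 1 ≤ j → j ≤ m → Border p 1 j (st.mem j)) :
    Ends E computePeriods st fun T st' => (∀ j ≤ m, PeriodMask p t j (st'.mem (m + 1 + j))) ∧
      (∀ j, t ≤ j → j ≤ m → Border p t j (st'.mem (2 * (m + 1) + j))) ∧ T ≤ 72 * m + 11 := by
  have htw := hF.lt_two_pow hI
  have ht := hF.one_le_t
  have htk := hF.two_t_le
  have hbound := hF.bound_eq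
  have hbw := hI.bound_le
  have htw' : t ≤ E.w := by
    have := (Nat.le_mul_of_pos_right k hI.one_le_c).trans hI.word
    omega
  have htS : t < shiftSize c t :=
    Nat.lt_two_pow_self.trans_le (Nat.pow_le_pow_right (by norm_num) (by omega))
  refine (periodTable_ends hI hB ht htw' (by omega) hl.reg_baseD hl.reg_maskD hπ).seq ?_
  rintro T₁ st₁ ⟨hmasks, hT₁⟩ hF₁
  have hB₁ := hB.of_frame hF₁
  have hl₁ := hl.of_frame hF₁
  have hbase := BinOp.eval_add (w := E.w) (a := 0) (b := 2 * (m + 1)) (by omega)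
  have hi := BinOp.eval_add (w := E.w) (a := 0) (b := t) (by omega)
  rw [zero_add] at hbase hi
  refine .block_seq (by simp) ((borderTable_ends (o := t) (b := 2 * (m + 1)) hI
    (hB₁.of_frame (frame_execAll ..)) (by simp [hB₁.reg_zero, hl₁.reg_t, hi])
    (by simp [hB₁.reg_zero, hl₁.reg_baseJ, hbase]) (by omega)
    (.inr ⟨by omega, fun j hj hjm => ?_⟩)).mono_frame ?_)
  · have hmem : st₁.mem j = st.mem j := hmasks.mem_eq j (by omega)
    simpa [hmem] using hπ j hj hjm
  · rintro T₂ st₂ ⟨hborders, hT₂⟩ -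
    refine ⟨fun j hj => ?_, fun j htj hjm => hborders.entry j htj (by omega), ?_⟩
    · rw [hborders.mem_eq _ (by omega)]
      simpa using hmasks.entry j (Nat.zero_le j) (by omega)
    · simp; omega

theorem fill_shiftEntry_ends (hI : Problem E n m c k p f) (hF : Fits E m k c t)
    (hB : Basics n m c k st) (hl : Layout m c t p st) (hlim : st.reg .lim = shiftSize c t) :
    Ends E (.seq (.block [.op .add .base .zero .baseT]) (fill shiftEntry)) st fun T st' =>
      Tabulates (ShiftEntry c t) (3 * (m + 1)) 0 (shiftSize c t) st.mem st'.mem ∧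
        T ≤ (21 * t + 15) * shiftSize c t + 4 := by
  have hbound := hF.bound_eq
  have hbw := hI.bound_le
  have hstart : 0 < startSize c t := Nat.two_pow_pos _
  have hbase := BinOp.eval_add (w := E.w) (a := 0) (b := 3 * (m + 1)) (by omega)
  have hB' := hB.of_frame (frame_execAll E [.op .add .base .zero .baseT] st)
  have hl' := hl.of_frame (frame_execAll E [.op .add .base .zero .baseT] st)
  refine .block_seq (by simp) ((fill_ends hB'.reg_one (b := 3 * (m + 1))
    (by simp [hB.reg_zero, hl.reg_baseT, hbase]) (by simp [hlim]) (by omega) hbw (by omega)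
    (by decide) (by decide) fun st' hF' hlt =>
      shiftEntry_ends hI hF (hB'.of_frame hF') (hl'.of_frame hF') hlt).mono_frame ?_)
  rintro T st' ⟨htab, hT⟩ -
  replace hT : T ≤ (21 * t + 15) * shiftSize c t + 3 := hT
  exact ⟨by simpa using htab, by simp; omega⟩

theorem fill_startEntry_ends (hI : Problem E n m c k p f) (hF : Fits E m k c t)
    (hB : Basics n m c k st) (hl : Layout m c t p st) :
    Ends E (.seq (.block [.op .add .base .zero .baseU, .op .add .y .ct .t, .op .shl .lim .one .y])
      (fill startEntry)) st fun T st' =>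
      Tabulates (StartEntry c t m (chunk c p 0 t)) (3 * (m + 1) + shiftSize c t) 0 (startSize c t)
        st.mem st'.mem ∧ T ≤ (21 * t + 15) * startSize c t + 6 := by
  have hbound := hF.bound_eq
  have hbw := hI.bound_le
  have hexp : c * t + t < startSize c t := Nat.lt_two_pow_self
  have hbase := BinOp.eval_add (w := E.w) (a := 0) (b := 3 * (m + 1) + shiftSize c t) (by omega)
  have hy := BinOp.eval_add (w := E.w) (a := c * t) (b := t) (by omega)
  have hlim : BinOp.eval E.w .shl 1 (c * t + t) = startSize c t :=
    (BinOp.eval_shl (by rw [one_mul, ← startSize]; omega)).trans (one_mul _)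
  have hF₀ := frame_execAll E
    [.op .add .base .zero .baseU, .op .add .y .ct .t, .op .shl .lim .one .y] st
  have hB' := hB.of_frame hF₀
  have hl' := hl.of_frame hF₀
  refine .block_seq (by simp) ((fill_ends hB'.reg_one (b := 3 * (m + 1) + shiftSize c t)
    (by simp [hB.reg_zero, hl.reg_baseU, hbase])
    (by simp [hB.reg_one, hl.reg_ct, hl.reg_t, hy, hlim]) (by omega) hbw (by omega)
    (by decide) (by decide) fun st' hF' hlt =>
      startEntry_ends hI hF (hB'.of_frame hF') (hl'.of_frame hF') hlt).mono_frame ?_)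
  rintro T st' ⟨htab, hT⟩ -
  replace hT : T ≤ (21 * t + 15) * startSize c t + 3 := hT
  exact ⟨by simpa using htab, by simp; omega⟩

theorem computeLookupTables_ends (hI : Problem E n m c k p f) (hF : Fits E m k c t)
    (hB : Basics n m c k st) (hl : Layout m c t p st) (hlim : st.reg .lim = shiftSize c t)
    (hmasks : ∀ j ≤ m, PeriodMask p t j (st.mem (m + 1 + j)))
    (hborders : ∀ j, t ≤ j → j ≤ m → Border p t j (st.mem (2 * (m + 1) + j))) :
    Ends E computeLookupTables st fun T st' => Tables m c t p st'.mem ∧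
      T ≤ (21 * t + 15) * (shiftSize c t + startSize c t) + 10 := by
  refine (fill_shiftEntry_ends hI hF hB hl hlim).seq ?_
  rintro T₁ st₁ ⟨hshifts, hT₁⟩ hF₁
  refine (fill_startEntry_ends hI hF (hB.of_frame hF₁) (hl.of_frame hF₁)).mono_frame ?_
  rintro T₂ st₂ ⟨hstarts, hT₂⟩ -
  have hmem a (ha : a < 3 * (m + 1)) : st₂.mem a = st.mem a :=
    (hstarts.mem_eq a (by omega)).trans (hshifts.mem_eq a (by omega))
  refine ⟨⟨fun j hj => ?_, fun j htj hj => ?_, fun a ha => ?_, fun a ha => ?_⟩, ?_⟩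
  · rw [hmem _ (by omega)]
    exact hmasks j hj
  · rw [hmem _ (by omega)]
    exact hborders j htj hj
  · rw [hstarts.mem_eq _ (by omega)]
    exact hshifts.entry a (Nat.zero_le a) ha
  · exact hstarts.entry a (Nat.zero_le a) ha
  · rw [mul_add]; omega

end Tables

/-- The algorithm for short patterns and blocks of positive length. -/
def blockAlgorithm : Com Var :=
  .seq computeLayout (.seq computePeriods (.seq computeLookupTables blockSearch))

theorem blockAlgorithm_ends (hI : Problem E n m c k p f) (hF : Fits E m k c t)
    (hB : Basics n m c k st) (ht : st.reg .t = t)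
    (hπ : ∀ j, 1 ≤ j → j ≤ m → Border p 1 j (st.mem j)) (hout : st.out = []) :
    Ends E blockAlgorithm st fun T st' => st'.out = occList p f n m (n + 1) ∧
      T ≤ 72 * m + 56 + (21 * t + 15) * (shiftSize c t + startSize c t) + 90 * (n / t + 1) +
        60 * ((n + t) / t + fullMatches p f m (n + t) 0) := by
  refine (computeLayout_ends hI hF hB ht).seq ?_
  rintro _ st₁ ⟨rfl, hl₁, hlim₁⟩ hF₁
  have hB₁ := hB.of_frame hF₁
  refine (computePeriods_ends hI hF hB₁ hl₁ (by rwa [hF₁.mem])).seq ?_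
  rintro T₂ st₂ ⟨hmasks, hborders, hT₂⟩ hF₂
  have hB₂ := hB₁.of_frame hF₂
  have hl₂ := hl₁.of_frame hF₂
  refine (computeLookupTables_ends hI hF hB₂ hl₂ ((hF₂.reg .lim).trans hlim₁) hmasks hborders).seq
    ?_
  rintro T₃ st₃ ⟨htables, hT₃⟩ hF₃
  refine (blockSearch_ends hI hF (hB₂.of_frame hF₃) (hl₂.of_frame hF₃) htables
    (by rw [hF₃.out, hF₂.out, hF₁.out, hout])).mono_frame ?_
  rintro T₄ st₄ ⟨hocc, hT₄⟩ -
  exact ⟨hocc, by omega⟩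

/-- The whole algorithm; blocks have length `k / 2 ^ a`. -/
def algorithm (a : ℕ) : Com Var :=
  .seq (.seq
      (.block [.const .one 1, .op .shl .maskC .one .c, .op .sub .maskC .maskC .one, .const .i 1])
      borderTable)
    (.seq (computeBlockLength a)
      (.ite (.eq .t .zero) charSearch
        (.seq (.block [.const .y 4, .op .shr .x .n .y])
          (.ite (.lt .x .m) charSearch blockAlgorithm))))

theorem prepare_ends (hI : Problem E n m c k p f) (hn : st.reg .n = n) (hm : st.reg .m = m)
    (hc : st.reg .c = c) (hk : st.reg .k = k) (hz : st.reg .zero = 0) (hbase : st.reg .base = 0) :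
    Ends E (.seq
      (.block [.const .one 1, .op .shl .maskC .one .c, .op .sub .maskC .maskC .one, .const .i 1])
      borderTable) st fun T st' => Basics n m c k st' ∧
        (∀ j, 1 ≤ j → j ≤ m → Border p 1 j (st'.mem j)) ∧ T ≤ 60 * m + 9 := by
  have hone : 1 % 2 ^ E.w = 1 := Nat.mod_eq_of_lt (Nat.one_lt_two_pow (Nat.ne_of_gt hI.one_le_w))
  have hmask := BinOp.eval_sub_eval_shl_one hI.one_le_w (b := c)
    (by simpa using hI.mul_le hI.one_le_k)
  have hm1 := hI.one_le_m
  have hmb := hI.m_lt_bound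
  have hB₁ : Basics n m c k (execAll E [.const .one 1, .op .shl .maskC .one .c,
      .op .sub .maskC .maskC .one, .const .i 1] st) := by
    constructor <;> simp [hn, hm, hc, hk, hz, hone, hmask]
  refine .block_seq (by simp) ((borderTable_ends (o := 1) (b := 0) hI hB₁ (by simp [hone])
    (by simp [hbase]) (by omega) (.inl ⟨rfl, rfl⟩)).mono_frame ?_)
  rintro T st' ⟨htab, hT⟩ hF
  exact ⟨hB₁.of_frame hF, fun j hj hjm => by simpa using htab.entry j hj (by omega),
    by simp; omega⟩

theorem algorithm_ends (hI : Problem E n m c k p f) {a : ℕ} (ha : 2 ≤ a) (ht : t = k / 2 ^ a)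
    (hF : 1 ≤ t → m ≤ n / 16 → Fits E m k c t)
    (hn : st.reg .n = n) (hm : st.reg .m = m) (hc : st.reg .c = c) (hk : st.reg .k = k)
    (hz : st.reg .zero = 0) (hbase : st.reg .base = 0) (hout : st.out = []) :
    Ends E (algorithm a) st fun T st' => st'.out = occList p f n m (n + 1) ∧
      (t = 0 ∨ n / 16 < m → T ≤ 60 * m + 62 * n + a + 20) ∧
      (1 ≤ t → m ≤ n / 16 → T ≤ 132 * m + 80 + a +
        (21 * t + 15) * (shiftSize c t + startSize c t) + 90 * (n / t + 1) +
        60 * ((n + t) / t + fullMatches p f m (n + t) 0)) := by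
  refine (prepare_ends hI hn hm hc hk hz hbase).seq ?_
  rintro T₁ st₁ ⟨hB₁, hπ₁, hT₁⟩ hF₁
  refine (computeBlockLength_ends hI hB₁ a).seq ?_
  rintro _ st₂ ⟨rfl, ht₂, hF₂⟩ -
  rw [← ht] at ht₂
  have hB₂ := hB₁.of_frame hF₂
  rw [← hF₂.mem] at hπ₁
  have hout₂ : st₂.out = [] := by rw [hF₂.out, hF₁.out, hout]
  refine .ite (fun htz => ?_) fun htz => ?_ <;> simp only [Cond.Holds, ht₂, hB₂.reg_zero] at htz
  · refine (charSearch_ends hI hB₂ hπ₁ hout₂).mono_frame ?_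
    rintro T₃ st₃ ⟨hocc, hT₃⟩ -
    exact ⟨hocc, by omega, by omega⟩
  have hk4 : 2 ^ 2 ≤ k := (Nat.pow_le_pow_right (by norm_num) ha).trans
    (not_lt.mp fun hlt => htz (ht.trans (Nat.div_eq_of_lt hlt)))
  have hkw : k < 2 ^ E.w :=
    ((Nat.le_mul_of_pos_right k hI.one_le_c).trans hI.word).trans_lt Nat.lt_two_pow_self
  have h4 : 4 % 2 ^ E.w = 4 := Nat.mod_eq_of_lt (by omega)
  have hF₃ := frame_execAll E [.const .y 4, .op .shr .x .n .y] st₂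
  have hB₃ := hB₂.of_frame hF₃
  rw [← hF₃.mem] at hπ₁
  refine .block_seq (by simp) (.ite (fun hlt => ?_) fun hlt => ?_)
  · replace hlt : n / 16 < m := by
      simpa [hB₂.reg_n, hB₂.reg_m, h4, BinOp.eval_shr hI.n_lt] using hlt
    refine (charSearch_ends hI hB₃ hπ₁ hout₂).mono_frame ?_
    rintro T₄ st₄ ⟨hocc, hT₄⟩ -
    exact ⟨hocc, by simp; omega, by omega⟩
  · replace hlt : m ≤ n / 16 := by
      simpa [hB₂.reg_n, hB₂.reg_m, h4, BinOp.eval_shr hI.n_lt] using hlt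
    refine (blockAlgorithm_ends hI (hF (by omega) hlt) hB₃ ((hF₃.reg .t).trans ht₂) hπ₁
      hout₂).mono_frame ?_
    rintro T₄ st₄ ⟨hocc, hT₄⟩ -
    exact ⟨hocc, by omega, by simp; omega⟩

end Algorithm

/-! ### Packed strings -/

section PackedStrings

variable {σ : ℕ}

/-- The characters of a string, continued by zeros. -/
def char (A : List (Fin σ)) (i : ℕ) : ℕ := (A.map Fin.val).getD i 0

theorem char_eq_getElem {A : List (Fin σ)} {i : ℕ} (h : i < A.length) : char A i = A[i] := by
  rw [char, List.getD_eq_getElem _ _ (by simpa using h), List.getElem_map]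

theorem char_lt (A : List (Fin σ)) (i : ℕ) : char A i < 2 ^ Nat.clog 2 σ := by
  by_cases h : i < A.length
  · rw [char_eq_getElem h]
    exact A[i].isLt.trans_le (Nat.le_pow_clog (by norm_num) σ)
  · rw [char, List.getD_eq_default _ _ (by simpa using h)]
    positivity

theorem occurs_char_iff (P Q : List (Fin σ)) {i : ℕ} (hi : i ≤ Q.length) :
    Occurs (char P) (char Q) Q.length P.length i ↔ P <+: Q.drop i := by
  rw [List.prefix_iff_getElem]
  constructor
  · rintro ⟨⟨-, h⟩, hle⟩
    refine ⟨by simp; omega, fun r hr => Fin.ext ?_⟩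
    rw [List.getElem_drop, ← char_eq_getElem, ← char_eq_getElem]
    exact (h r (by omega)).symm
  · rintro ⟨hle, h⟩
    rw [List.length_drop] at hle
    refine ⟨⟨by omega, fun r hr => ?_⟩, by omega⟩
    rw [char_eq_getElem (by omega), char_eq_getElem (by omega), h r (by omega), List.getElem_drop]

theorem nodup_occList (p f : ℕ → ℕ) (n m S : ℕ) : (occList p f n m S).Nodup :=
  List.nodup_range.filter _

theorem toFinset_occList (P Q : List (Fin σ)) :
    (occList (char P) (char Q) Q.length P.length (Q.length + 1)).toFinset = occurrences P Q := by
  ext i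
  simp only [occList, occurrences, List.mem_toFinset, List.mem_filter, List.mem_range,
    decide_eq_true_eq, Finset.mem_filter, Finset.mem_range]
  exact and_congr_right fun h => occurs_char_iff P Q (by omega)

theorem fullMatches_char_le (P Q : List (Fin σ)) (t : ℕ) :
    fullMatches (char P) (char Q) P.length (Q.length + t) 0 ≤
      (occurrences P Q).card + P.length + t := by
  classical
  have hsub : (Finset.Ico 0 (Q.length + t)).filter
      (fun s => Agrees (char P) (char Q) s (s + P.length)) ⊆
      occurrences P Q ∪ Finset.Ico (Q.length + 1 - P.length) (Q.length + t) := by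
    intro s hs
    rw [Finset.mem_filter, Finset.mem_Ico] at hs
    rw [Finset.mem_union, occurrences, Finset.mem_filter, Finset.mem_range, Finset.mem_Ico]
    by_cases h : s + P.length ≤ Q.length
    · exact .inl ⟨by omega, (occurs_char_iff P Q (by omega)).mp ⟨hs.2, h⟩⟩
    · exact .inr (by omega)
  have hcard := (Finset.card_le_card hsub).trans (Finset.card_union_le _ _)
  rw [Nat.card_Ico] at hcard
  refine le_trans (le_of_eq ?_) (hcard.trans (by omega))
  unfold fullMatches
  congr

theorem problem_packed {w k B : ℕ} {P Q : List (Fin σ)} (hσ : 2 ≤ σ) (hk : 1 ≤ k)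
    (hkw : k * Nat.clog 2 σ ≤ w) (hP : 1 ≤ P.length) (hPQ : P.length ≤ Q.length)
    (hQ : Q.length < 2 ^ w) (hB : P.length < B) (hBw : B ≤ 2 ^ w) :
    Problem ⟨w, packedInput k P Q, B⟩ Q.length P.length (Nat.clog 2 σ) k (char P) (char Q) where
  p_lt := char_lt P
  f_lt := char_lt Q
  pattern _ := rfl
  text _ := rfl
  one_le_c := Nat.clog_pos (by norm_num) hσ
  one_le_k := hk
  word := hkw
  one_le_m := hP
  m_le := hPQ
  n_lt := hQ
  m_lt_bound := hB
  bound_le := hBw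

theorem solvesWithin_of_ends {w k B T : ℕ} {P Q : List (Fin σ)} {a : Com Var}
    (h : Ends ⟨w, packedInput k P Q, B⟩ a
      ⟨fun reg => (parameters k P Q).getD (Var.equiv reg) 0, fun _ => 0, []⟩ fun T' st =>
        st.out = occList (char P) (char Q) Q.length P.length (Q.length + 1) ∧ T' ≤ T) :
    SolvesWithin (a.compile Var.equiv 0) w k P Q T (42 + B) := by
  obtain ⟨T', st, ⟨hocc, hT⟩, hrun, hspace⟩ := h.halted_and_spaceWithin Var.equiv
  obtain ⟨hout, hhalt⟩ := hrun T hT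
  refine ⟨hhalt, hspace, ?_, ?_⟩ <;> rw [hout, hocc]
  · exact nodup_occList ..
  · exact toFinset_occList P Q

theorem solvesWithin_charSearch {w k a : ℕ} {P Q : List (Fin σ)} (hσ : 2 ≤ σ) (hk : 1 ≤ k)
    (hkw : k * Nat.clog 2 σ ≤ w) (hP : 1 ≤ P.length) (hPQ : P.length ≤ Q.length)
    (hQ : Q.length < 2 ^ w) (ha : 2 ≤ a) (h : k / 2 ^ a = 0 ∨ Q.length / 16 < P.length) :
    SolvesWithin ((algorithm a).compile Var.equiv 0) w k P Q
      (60 * P.length + 62 * Q.length + a + 20) (42 + (P.length + 1)) :=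
  solvesWithin_of_ends <|
    (algorithm_ends (problem_packed hσ hk hkw hP hPQ hQ (by omega) (by omega)) ha rfl
      (fun _ _ => by omega) rfl rfl rfl rfl rfl rfl rfl).mono_frame
      fun _ _ hT _ => ⟨hT.1, hT.2.1 h⟩

theorem shiftSize_le {c t : ℕ} (hc : 1 ≤ c) : shiftSize c t ≤ 2 ^ (5 * (c * t)) :=
  Nat.pow_le_pow_right (by norm_num) (by nlinarith)

theorem startSize_le {c t : ℕ} (hc : 1 ≤ c) : startSize c t ≤ 2 ^ (5 * (c * t)) :=
  Nat.pow_le_pow_right (by norm_num) (by nlinarith)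

theorem memory_le_two_pow {w m n c t : ℕ} (hc : 1 ≤ c) (ht : 1 ≤ t) (hw : 16 * (c * t) ≤ w)
    (hm : m ≤ n / 16) (hn : n < 2 ^ w) :
    3 * (m + 1) + shiftSize c t + startSize c t ≤ 2 ^ w := by
  have hshift : shiftSize c t ≤ 2 ^ (5 * (c * t)) := shiftSize_le hc
  have hstart : startSize c t ≤ 2 ^ (5 * (c * t)) := startSize_le hc
  have hct : 1 ≤ c * t := Nat.mul_pos hc ht
  have hpow : 2 ^ 4 * 2 ^ (5 * (c * t)) ≤ 2 ^ w := by
    rw [← pow_add]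
    exact Nat.pow_le_pow_right (by norm_num) (by omega)
  have hpos : 1 ≤ 2 ^ (5 * (c * t)) := Nat.one_le_two_pow
  omega

theorem solvesWithin_blockSearch {w k a t : ℕ} {P Q : List (Fin σ)} (hσ : 2 ≤ σ)
    (hkw : k * Nat.clog 2 σ ≤ w) (hP : 1 ≤ P.length) (hPQ : P.length ≤ Q.length)
    (hQ : Q.length < 2 ^ w) (ha : 4 ≤ a) (ht : t = k / 2 ^ a) (ht1 : 1 ≤ t)
    (hm : P.length ≤ Q.length / 16) :
    SolvesWithin ((algorithm a).compile Var.equiv 0) w k P Q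
      (132 * P.length + 80 + a +
        (21 * t + 15) * (shiftSize (Nat.clog 2 σ) t + startSize (Nat.clog 2 σ) t) +
        90 * (Q.length / t + 1) +
        60 * ((Q.length + t) / t + ((occurrences P Q).card + P.length + t)))
      (42 + (3 * (P.length + 1) + shiftSize (Nat.clog 2 σ) t + startSize (Nat.clog 2 σ) t)) := by
  have hc : 1 ≤ Nat.clog 2 σ := Nat.clog_pos (by norm_num) hσ
  have htk : 2 ^ 4 * t ≤ k := calc
    2 ^ 4 * t ≤ 2 ^ a * t := Nat.mul_le_mul_right t (Nat.pow_le_pow_right (by norm_num) ha)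
    _ ≤ k := ht ▸ Nat.mul_div_le k (2 ^ a)
  have hw : 16 * (Nat.clog 2 σ * t) ≤ w := by nlinarith
  have hmatches := fullMatches_char_le P Q t
  refine solvesWithin_of_ends ((algorithm_ends (problem_packed hσ (by omega) hkw hP hPQ hQ
    (by omega) (memory_le_two_pow hc ht1 hw hm hQ)) (by omega) ht
    (fun _ _ => ⟨ht1, by omega, rfl⟩) rfl rfl rfl rfl rfl rfl rfl).mono_frame ?_)
  rintro T st ⟨hocc, -, hT⟩ -
  exact ⟨hocc, (hT ht1 hm).trans (by omega)⟩

end PackedStrings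

/-! ### Time and space bounds -/

/-- The constant `C` of the time and space bounds for block length `k / 2 ^ a`. There are at most
`2 ^ (a + 1) / κ` times `n / log_σ n` blocks. -/
noncomputable def costConstant (a : ℕ) (κ : ℝ) : ℝ := 2000 + a + 150 * (2 ^ (a + 1) / κ)

section Bounds

variable {n m k a t o : ℕ} {κ l y : ℝ}

theorem exists_le_mul_two_pow {e : ℝ} (he : 0 < e) (b : ℝ) : ∃ a : ℕ, 4 ≤ a ∧ b ≤ e * 2 ^ a := by
  obtain ⟨a, ha⟩ := pow_unbounded_of_one_lt (b / e) (one_lt_two (α := ℝ))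
  refine ⟨max 4 a, le_max_left 4 a, (div_le_iff₀' he).mp (ha.le.trans ?_)⟩
  exact pow_le_pow_right₀ (by norm_num) (le_max_right 4 a)

theorem sqrt_le_div_logb {σ : ℕ} (hn : 2 ≤ n) (hσ : 2 ≤ σ) :
    (n : ℝ) ^ (1 / 2 : ℝ) ≤ 4 * (n / Real.logb σ n) := by
  have hn1 : (1 : ℝ) < n := by exact_mod_cast hn
  have hσ2 : (2 : ℝ) ≤ σ := by exact_mod_cast hσ
  have hlogσ : 1 / 2 < Real.log σ := by
    linarith [Real.log_two_gt_d9, Real.log_le_log (by norm_num) hσ2]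
  have hroot : 0 < (n : ℝ) ^ (1 / 2 : ℝ) := Real.rpow_pos_of_pos (by linarith) _
  have hsq : (n : ℝ) ^ (1 / 2 : ℝ) * (n : ℝ) ^ (1 / 2 : ℝ) = n := by
    rw [← Real.rpow_add (by linarith)]
    norm_num
  have hlogn : Real.log n ≤ (n : ℝ) ^ (1 / 2 : ℝ) / (1 / 2) :=
    Real.log_le_rpow_div (by linarith) (by norm_num)
  have hlogb : Real.logb σ n ≤ 4 * (n : ℝ) ^ (1 / 2 : ℝ) := by
    rw [Real.logb, div_le_iff₀ (by linarith)]
    nlinarith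
  rw [← mul_div_assoc, le_div_iff₀ (Real.logb_pos (by linarith) hn1)]
  calc (n : ℝ) ^ (1 / 2 : ℝ) * Real.logb σ n
      ≤ (n : ℝ) ^ (1 / 2 : ℝ) * (4 * (n : ℝ) ^ (1 / 2 : ℝ)) := by gcongr
    _ = 4 * n := by rw [mul_left_comm, hsq]

theorem rpow_half_le_div_logb {σ : ℕ} {ε : ℝ} (hn : 2 ≤ n) (hσ : 2 ≤ σ) (hε : ε < 1) :
    (n : ℝ) ^ (ε / 2) ≤ 4 * (n / Real.logb σ n) :=
  (Real.rpow_le_rpow_of_exponent_le (by exact_mod_cast (by omega : 1 ≤ n)) (by linarith)).trans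
    (sqrt_le_div_logb hn hσ)

theorem two_pow_le_rpow {w c : ℕ} {b e : ℝ} (hn : 2 ≤ n) (hw : (w : ℝ) ≤ b * Real.logb 2 n)
    (ha : 6 * b ≤ e * 2 ^ a) (hkw : k * c ≤ w) (ht : t * 2 ^ a ≤ k) :
    ((2 ^ (6 * (c * t)) : ℕ) : ℝ) ≤ (n : ℝ) ^ e := by
  have hn1 : (1 : ℝ) < n := by exact_mod_cast hn
  have hlog : 0 < Real.logb 2 n := Real.logb_pos (by norm_num) hn1
  have hctw : (c * t : ℝ) * 2 ^ a ≤ w := by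
    have : c * t * 2 ^ a ≤ w := by nlinarith
    exact_mod_cast this
  have hexp : ((6 * (c * t) : ℕ) : ℝ) ≤ Real.logb 2 n * e := by
    push_cast
    refine le_of_mul_le_mul_right ?_ (by positivity : (0 : ℝ) < 2 ^ a)
    nlinarith
  calc ((2 ^ (6 * (c * t)) : ℕ) : ℝ) = (2 : ℝ) ^ ((6 * (c * t) : ℕ) : ℝ) := by
        rw [Real.rpow_natCast, Nat.cast_pow, Nat.cast_ofNat]
    _ ≤ (2 : ℝ) ^ (Real.logb 2 n * e) := Real.rpow_le_rpow_of_exponent_le (by norm_num) hexp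
    _ = (n : ℝ) ^ e := by
        rw [Real.rpow_mul (by norm_num), Real.rpow_logb (by norm_num) (by norm_num) (by linarith)]

theorem le_two_pow_mul {c : ℕ} (hc : 1 ≤ c) : t ≤ 2 ^ (6 * (c * t)) :=
  (show t ≤ 6 * (c * t) by nlinarith).trans Nat.lt_two_pow_self.le

theorem tableWork_le {c : ℕ} (hc : 1 ≤ c) :
    (21 * t + 15) * (shiftSize c t + startSize c t) ≤ 72 * 2 ^ (6 * (c * t)) := by
  have hshift : shiftSize c t ≤ 2 ^ (5 * (c * t)) := shiftSize_le hc
  have hstart : startSize c t ≤ 2 ^ (5 * (c * t)) := startSize_le hc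
  have ht : t < 2 ^ (c * t) := (Nat.le_mul_of_pos_left t hc).trans_lt Nat.lt_two_pow_self
  calc (21 * t + 15) * (shiftSize c t + startSize c t)
      ≤ 36 * 2 ^ (c * t) * (2 * 2 ^ (5 * (c * t))) := Nat.mul_le_mul (by omega) (by omega)
    _ = 72 * 2 ^ (6 * (c * t)) := by ring

theorem le_costConstant_mul {T s : ℝ} (hκ : 0 < κ) (hm : 1 ≤ m) (hy : 0 ≤ y)
    (hs : s ≤ 2 ^ (a + 1) / κ * y) (hT : T ≤ 2000 * (y + m + o) + a + 150 * s) :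
    T ≤ costConstant a κ * (y + m + o) := by
  have hm1 : (1 : ℝ) ≤ m := by exact_mod_cast hm
  have ha : (a : ℝ) * 1 ≤ a * (y + m + o) := by gcongr; linarith
  have hA : 2 ^ (a + 1) / κ * y ≤ 2 ^ (a + 1) / κ * (y + m + o) := by
    gcongr; linarith
  rw [costConstant]
  linarith

theorem charSearch_time_le (hκ : 0 < κ) (hl : 0 < l) (hlk : κ * l ≤ k) (hm : 1 ≤ m)
    (h : k / 2 ^ a = 0 ∨ n / 16 < m) :
    ((60 * m + 62 * n + a + 20 : ℕ) : ℝ) ≤ costConstant a κ * (n / l + m + o) := by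
  have hy : 0 ≤ (n : ℝ) / l := by positivity
  have hm1 : (1 : ℝ) ≤ m := by exact_mod_cast hm
  rcases h with h | h
  · have hk : (k : ℝ) < 2 ^ a := by
      exact_mod_cast (Nat.div_eq_zero_iff.mp h).resolve_left (by positivity)
    refine le_costConstant_mul (s := n) hκ hm hy ?_ (by push_cast; linarith)
    rw [div_mul_div_comm, le_div_iff₀ (by positivity), mul_comm]
    gcongr
    rw [pow_succ]
    linarith
  · have hn : (n : ℝ) ≤ 16 * m := by exact_mod_cast (by omega : n ≤ 16 * m)
    exact le_costConstant_mul (s := 0) hκ hm hy (by positivity) (by push_cast; linarith)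

theorem blocks_le (hκ : 0 < κ) (hl : 0 < l) (hlk : κ * l ≤ k) (ht : t = k / 2 ^ a) (ht1 : 1 ≤ t) :
    ((n / t : ℕ) : ℝ) ≤ 2 ^ (a + 1) / κ * (n / l) := by
  have hkt : (k : ℝ) ≤ 2 ^ (a + 1) * t := by
    have hlt : k < 2 ^ a * (t + 1) := ht ▸ Nat.lt_mul_div_succ k (by positivity)
    have hle : 2 ^ a * (t + 1) ≤ 2 ^ (a + 1) * t := by
      rw [pow_succ, mul_assoc]
      exact Nat.mul_le_mul_left _ (by omega)
    exact_mod_cast (hlt.trans_le hle).le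
  refine Nat.cast_div_le.trans ?_
  rw [div_mul_div_comm, div_le_div_iff₀ (by exact_mod_cast ht1) (by positivity)]
  nlinarith

theorem blockSearch_time_le {s u : ℕ} (hκ : 0 < κ) (hl : 0 < l) (hlk : κ * l ≤ k) (hm : 1 ≤ m)
    (ht : t = k / 2 ^ a) (ht1 : 1 ≤ t) (hs : s ≤ 72 * u) (htu : t ≤ u)
    (hu : (u : ℝ) ≤ 4 * (n / l)) :
    ((132 * m + 80 + a + s + 90 * (n / t + 1) + 60 * ((n + t) / t + (o + m + t)) : ℕ) : ℝ) ≤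
      costConstant a κ * (n / l + m + o) := by
  have hm1 : (1 : ℝ) ≤ m := by exact_mod_cast hm
  have hsR : (s : ℝ) ≤ 72 * u := by exact_mod_cast hs
  have htR : (t : ℝ) ≤ u := by exact_mod_cast htu
  refine le_costConstant_mul hκ hm (by positivity) (blocks_le hκ hl hlk ht ht1) ?_
  rw [Nat.add_div_right n ht1]
  push_cast
  linarith

theorem charSearch_space_le (hκ : 0 < κ) (hm : 1 ≤ m) (hy : 0 ≤ y) :
    ((42 + (m + 1) : ℕ) : ℝ) ≤ costConstant a κ * (y + m) := by
  have hm1 : (1 : ℝ) ≤ m := by exact_mod_cast hm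
  have hle := le_costConstant_mul (a := a) (o := 0) (s := 0) (T := (42 + (m + 1) : ℕ)) hκ hm hy
    (by positivity) (by push_cast; linarith)
  rwa [Nat.cast_zero, add_zero] at hle

theorem blockSearch_space_le {c : ℕ} (hκ : 0 < κ) (hc : 1 ≤ c) (hm : 1 ≤ m)
    (hy : ((2 ^ (6 * (c * t)) : ℕ) : ℝ) ≤ y) :
    ((42 + (3 * (m + 1) + shiftSize c t + startSize c t) : ℕ) : ℝ) ≤
      costConstant a κ * (y + m) := by
  have hsize : shiftSize c t + startSize c t ≤ 2 * 2 ^ (6 * (c * t)) := calc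
    shiftSize c t + startSize c t ≤ 2 ^ (5 * (c * t)) + 2 ^ (5 * (c * t)) :=
      add_le_add (shiftSize_le hc) (startSize_le hc)
    _ = 2 * 2 ^ (5 * (c * t)) := (two_mul _).symm
    _ ≤ 2 * 2 ^ (6 * (c * t)) := by gcongr <;> norm_num
  have hspace : 42 + (3 * (m + 1) + shiftSize c t + startSize c t) ≤
      48 * m + 2 * 2 ^ (6 * (c * t)) := by omega
  have hcast : ((42 + (3 * (m + 1) + shiftSize c t + startSize c t) : ℕ) : ℝ) ≤
      48 * m + 2 * (2 ^ (6 * (c * t)) : ℕ) := by exact_mod_cast hspace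
  have hy0 : 0 ≤ y := (Nat.cast_nonneg _).trans hy
  have hle := le_costConstant_mul (a := a) (o := 0) (s := 0) hκ hm hy0 (by positivity)
    (hcast.trans (by push_cast at hy ⊢; linarith))
  rwa [Nat.cast_zero, add_zero] at hle

end Bounds

end PackedMatching

open PackedMatching

/-- `b` and `κ` are the constants in "word length `Θ(log n)`" and "`Θ(log n / log σ)` characters per
word" (the matching bounds are `n < 2 ^ w` and `k * ⌈log₂ σ⌉ ≤ w`). One program works for all inputs
and all word lengths in this range. -/
theorem theorem1 (ε : ℝ) (hε0 : 0 < ε) (hε1 : ε < 1) (b κ : ℝ) (hκ : 0 < κ) :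
    ∃ (s : ℕ) (prog : WordRAM.Program s) (C : ℝ),
      ∀ (n m w σ k : ℕ) (P Q : List (Fin σ)),
        P.length = m → Q.length = n → 2 ≤ σ → 1 ≤ m → m ≤ n → 2 ≤ n →
        n < 2 ^ w → (w : ℝ) ≤ b * Real.logb 2 n →
        κ * Real.logb σ n ≤ k → k * Nat.clog 2 σ ≤ w →
        ∃ T S : ℕ, PackedMatching.SolvesWithin prog w k P Q T S ∧
          (T : ℝ) ≤ C * (n / Real.logb σ n + m + (PackedMatching.occurrences P Q).card) ∧
          (S : ℝ) ≤ C * ((n : ℝ) ^ ε + m) := by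
  obtain ⟨a, ha4, ha⟩ := exists_le_mul_two_pow (half_pos hε0) (6 * b)
  refine ⟨42, (algorithm a).compile Var.equiv 0, costConstant a κ, ?_⟩
  rintro n m w σ k P Q rfl rfl hσ hm hmn hn hw hwb hkκ hkw
  have hn1 : (1 : ℝ) < Q.length := by exact_mod_cast hn
  have hl : 0 < Real.logb σ Q.length := Real.logb_pos (by exact_mod_cast hσ) hn1
  have hk : 1 ≤ k := by exact_mod_cast (mul_pos hκ hl).trans_le hkκ
  have hc : 1 ≤ Nat.clog 2 σ := Nat.clog_pos (by norm_num) hσ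
  by_cases h : k / 2 ^ a = 0 ∨ Q.length / 16 < P.length
  · exact ⟨_, _, solvesWithin_charSearch hσ hk hkw hm hmn hw (by omega) h,
      charSearch_time_le hκ hl hkκ hm h, charSearch_space_le hκ hm (by positivity)⟩
  · obtain ⟨t, ht⟩ : ∃ t, t = k / 2 ^ a := ⟨_, rfl⟩
    have ht1 : 1 ≤ t := by omega
    have hpow := two_pow_le_rpow hn hwb ha hkw (ht ▸ Nat.div_mul_le_self k (2 ^ a))
    exact ⟨_, _, solvesWithin_blockSearch hσ hkw hm hmn hw ha4 ht ht1 (by omega),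
      blockSearch_time_le hκ hl hkκ hm ht ht1 (tableWork_le hc) (le_two_pow_mul hc)
        (hpow.trans (rpow_half_le_div_logb hn hσ hε1)),
      blockSearch_space_le hκ hc hm
        (hpow.trans (Real.rpow_le_rpow_of_exponent_le hn1.le (by linarith)))⟩
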